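/- Let $\mathbb{F}$ be a non-archimedean local field and $\mathbb{E}=\mathbb{F}(\alpha)$ a quadratic extension with $\alpha\notin\mathbb{F}$, $\alpha^2\in\mathbb{F}$; write $x=x_1+x_2\alpha$ with $x_1,x_2\in\mathbb{F}$ for $x\in\mathbb{E}$. For $\mathbb{K}\in\{\mathbb{F},\mathbb{E}\}$ let $\mathcal{O}_\mathbb{K}$ be the ring of integers, $q_\mathbb{K}$ the cardinality of the residue field, $\nu_\mathbb{K}$ the normalized valuation, $\varpi_\mathbb{K}$ a uniformizer and $|x|_\mathbb{K}=q_\mathbb{K}^{-\nu_\mathbb{K}(x)}$. Let $dx_1$ be the Haar measure on $\mathbb{F}$ with $\operatorname{vol}(\mathcal{O}_\mathbb{F})=1$ and $dx=dx_1\,dx_2$ on $\mathbb{E}$. For a character $\chi\in\widehat{\mathcal{O}_\mathbb{K}^\times}$ and $s\in\mathbb{C}$ put $\chi_s(x)=\chi(\varpi_\mathbb{K}^{-\nu_\mathbb{K}(x)}x)|x|_\mathbb{K}^s$ $(x\in\mathbb{K}^\times)$. For a multiplicative character $\xi$ of $\mathbb{F}^\times$ let $L(z,\xi)=(1-\xi(\varpi_\mathbb{F})q_\mathbb{F}^{-z})^{-1}$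 if $\xi|_{\mathcal{O}_\mathbb{F}^\times}=1$ and $L(z,\xi)=1$ otherwise. Distributions are linear functionals on the space $C_c^\infty$ of compactly supported locally constant functions, and a family of distributions is called holomorphic if its pairing with every test function is holomorphic. Let $\chi\in\widehat{\mathcal{O}_\mathbb{E}^\times}$ and $\eta\in\widehat{\mathcal{O}_\mathbb{F}^\times}$, and assume $\chi_0(\varpi_\mathbb{F})=1$ (this holds for all $\chi$ if $\varpi_\mathbb{F}$ is a power of $\varpi_\mathbb{E}$), so that $\chi_s|_{\mathbb{F}^\times}=(\chi|_{\mathcal{O}_\mathbb{F}^\times})_{2s}$. For $x\in\mathbb{E}\setminus\mathbb{F}$ put $$K_{s,t}^{\chi,\eta}(x)=\chi_{s-\frac12}(x^2)\,(\chi_{s-\frac12}\eta_{t+\frac12})\Big(\frac{x_2}{x_1^2-x_2^2\alpha^2}\Big).$$ Let $\widetilde K_{s,t}^{\chi,\eta}$, $(s,t)\in\mathbb{C}^2$, be the unique holomorphic family of distributions on $\mathbb{E}$ that for $\operatorname{Re}(2s\pm t+\frac12)>0$ is given by the locally integrable function $L(\frac12,\chi_s|_{\mathbb{F}^\times}\eta_t)^{-1}L(\frac12,\chi_s|_{\mathbb{F}^\times}\eta_t^{-1})^{-1}K_{s,t}^{\chi,\eta}$.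 For $\xi\in\widehat{\mathcal{O}_\mathbb{F}^\times}$ let $\widetilde\xi_s$, $s\in\mathbb{C}$, be the unique holomorphic family of distributions on $\mathbb{F}$ that for $\operatorname{Re}s>-1$ is given by the locally integrable function $L(1,\xi_s)^{-1}\xi_s$, and put $$L_t^\eta(x_1+x_2\alpha)=\widetilde{(\eta^{-2})}_{-2t-1}(x_1)\,\delta(x_2),\qquad\text{i.e. }\langle L_t^\eta,\varphi\rangle=\langle\widetilde{(\eta^{-2})}_{-2t-1},\varphi|_\mathbb{F}\rangle .$$ Fix a non-trivial continuous additive character $\psi$ of $\mathbb{F}$, extended to $\mathbb{E}$ by $\psi(x_1+x_2\alpha)=\psi(x_1)$. Let $c_\mathbb{F}>0$ be the constant in the Fourier inversion formula $f(x)=c_\mathbb{F}\int_\mathbb{F}\psi(-xy)\widehat f(y)\,dy$, $\widehat f(x)=\int_\mathbb{F}\psi(xy)f(y)\,dy$ $(f\in C_c^\infty(\mathbb{F}))$. For a character $\chi$ of $\mathcal{O}_\mathbb{K}^\times$ let $s\mapsto\Gamma(\chi_s)$ be the meromorphic function on $\mathbb{C}$ given for $\operatorname{Re}s>0$ by $$\Gamma(\chi_s)=\lim_{n\to\infty}\int_{q_\mathbb{K}^{-n}\le|x|_\mathbb{K}\le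 q_\mathbb{K}^n}\psi(x)\chi_s(x)|x|_\mathbb{K}^{-1}\,dx .$$ Theorem (Residue identities). The families $\widetilde K^{\chi,\eta}_{s,t}$, $\widetilde{(\eta^{-2})}_s$, the constant $c_\mathbb{F}$ and the gamma factors below exist, and for all $s,t\in\mathbb{C}$: (1) If $\chi|_{\mathcal{O}_\mathbb{F}^\times}\cdot\eta=1$ and $2s+t+\frac12\in\frac{2\pi i}{\ln q_\mathbb{F}}\mathbb{Z}$ (the hyperplane $\backslash\!\backslash$), then $$\widetilde K_{s,t}^{\chi,\eta}=(1-q_\mathbb{F}^{-1})\cdot L_t^\eta .$$ (2) If $\chi|_{\mathcal{O}_\mathbb{F}^\times}\cdot\eta^{-1}=1$ and $2s-t+\frac12\in\frac{2\pi i}{\ln q_\mathbb{F}}\mathbb{Z}$ (the hyperplane $/\!/$), then, with $\delta$ the Dirac distribution at $0\in\mathbb{E}$, $$\widetilde K_{s,t}^{\chi,\eta}=c_\mathbb{F}(1-q_\mathbb{F}^{-1})\,\chi_0(-\alpha)^{-2}\,|\alpha^2|_\mathbb{F}^{-t+\frac12}\,\Gamma\big((\chi^2|_{\mathcal{O}_\mathbb{F}^\times})_{2t}\big)\,\Gamma\big((\chi^{-2})_{-t+\frac12}\big)\,L(\tfrac12,\chi_s|_{\mathbb{F}^\times}\cdot\eta_t)^{-1}\cdot\delta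 ,$$ where at the parameters at which one of the two gamma factors has a pole, the constant is understood as its limit along the hyperplane, i.e. as the limit for $t'\to t$, $t'\neq t$, of its values at $(s',t')=(s+\frac{t'-t}{2},t')$; this limit exists. -/

import Mathlib

open MeasureTheory Filter Topology

noncomputable section

namespace ResidueIdentities

/-! ### Non-archimedean local fields

A non-archimedean local field is a nontrivially normed ultrametric field which is proper
(equivalently, locally compact).  The norm itself carries no normalization; the normalized
absolute value `absVal` is defined below. -/

section LocalField

variable (K : Type*) [NontriviallyNormedField K]

/-- The cardinality `q_K` of the residue field. -/
def residueCard [IsUltrametricDist K] : ℕ :=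
  Nat.card (IsLocalRing.ResidueField (NormedField.valuation (K := K)).valuationSubring)

/-- The group `𝒪_K^×` of units of the ring of integers. -/
def unitGroup : Subgroup Kˣ where
  carrier := {u | ‖(u : K)‖ = 1}
  one_mem' := by simp
  mul_mem' := by
    intro a b ha hb
    simp only [Set.mem_ofPred_eq] at ha hb ⊢
    simp [ha, hb]
  inv_mem' := by
    intro a ha
    simp only [Set.mem_ofPred_eq] at ha ⊢
    simp [ha]

/-- The group of (continuous, unitary) characters of the compact group `𝒪_K^×`. -/
abbrev UnitChar := unitGroup K →ₜ* Circle

/-- A uniformizer of `𝒪_K`: a non-zero element of maximal norm among those of norm `< 1`. -/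
structure Uniformizer where
  val : Kˣ
  norm_lt_one : ‖(val : K)‖ < 1
  le_norm : ∀ x : K, ‖x‖ < 1 → ‖x‖ ≤ ‖(val : K)‖

variable {K}

theorem Uniformizer.exists_ord (ϖ : Uniformizer K) (x : Kˣ) :
    ∃ n : ℤ, ‖(x : K)‖ = ‖(ϖ.val : K)‖ ^ n := by
  have h0 : 0 < ‖(ϖ.val : K)‖ := norm_pos_iff.2 ϖ.val.ne_zero
  have hx : 0 < ‖(x : K)‖ := norm_pos_iff.2 x.ne_zero
  obtain ⟨n, hn1, hn2⟩ := exists_mem_Ico_zpow hx ((one_lt_inv₀ h0).2 ϖ.norm_lt_one)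
  refine ⟨-n, ?_⟩
  rw [inv_zpow', zpow_neg] at hn1
  rw [inv_zpow'] at hn2
  rw [zpow_neg]
  by_contra hne
  have hlt : (‖(ϖ.val : K)‖ ^ n)⁻¹ < ‖(x : K)‖ := lt_of_le_of_ne hn1 (Ne.symm hne)
  -- the inverse of `ϖ ^ (n + 1) * x` would have norm strictly between `‖ϖ‖` and `1`
  have hp : 0 < ‖(ϖ.val : K)‖ ^ n := zpow_pos h0 n
  have key := ϖ.le_norm ((((ϖ.val : K) ^ n) * (x : K))⁻¹) (by
    rw [norm_inv, norm_mul, norm_zpow]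
    apply inv_lt_one_of_one_lt₀
    rwa [inv_lt_iff_one_lt_mul₀ hp, mul_comm] at hlt)
  rw [norm_inv, norm_mul, norm_zpow, inv_le_comm₀ (mul_pos hp hx) h0] at key
  have h2 : ‖(ϖ.val : K)‖ ^ n * ‖(x : K)‖ < ‖(ϖ.val : K)‖⁻¹ := by
    calc ‖(ϖ.val : K)‖ ^ n * ‖(x : K)‖
        < ‖(ϖ.val : K)‖ ^ n * ‖(ϖ.val : K)‖ ^ (-(n + 1)) := mul_lt_mul_of_pos_left hn2 hp
      _ = ‖(ϖ.val : K)‖⁻¹ := by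
        rw [← zpow_add₀ h0.ne', ← zpow_neg_one]; congr 1; ring
  exact absurd key (not_le.2 h2)

/-- The normalized valuation `ν_K(x)` of `x ∈ K^×`. -/
def ord (ϖ : Uniformizer K) (x : Kˣ) : ℤ := (ϖ.exists_ord x).choose

theorem norm_eq_zpow_ord (ϖ : Uniformizer K) (x : Kˣ) :
    ‖(x : K)‖ = ‖(ϖ.val : K)‖ ^ ord ϖ x := (ϖ.exists_ord x).choose_spec

theorem ord_mul (ϖ : Uniformizer K) (x y : Kˣ) : ord ϖ (x * y) = ord ϖ x + ord ϖ y := by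
  have h0 : 0 < ‖(ϖ.val : K)‖ := norm_pos_iff.2 ϖ.val.ne_zero
  apply zpow_right_injective₀ h0 ϖ.norm_lt_one.ne
  simp only
  rw [← norm_eq_zpow_ord, zpow_add₀ h0.ne', ← norm_eq_zpow_ord, ← norm_eq_zpow_ord,
    Units.val_mul, norm_mul]

/-- The unit part `ϖ^{-ν(x)} x ∈ 𝒪_K^×` of `x ∈ K^×`. -/
def unitPart (ϖ : Uniformizer K) (x : Kˣ) : unitGroup K :=
  ⟨ϖ.val ^ (-ord ϖ x) * x, by
    have h0 : 0 < ‖(ϖ.val : K)‖ := norm_pos_iff.2 ϖ.val.ne_zero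
    change ‖((ϖ.val ^ (-ord ϖ x) * x : Kˣ) : K)‖ = 1
    rw [Units.val_mul, Units.val_zpow_eq_zpow_val, norm_mul, norm_zpow, norm_eq_zpow_ord ϖ x,
      ← zpow_add₀ h0.ne']
    simp⟩

theorem unitPart_mul (ϖ : Uniformizer K) (x y : Kˣ) :
    unitPart ϖ (x * y) = unitPart ϖ x * unitPart ϖ y := by
  ext1
  change ϖ.val ^ (-ord ϖ (x * y)) * (x * y)
    = (ϖ.val ^ (-ord ϖ x) * x) * (ϖ.val ^ (-ord ϖ y) * y)
  rw [ord_mul, neg_add, zpow_add]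
  exact mul_mul_mul_comm _ _ _ _

variable [IsUltrametricDist K]

/-- The normalized absolute value `|x|_K = q_K^{-ν(x)}`, with `|0|_K = 0`. -/
def absVal (ϖ : Uniformizer K) (x : K) : ℝ :=
  open Classical in
  if h : x = 0 then 0 else (residueCard K : ℝ) ^ (-ord ϖ (Units.mk0 x h))

/-- The multiplicative character `χ_s(x) = χ(ϖ^{-ν(x)} x) |x|^s` of `K^×`, where
`|x|^s = exp(s log |x|)` and `log |x| = -ν(x) log q`. -/
def twist (ϖ : Uniformizer K) (χ : UnitChar K) (s : ℂ) : Kˣ →* ℂˣ :=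
  MonoidHom.mk'
    (fun x => Circle.toUnits (χ (unitPart ϖ x)) *
      Units.mk0 (Complex.exp (s * (-(ord ϖ x : ℂ) * Real.log (residueCard K))))
        (Complex.exp_ne_zero _))
    (by
      intro x y
      rw [unitPart_mul, map_mul, map_mul]
      refine Eq.trans ?_ (mul_mul_mul_comm _ _ _ _)
      congr 1
      ext
      simp only [Units.val_mul, Units.val_mk0, ← Complex.exp_add, ord_mul]
      congr 1
      push_cast
      ring)

/-- A multiplicative character of `K^×` as a function on `K`, with value `0` at `0`. -/
def charFun (ξ : Kˣ →* ℂˣ) (x : K) : ℂ :=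
  open Classical in
  if h : x = 0 then 0 else (ξ (Units.mk0 x h) : ℂ)

/-- The local `L`-factor `L(z, ξ)` of a multiplicative character `ξ` of `K^×`:
`(1 - ξ(ϖ) q^{-z})⁻¹` if `ξ` is trivial on `𝒪_K^×`, and `1` otherwise. -/
def localL (ϖ : Uniformizer K) (z : ℂ) (ξ : Kˣ →* ℂˣ) : ℂ :=
  open Classical in
  if ∀ u ∈ unitGroup K, ξ u = 1 then (1 - (ξ ϖ.val : ℂ) * (residueCard K : ℂ) ^ (-z))⁻¹ else 1

end LocalField

/-! ### Test functions and distributions -/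

section Distributions

/-- The space `C_c^∞(X)` of locally constant functions with compact support. -/
def testFun (X : Type*) [TopologicalSpace X] : Submodule ℂ (X → ℂ) where
  carrier := {f | IsLocallyConstant f ∧ HasCompactSupport f}
  zero_mem' := ⟨IsLocallyConstant.const 0, HasCompactSupport.zero⟩
  add_mem' hf hg := ⟨hf.1.add hg.1, hf.2.add hg.2⟩
  smul_mem' c _ hf := ⟨hf.1.comp (fun z => c • z), hf.2.smul_left (f := fun _ => c)⟩

/-- Distributions on `X`: all linear functionals on `C_c^∞(X)`. -/
abbrev Distribution (X : Type*) [TopologicalSpace X] := Module.Dual ℂ (testFun X)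

/-- The Dirac distribution at `x`. -/
def dirac {X : Type*} [TopologicalSpace X] (x : X) : Distribution X where
  toFun φ := φ.1 x
  map_add' _ _ := rfl
  map_smul' _ _ := rfl

/-- The Haar measure of a local field for which the ring of integers has measure `1`. -/
def haarO (K : Type*) [NontriviallyNormedField K] [ProperSpace K] [MeasurableSpace K]
    [BorelSpace K] : Measure K :=
  Measure.addHaarMeasure
    ⟨⟨Metric.closedBall 0 1, isCompact_closedBall 0 1⟩,
      ⟨0, Metric.ball_subset_interior_closedBall (Metric.mem_ball_self one_pos)⟩⟩

variable {K : Type*} [NontriviallyNormedField K] [IsUltrametricDist K] [MeasurableSpace K]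

/-- `D : ℂ → 𝒟'(K)` is the normalized family `s ↦ ξ~_s = L(1, ξ_s)⁻¹ ξ_s` of homogeneous
distributions: it is holomorphic in `s ∈ ℂ` and is given by the locally integrable function
`L(1, ξ_s)⁻¹ ξ_s` for `Re s > -1`.  There is exactly one such family. -/
def IsHomogeneousFamily (μ : Measure K) (ϖ : Uniformizer K) (ξ : UnitChar K)
    (D : ℂ → Distribution K) : Prop :=
  (∀ φ : testFun K, Differentiable ℂ fun s => D s φ) ∧
  ∀ s : ℂ, -1 < s.re → ∀ φ : testFun K,
    D s φ = (localL ϖ 1 (twist ϖ ξ s))⁻¹ * ∫ x, charFun (twist ϖ ξ s) x * φ.1 x ∂μ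

/-- The family `ξ~_s`, `s ∈ ℂ`, of normalized homogeneous distributions on `K`. -/
def homogeneousFamily (μ : Measure K) (ϖ : Uniformizer K) (ξ : UnitChar K) : ℂ → Distribution K :=
  Classical.epsilon (IsHomogeneousFamily μ ϖ ξ)

/-- `G : ℂ → ℂ` is the gamma factor `s ↦ Γ(χ_s)`: the meromorphic function on `ℂ` (in normal form,
so with value `0` at its poles) with
`Γ(χ_s) = lim_{n → ∞} ∫_{q^{-n} ≤ |x| ≤ q^n} ψ(x) χ_s(x) |x|⁻¹ dx` for `Re s > 0`.
There is exactly one such function.  For `χ ≠ 1` it is entire and is given by the same limit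
for all `s`. -/
def IsGammaFactor (μ : Measure K) (ϖ : Uniformizer K) (ψ : AddChar K Circle) (χ : UnitChar K)
    (G : ℂ → ℂ) : Prop :=
  MeromorphicNFOn G Set.univ ∧
  ∀ s : ℂ, 0 < s.re → Tendsto
    (fun n : ℕ =>
      ∫ x in {x : K | (residueCard K : ℝ) ^ (-(n : ℤ)) ≤ absVal ϖ x ∧
          absVal ϖ x ≤ (residueCard K : ℝ) ^ (n : ℤ)},
        (ψ x : ℂ) * charFun (twist ϖ χ s) x * ((absVal ϖ x)⁻¹ : ℝ) ∂μ)
    atTop (𝓝 (G s))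

/-- The gamma factor `s ↦ Γ(χ_s)`. -/
def gammaFactor (μ : Measure K) (ϖ : Uniformizer K) (ψ : AddChar K Circle) (χ : UnitChar K) :
    ℂ → ℂ :=
  Classical.epsilon (IsGammaFactor μ ϖ ψ χ)

/-- The Fourier transform `f^(x) = ∫ ψ(x y) f(y) dy`. -/
def fourier (μ : Measure K) (ψ : AddChar K Circle) (f : K → ℂ) (x : K) : ℂ :=
  ∫ y, (ψ (x * y) : ℂ) * f y ∂μ

/-- `c > 0` is the constant in the Fourier inversion formula
`f(x) = c ∫ ψ(-x y) f^(y) dy` for `f ∈ C_c^∞(K)`.  There is exactly one such constant. -/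
def IsFourierConst (μ : Measure K) (ψ : AddChar K Circle) (c : ℝ) : Prop :=
  0 < c ∧ ∀ f ∈ testFun K, ∀ x : K,
    f x = c * ∫ y, (ψ (-(x * y)) : ℂ) * fourier μ ψ f y ∂μ

/-- The constant `c_K` in the Fourier inversion formula. -/
def fourierConst (μ : Measure K) (ψ : AddChar K Circle) : ℝ :=
  Classical.epsilon (IsFourierConst μ ψ)

end Distributions

/-! ### Quadratic extensions -/

section Quadratic

variable (F E : Type*) [NontriviallyNormedField F] [NontriviallyNormedField E] [NormedAlgebra F E]

/-- A presentation `E = F(α)` of a quadratic extension with `α² = a ∈ F`, `α ∉ F`. -/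
structure QuadraticGenerator where
  α : E
  a : F
  sq : α ^ 2 = algebraMap F E a
  notMem : α ∉ Set.range (algebraMap F E)
  finrank_eq : Module.finrank F E = 2

variable {F E}

/-- The coordinates `(x₁, x₂) ↦ x₁ + x₂ α` identifying `F × F` with `E`. -/
def QuadraticGenerator.coord (Q : QuadraticGenerator F E) : (F × F) ≃ₗ[F] E :=
  haveI : FiniteDimensional F E := Module.finite_of_finrank_eq_succ Q.finrank_eq
  LinearEquiv.ofInjectiveOfFinrankEq
    ((Algebra.linearMap F E).coprod (LinearMap.toSpanSingleton F E Q.α))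
    (by
      rw [← LinearMap.ker_eq_bot, LinearMap.ker_eq_bot']
      rintro ⟨x, y⟩ h
      simp only [LinearMap.coprod_apply, Algebra.linearMap_apply,
        LinearMap.toSpanSingleton_apply, Algebra.smul_def] at h
      have hy : y = 0 := by
        by_contra hy
        have hy' : algebraMap F E y ≠ 0 := by simpa using hy
        refine Q.notMem ⟨-x / y, ?_⟩
        rw [map_div₀, map_neg, div_eq_iff hy']
        linear_combination -h
      subst hy
      simpa using h)
    (by rw [Q.finrank_eq]; simp)

theorem QuadraticGenerator.coord_apply (Q : QuadraticGenerator F E) (p : F × F) :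
    Q.coord p = algebraMap F E p.1 + algebraMap F E p.2 * Q.α := by
  rw [← Algebra.smul_def]
  rfl

/-- The restriction of a multiplicative character of `E^×` to `F^×`. -/
def resChar (ξ : Eˣ →* ℂˣ) : Fˣ →* ℂˣ := ξ.comp (Units.map (algebraMap F E : F →* E))

/-- The restriction of a character of `𝒪_E^×` to `𝒪_F^×`. -/
def resUnitChar (χ : UnitChar E) : UnitChar F where
  toFun u := χ ⟨Units.map (algebraMap F E : F →* E) u, by
    have hu : ‖((u : Fˣ) : F)‖ = 1 := u.2
    change ‖algebraMap F E ((u : Fˣ) : F)‖ = 1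
    rw [norm_algebraMap', hu]⟩
  map_one' := by
    rw [← map_one χ]; congr 1; ext1; exact map_one _
  map_mul' u v := by
    rw [← map_mul χ]; congr 1; ext1; exact map_mul _ _ _
  continuous_toFun := by
    refine (map_continuous χ).comp (Continuous.subtype_mk ?_ _)
    exact (Continuous.units_map (algebraMap F E : F →* E)
      (algebraMapCLM F E).continuous).comp continuous_subtype_val

/-- The additive character `ψ(x₁ + x₂ α) = ψ(x₁)` of `E`. -/
def QuadraticGenerator.extendAddChar (Q : QuadraticGenerator F E) (ψ : AddChar F Circle) :
    AddChar E Circle :=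
  ψ.compAddMonoidHom
    ((LinearMap.fst F F F).toAddMonoidHom.comp Q.coord.symm.toLinearMap.toAddMonoidHom)

variable [ProperSpace F] [ProperSpace E]

/-- The restriction of test functions from `E` to `F`. -/
def restrictTest : testFun E →ₗ[ℂ] testFun F where
  toFun φ := ⟨fun x => φ.1 (algebraMap F E x),
    φ.2.1.comp_continuous (algebraMapCLM F E).continuous,
    φ.2.2.comp_isClosedEmbedding (algebraMap_isometry F E).isClosedEmbedding⟩
  map_add' _ _ := rfl
  map_smul' _ _ := rfl

variable [MeasurableSpace F] [BorelSpace F] [MeasurableSpace E]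

/-- The Haar measure `dx = dx₁ dx₂` on `E`, `x = x₁ + x₂ α`. -/
def QuadraticGenerator.haarE (Q : QuadraticGenerator F E) : Measure E :=
  ((haarO F).prod (haarO F)).map Q.coord

variable [IsUltrametricDist F] [IsUltrametricDist E]

/-- The function
`K(x) = χ_{s-1/2}(x²) (χ_{s-1/2} η_{t+1/2})(x₂ / (x₁² - x₂² α²))` for `x = x₁ + x₂ α`, `x₂ ≠ 0`
(and `K(x) = 0` on the null set `x₂ = 0`). -/
def kernelFun (Q : QuadraticGenerator F E) (ϖF : Uniformizer F) (ϖE : Uniformizer E)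
    (χ : UnitChar E) (η : UnitChar F) (s t : ℂ) (x : E) : ℂ :=
  let x₁ := (Q.coord.symm x).1
  let x₂ := (Q.coord.symm x).2
  charFun (twist ϖE χ (s - 1 / 2)) (x ^ 2) *
    charFun (resChar (twist ϖE χ (s - 1 / 2)) * twist ϖF η (t + 1 / 2))
      (x₂ / (x₁ ^ 2 - x₂ ^ 2 * Q.a))

/-- `T : ℂ → ℂ → 𝒟'(E)` is the renormalized family
`L(1/2, χ_s|_{F^×} η_t)⁻¹ L(1/2, χ_s|_{F^×} η_t⁻¹)⁻¹ K_{s,t}` extended holomorphically to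
`(s, t) ∈ ℂ²`: it is holomorphic, and is given by this locally integrable function for
`Re (2 s ± t + 1/2) > 0`.  There is exactly one such family. -/
def IsRenormalizedKernel (Q : QuadraticGenerator F E) (ϖF : Uniformizer F) (ϖE : Uniformizer E)
    (χ : UnitChar E) (η : UnitChar F) (T : ℂ → ℂ → Distribution E) : Prop :=
  (∀ φ : testFun E, Differentiable ℂ fun p : ℂ × ℂ => T p.1 p.2 φ) ∧
  ∀ s t : ℂ, 0 < (2 * s + t + 1 / 2).re → 0 < (2 * s - t + 1 / 2).re → ∀ φ : testFun E,
    T s t φ =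
      (localL ϖF (1 / 2) (resChar (twist ϖE χ s) * twist ϖF η t))⁻¹ *
      (localL ϖF (1 / 2) (resChar (twist ϖE χ s) * (twist ϖF η t)⁻¹))⁻¹ *
      ∫ x, kernelFun Q ϖF ϖE χ η s t x * φ.1 x ∂Q.haarE

/-- The renormalized kernel `K~_{s,t}^{χ,η}` as a holomorphic family of distributions on `E`. -/
def renormalizedKernel (Q : QuadraticGenerator F E) (ϖF : Uniformizer F) (ϖE : Uniformizer E)
    (χ : UnitChar E) (η : UnitChar F) : ℂ → ℂ → Distribution E :=
  Classical.epsilon (IsRenormalizedKernel Q ϖF ϖE χ η)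

/-- The distribution `L_t^η(x₁ + x₂ α) = (η⁻²)~_{-2t-1}(x₁) δ(x₂)` on `E`. -/
def lineDistribution (ϖF : Uniformizer F) (η : UnitChar F) (t : ℂ) : Distribution E :=
  (homogeneousFamily (haarO F) ϖF (η ^ 2)⁻¹ (-2 * t - 1)).comp restrictTest

/-- The set `\` of parameters: `χ|_{𝒪_F^×} η = 1` and `2s + t + 1/2 ∈ (2πi / ln q_F) ℤ`. -/
def InBackslash (χ : UnitChar E) (s : ℂ) (η : UnitChar F) (t : ℂ) : Prop :=
  resUnitChar χ * η = 1 ∧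
    ∃ k : ℤ, 2 * s + t + 1 / 2 = 2 * Real.pi * Complex.I / Real.log (residueCard F) * k

/-- The set `//` of parameters: `χ|_{𝒪_F^×} η⁻¹ = 1` and `2s - t + 1/2 ∈ (2πi / ln q_F) ℤ`. -/
def InSlash (χ : UnitChar E) (s : ℂ) (η : UnitChar F) (t : ℂ) : Prop :=
  resUnitChar χ * η⁻¹ = 1 ∧
    ∃ k : ℤ, 2 * s - t + 1 / 2 = 2 * Real.pi * Complex.I / Real.log (residueCard F) * k

/-- The constant
`c_F (1 - q_F⁻¹) χ₀(-α)⁻² |α²|_F^{-t+1/2} Γ((χ²|_{𝒪_F^×})_{2t}) Γ((χ⁻²)_{-t+1/2})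
  L(1/2, χ_s|_{F^×} η_t)⁻¹`. -/
def residueConst (Q : QuadraticGenerator F E) (ϖF : Uniformizer F) (ϖE : Uniformizer E)
    (ψ : AddChar F Circle) (χ : UnitChar E) (η : UnitChar F) (s t : ℂ) : ℂ :=
  fourierConst (haarO F) ψ * (1 - (residueCard F : ℂ)⁻¹) *
    (charFun (twist ϖE χ 0) (-Q.α) ^ 2)⁻¹ * (absVal ϖF Q.a : ℂ) ^ (-t + 1 / 2) *
    gammaFactor (haarO F) ϖF ψ (resUnitChar (χ ^ 2)) (2 * t) *
    gammaFactor Q.haarE ϖE (Q.extendAddChar ψ) (χ ^ 2)⁻¹ (-t + 1 / 2) *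
    (localL ϖF (1 / 2) (resChar (twist ϖE χ s) * twist ϖF η t))⁻¹

end Quadratic

end ResidueIdentities

end

/-!
Residue identities for the renormalized kernels on a quadratic extension `E = F(α)`.

*Regularization by scaling.*  Let `ξ` be a character of `𝒪_F^×`.  There are `b ∈ F^×` and `c ∈ ℂ`
such that `c (1 - ξ_z(b)) = L(z, ξ)⁻¹` for all `z` (`scaleUnit`, `scaleConst`, `scaleConst_mul`):
the uniformizer and `1` if `ξ = 1`, a unit with `ξ(b) ≠ 1` otherwise.  By homogeneity, pairing `ξ_s`
with `φ - φ(b⁻¹ ·)` multiplies `⟨ξ_s, φ⟩` by `1 - ξ_{s+1}(b)`, and this difference vanishes near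
`0`, so that `c ∫ ξ_s (φ - φ(b⁻¹ ·))` is the entire continuation of `L(1, ξ_s)⁻¹ ξ_s` (`homDist`).
In the coordinates `x = x₁ + x₂ α` the kernel is `(χ|_F η)_{2s+t-1/2}(x₂)` times a function that is
homogeneous under `F^×` and locally constant away from the origin of `E` (`smoothPart`).  Scaling
once in `E`, to vanish near the origin, and once more in `x₂` gives the entire family `kernelDist`,
which is the renormalized kernel (`isRenormalizedKernel_kernelDist`, `renormalizedKernel_eq`).

*The hyperplane `\`.*  There the factor in `x₂` is `|x₂|⁻¹` paired with a difference
`g - g(ϖ⁻¹ ·)`, and such an integral is `(1 - q⁻¹) g(0)` (`integral_absVal_inv_mul_subComp`).  What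
remains is the integral defining the homogeneous distribution on `F`
(`kernelDist_eq_lineDistribution`).

*The hyperplane `//`.*  For `Re t > 0` the substitution `x₁ = x₂ u` applies; on each line
`F (u + α)` the same one-dimensional identity produces `(1 - q⁻¹) φ(0)`, and the kernel is a multiple of the
Dirac distribution with the integral of `(χ⁻²)_{-t-1/2}` over the affine line `F + α` as a factor
(`kernelDist_eq_of_inSlash_of_re_pos`).  Both sides are entire along the hyperplane, so the kernel
is a multiple of the Dirac distribution everywhere on it (`kernelDist_eq_smul_dirac`).

*The constant.*  For `0 < Re t < 1/2` the line integral is a product of two gamma factors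
(`integral_quasiChar_coord_one`): integrate `f(u₂) (χ⁻²)_{-t-1/2}(u)` over `E`, where `f` is the
character `χ²` of the unit sphere of `F`.  Slicing along `u₂` gives the line integral.  Fourier
inversion for `f` and the substitution `u ↦ -α y⁻¹ u` turn the same integral into the gamma factor
of `E` times `∫ (χ²)_{2t-1} f^`, which is the gamma factor of `F`.  The general case follows from the
identity principle for meromorphic functions along the hyperplane (`eventually_residueConst_eq`).
-/

noncomputable section

set_option linter.unusedSectionVars false

namespace ResidueIdentities

/-! ### The module of a local field -/

section Module

open scoped Pointwise

variable {K : Type*} [NontriviallyNormedField K]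

theorem Uniformizer.norm_pos (ϖ : Uniformizer K) : 0 < ‖(ϖ.val : K)‖ :=
  norm_pos_iff.2 ϖ.val.ne_zero

theorem exists_norm_eq_zpow (ϖ : Uniformizer K) {x : K} (hx : x ≠ 0) :
    ∃ k : ℤ, ‖x‖ = ‖(ϖ.val : K)‖ ^ k := ϖ.exists_ord (Units.mk0 x hx)

theorem ord_eq_of_norm_eq (ϖ : Uniformizer K) {x : Kˣ} {n : ℤ}
    (h : ‖(x : K)‖ = ‖(ϖ.val : K)‖ ^ n) : ord ϖ x = n := by
  apply zpow_right_injective₀ ϖ.norm_pos ϖ.norm_lt_one.ne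
  simp only
  rw [← norm_eq_zpow_ord, h]

theorem ord_uniformizer (ϖ : Uniformizer K) : ord ϖ ϖ.val = 1 :=
  ord_eq_of_norm_eq ϖ (by simp)

theorem ord_eq_zero (ϖ : Uniformizer K) {x : Kˣ} (h : ‖(x : K)‖ = 1) : ord ϖ x = 0 :=
  ord_eq_of_norm_eq ϖ (by simpa using h)

variable [IsUltrametricDist K]

theorem mem_valuationSubring_iff {x : K} :
    x ∈ (NormedField.valuation (K := K)).valuationSubring ↔ ‖x‖ ≤ 1 := by
  rw [Valuation.mem_valuationSubring_iff]
  exact NNReal.coe_le_coe (r₁ := ‖x‖₊) (r₂ := 1)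

theorem residue_eq_residue_iff (x y : (NormedField.valuation (K := K)).valuationSubring) :
    IsLocalRing.residue _ x = IsLocalRing.residue _ y ↔ ‖(x : K) - y‖ < 1 := by
  rw [← sub_eq_zero, ← map_sub, IsLocalRing.residue_eq_zero_iff, IsLocalRing.mem_maximalIdeal,
    mem_nonunits_iff, isUnit_iff_exists_inv]
  have hz : ‖(x : K) - y‖ ≤ 1 := mem_valuationSubring_iff.1 (x - y).2
  refine ⟨fun h => lt_of_le_of_ne hz fun h1 => h ?_, fun h ⟨w, hw⟩ => ?_⟩
  · have h0 : (x : K) - y ≠ 0 := norm_ne_zero_iff.1 (by rw [h1]; exact one_ne_zero)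
    refine ⟨⟨((x : K) - y)⁻¹, mem_valuationSubring_iff.2 (by rw [norm_inv, h1, inv_one])⟩, ?_⟩
    ext
    exact mul_inv_cancel₀ h0
  · have h1 : ((x : K) - y) * w = 1 := congrArg Subtype.val hw
    have h2 := congrArg norm h1
    rw [norm_mul, norm_one] at h2
    have h3 : ‖(w : K)‖ ≤ 1 := mem_valuationSubring_iff.1 w.2
    exact absurd h2 (mul_lt_one_of_nonneg_of_lt_one_left (norm_nonneg _) h h3).ne

/-- The unit ball is the disjoint union of `q` translates of the maximal ideal. -/
theorem measure_closedBall_eq [ProperSpace K] [MeasurableSpace K] [BorelSpace K] (μ : Measure K)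
    [μ.IsAddHaarMeasure] :
    Finite (IsLocalRing.ResidueField (NormedField.valuation (K := K)).valuationSubring) ∧
    μ (Metric.closedBall 0 1) = residueCard K * μ (Metric.ball 0 1) := by
  let R := (NormedField.valuation (K := K)).valuationSubring
  let k := IsLocalRing.ResidueField R
  choose r hr using IsLocalRing.residue_surjective (R := R)
  have hdisj : Pairwise (Function.onFun Disjoint fun a : k => Metric.ball (r a : K) 1) := by
    intro a b hab
    refine Set.disjoint_left.2 fun x hxa hxb => hab ?_
    rw [← hr a, ← hr b, residue_eq_residue_iff]
    rw [mem_ball_iff_norm] at hxa hxb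
    rw [norm_sub_rev] at hxa
    have := IsUltrametricDist.norm_add_le_max ((r a : K) - x) (x - r b)
    rw [sub_add_sub_cancel] at this
    exact this.trans_lt (max_lt hxa hxb)
  have hU : ⋃ a : k, Metric.ball (r a : K) 1 = Metric.closedBall 0 1 := by
    ext x
    simp only [Set.mem_iUnion, mem_ball_iff_norm, mem_closedBall_zero_iff]
    constructor
    · rintro ⟨a, ha⟩
      have h1 : ‖(r a : K)‖ ≤ 1 := mem_valuationSubring_iff.1 (r a).2
      have := IsUltrametricDist.norm_add_le_max (x - r a) (r a)
      rw [sub_add_cancel] at this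
      exact this.trans (max_le ha.le h1)
    · intro hx
      let y : R := ⟨x, mem_valuationSubring_iff.2 hx⟩
      exact ⟨IsLocalRing.residue R y, (residue_eq_residue_iff y _).1 (hr _).symm⟩
  have hball : ∀ x : K, μ (Metric.ball x 1) = μ (Metric.ball 0 1) := fun x =>
    (Measure.addHaar_ball_center μ x 1)
  have hpos : 0 < μ (Metric.ball (0 : K) 1) := Metric.measure_ball_pos μ 0 one_pos
  have hfin : Finite k := by
    have := Measure.finite_const_le_meas_of_disjoint_iUnion μ hpos
      (As := fun a : k => Metric.ball (r a : K) 1) (fun _ => measurableSet_ball) hdisj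
      (by rw [hU]; exact (isCompact_closedBall _ _).measure_ne_top)
    simp only [hball, le_refl] at this
    exact Set.finite_univ_iff.1 this
  refine ⟨hfin, ?_⟩
  rw [← hU, measure_iUnion hdisj fun _ => measurableSet_ball]
  have := Fintype.ofFinite k
  simp only [hball, tsum_fintype, Finset.sum_const, Finset.card_univ, nsmul_eq_mul]
  rw [residueCard, Nat.card_eq_fintype_card]

theorem one_lt_residueCard (K : Type*) [NontriviallyNormedField K] [IsUltrametricDist K]
    [ProperSpace K] : 1 < residueCard K := by
  borelize K
  have := (measure_closedBall_eq (K := K) Measure.addHaar).1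
  exact Finite.one_lt_card

theorem ball_eq_smul_closedBall (ϖ : Uniformizer K) :
    Metric.ball (0 : K) 1 = (fun x => (ϖ.val : K) * x) '' Metric.closedBall 0 1 := by
  ext x
  simp only [mem_ball_zero_iff, Set.mem_image, mem_closedBall_zero_iff]
  constructor
  · intro hx
    refine ⟨(ϖ.val : K)⁻¹ * x, ?_, by simp⟩
    rw [norm_mul, norm_inv, inv_mul_le_one₀ ϖ.norm_pos]
    exact ϖ.le_norm x hx
  · rintro ⟨y, hy, rfl⟩
    rw [norm_mul]
    exact (mul_le_of_le_one_right (norm_nonneg _) hy).trans_lt ϖ.norm_lt_one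

theorem absVal_zero (ϖ : Uniformizer K) : absVal ϖ 0 = 0 := by simp [absVal]

theorem absVal_units (ϖ : Uniformizer K) (x : Kˣ) :
    absVal ϖ (x : K) = (residueCard K : ℝ) ^ (-ord ϖ x) := by
  simp [absVal]

variable [ProperSpace K]

theorem residueCard_pos (K : Type*) [NontriviallyNormedField K] [IsUltrametricDist K]
    [ProperSpace K] : (0 : ℝ) < residueCard K := by
  exact_mod_cast (one_lt_residueCard K).le

theorem absVal_pos (ϖ : Uniformizer K) {x : K} (hx : x ≠ 0) : 0 < absVal ϖ x := by
  rw [← Units.val_mk0 hx, absVal_units]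
  exact zpow_pos (residueCard_pos K) _

theorem absVal_nonneg (ϖ : Uniformizer K) (x : K) : 0 ≤ absVal ϖ x := by
  rcases eq_or_ne x 0 with rfl | hx
  · rw [absVal_zero]
  · exact (absVal_pos ϖ hx).le

/-- The exponent `κ` for which `|x| = ‖x‖ ^ κ`. -/
def normExponent (ϖ : Uniformizer K) : ℝ := Real.log (residueCard K) / -Real.log ‖(ϖ.val : K)‖

theorem log_residueCard_pos (K : Type*) [NontriviallyNormedField K] [IsUltrametricDist K]
    [ProperSpace K] : 0 < Real.log (residueCard K) :=
  Real.log_pos (by exact_mod_cast one_lt_residueCard K)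

theorem normExponent_pos (ϖ : Uniformizer K) : 0 < normExponent ϖ :=
  div_pos (log_residueCard_pos K) (neg_pos.2 (Real.log_neg ϖ.norm_pos ϖ.norm_lt_one))

theorem absVal_eq_norm_rpow (ϖ : Uniformizer K) (x : K) :
    absVal ϖ x = ‖x‖ ^ normExponent ϖ := by
  rcases eq_or_ne x 0 with rfl | hx
  · rw [absVal_zero, norm_zero, Real.zero_rpow (normExponent_pos ϖ).ne']
  have h1 := absVal_units ϖ (Units.mk0 x hx)
  have h2 := norm_eq_zpow_ord ϖ (Units.mk0 x hx)
  rw [Units.val_mk0] at h1 h2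
  have hl : Real.log ‖(ϖ.val : K)‖ ≠ 0 := (Real.log_neg ϖ.norm_pos ϖ.norm_lt_one).ne
  apply Real.log_injOn_pos (absVal_pos ϖ hx)
    (Set.mem_Ioi.2 (Real.rpow_pos_of_pos (norm_pos_iff.2 hx) _))
  rw [Real.log_rpow (norm_pos_iff.2 hx), h1, h2, Real.log_zpow, Real.log_zpow, normExponent]
  push_cast
  field_simp

theorem absVal_le_iff (ϖ : Uniformizer K) (x y : K) : absVal ϖ x ≤ absVal ϖ y ↔ ‖x‖ ≤ ‖y‖ := by
  rw [absVal_eq_norm_rpow, absVal_eq_norm_rpow]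
  exact Real.rpow_le_rpow_iff (norm_nonneg _) (norm_nonneg _) (normExponent_pos ϖ)

theorem absVal_of_norm_eq_one (ϖ : Uniformizer K) {x : K} (hx : ‖x‖ = 1) : absVal ϖ x = 1 := by
  rw [absVal_eq_norm_rpow, hx, Real.one_rpow]

theorem absVal_one (ϖ : Uniformizer K) : absVal ϖ (1 : K) = 1 := absVal_of_norm_eq_one ϖ norm_one

theorem absVal_inv (ϖ : Uniformizer K) (x : K) : absVal ϖ x⁻¹ = (absVal ϖ x)⁻¹ := by
  rw [absVal_eq_norm_rpow, absVal_eq_norm_rpow, norm_inv, Real.inv_rpow (norm_nonneg _)]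

variable [MeasurableSpace K] [BorelSpace K]

/-- The normalized absolute value is the module of the field. -/
theorem distribHaarChar_eq (ϖ : Uniformizer K) (x : Kˣ) :
    (distribHaarChar K x : ℝ) = absVal ϖ (x : K) := by
  have hunit : ∀ u : Kˣ, ‖(u : K)‖ = 1 → distribHaarChar K u = 1 := by
    intro u hu
    refine distribHaarChar_eq_of_measure_smul_eq_mul (μ := Measure.addHaar)
      (s := Metric.closedBall (0 : K) 1) (Metric.measure_closedBall_pos _ _ one_pos).ne'
      (isCompact_closedBall _ _).measure_ne_top ?_
    rw [ENNReal.coe_one, one_mul]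
    congr 1
    ext x
    rw [Set.mem_smul_set_iff_inv_smul_mem]
    simp [Units.smul_def, hu]
  have hϖ : (distribHaarChar K ϖ.val : ℝ) = (residueCard K : ℝ)⁻¹ := by
    have := distribHaarChar_eq_of_measure_smul_eq_mul (g := ϖ.val) (μ := Measure.addHaar)
      (s := Metric.closedBall (0 : K) 1) (r := (residueCard K : NNReal)⁻¹)
      (Metric.measure_closedBall_pos _ _ one_pos).ne'
      (isCompact_closedBall _ _).measure_ne_top (by
        rw [(measure_closedBall_eq _).2]
        have : ((residueCard K : NNReal)⁻¹ : NNReal) * (residueCard K : ENNReal) = 1 := by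
          rw [← ENNReal.coe_natCast, ← ENNReal.coe_mul, inv_mul_cancel₀, ENNReal.coe_one]
          exact_mod_cast (residueCard_pos K).ne'
        rw [← mul_assoc, this, one_mul]
        congr 1
        rw [ball_eq_smul_closedBall ϖ]
        rfl)
    rw [this]; simp
  have hdec : x = ϖ.val ^ ord ϖ x * (unitPart ϖ x : Kˣ) := by
    change x = ϖ.val ^ ord ϖ x * (ϖ.val ^ (-ord ϖ x) * x)
    rw [← mul_assoc, ← zpow_add]; simp
  have hu := hunit (unitPart ϖ x : Kˣ) (unitPart ϖ x).2
  conv_lhs => rw [hdec]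
  rw [map_mul, map_zpow, hu, mul_one, absVal_units, NNReal.coe_zpow, hϖ, inv_zpow']

variable (μ : Measure K) [μ.IsAddHaarMeasure]

theorem map_mul_left_eq (ϖ : Uniformizer K) {c : K} (hc : c ≠ 0) :
    μ.map (fun x => c * x) = ENNReal.ofReal (absVal ϖ c)⁻¹ • μ := by
  have hm : Measurable fun x : K => c * x := (continuous_const_mul c).measurable
  ext s hs
  rw [Measure.map_apply hm hs, Measure.smul_apply, smul_eq_mul]
  have := distribHaarChar_mul μ (Units.mk0 c hc)⁻¹ s
  have h2 : ((Units.mk0 c hc)⁻¹ • s) = (fun x => c * x) ⁻¹' s := by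
    ext x
    rw [Set.mem_smul_set_iff_inv_smul_mem]
    simp [Units.smul_def]
  rw [h2] at this
  rw [← this, ← absVal_inv]
  congr 1
  have h3 := distribHaarChar_eq ϖ (Units.mk0 c hc)⁻¹
  rw [Units.val_inv_eq_inv_val, Units.val_mk0] at h3
  rw [← h3, ENNReal.ofReal_coe_nnreal]

/-- The change of variables `x ↦ c x`. -/
theorem integral_comp_mul_left (ϖ : Uniformizer K) {c : K} (hc : c ≠ 0) {G : Type*}
    [NormedAddCommGroup G] [NormedSpace ℝ G] (f : K → G) :
    ∫ x, f (c * x) ∂μ = (absVal ϖ c)⁻¹ • ∫ x, f x ∂μ := by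
  let e : K ≃ᵐ K := (Homeomorph.mulLeft₀ c hc).toMeasurableEquiv
  have h := integral_map_equiv (μ := μ) e f
  rw [show μ.map e = ENNReal.ofReal (absVal ϖ c)⁻¹ • μ from map_mul_left_eq μ ϖ hc,
    integral_smul_measure, ENNReal.toReal_ofReal (inv_nonneg.2 (absVal_nonneg ϖ c))] at h
  exact h.symm

theorem integral_mul_left (ϖ : Uniformizer K) {c : K} (hc : c ≠ 0) (f : K → ℂ) :
    ∫ x, f (c * x) ∂μ = ((absVal ϖ c : ℝ) : ℂ)⁻¹ * ∫ x, f x ∂μ := by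
  rw [integral_comp_mul_left μ ϖ hc, Complex.real_smul, Complex.ofReal_inv]

theorem integrable_mul_left (ϖ : Uniformizer K) {c : K} (hc : c ≠ 0) {G : Type*}
    [NormedAddCommGroup G]
    {f : K → G} (hf : Integrable f μ) : Integrable (fun x => f (c * x)) μ := by
  let e : K ≃ᵐ K := (Homeomorph.mulLeft₀ c hc).toMeasurableEquiv
  have h := integrable_map_equiv (μ := μ) e f
  rw [show μ.map e = ENNReal.ofReal (absVal ϖ c)⁻¹ • μ from map_mul_left_eq μ ϖ hc] at h
  exact h.1 (hf.smul_measure ENNReal.ofReal_ne_top)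

end Module

/-! ### Quasi-characters as functions on the field -/

section QuasiChar

/-- The circle group has no small subgroups: an element all of whose powers `z ^ (2 ^ n)` stay
close to `1` is trivial. -/
theorem eq_one_of_norm_pow_sub_one_le {z : ℂ} (h : ∀ n : ℕ, ‖z ^ 2 ^ n - 1‖ ≤ 1 / 2) : z = 1 := by
  have key : ∀ n : ℕ, (3 / 2 : ℝ) ^ n * ‖z - 1‖ ≤ ‖z ^ 2 ^ n - 1‖ := by
    intro n
    induction n with
    | zero => simp
    | succ n ih =>
      have h1 : z ^ 2 ^ (n + 1) - 1 = (z ^ 2 ^ n - 1) * (2 + (z ^ 2 ^ n - 1)) := by ring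
      have h2 : 3 / 2 ≤ ‖2 + (z ^ 2 ^ n - 1)‖ := by
        have := norm_sub_le (2 + (z ^ 2 ^ n - 1)) (z ^ 2 ^ n - 1)
        rw [add_sub_cancel_right] at this
        have h3 := h n
        have : ‖(2 : ℂ)‖ = 2 := by simp
        linarith
      rw [h1, norm_mul, pow_succ]
      calc (3 / 2 : ℝ) ^ n * (3 / 2) * ‖z - 1‖ = ((3 / 2 : ℝ) ^ n * ‖z - 1‖) * (3 / 2) := by ring
        _ ≤ _ := mul_le_mul ih h2 (by norm_num) (norm_nonneg _)
  by_contra hz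
  have hpos : 0 < ‖z - 1‖ := norm_pos_iff.2 (sub_ne_zero.2 hz)
  obtain ⟨n, hn⟩ := pow_unbounded_of_one_lt (1 / ‖z - 1‖) (show (1 : ℝ) < 3 / 2 by norm_num)
  rw [div_lt_iff₀ hpos] at hn
  have := (key n).trans (h n)
  linarith

variable {K : Type*} [NontriviallyNormedField K]

/-- A multiplicative character of `K^×`, extended by `0`, as a homomorphism `K → ℂ`. -/
def charHom (ξ : Kˣ →* ℂˣ) : K →*₀ ℂ where
  toFun := charFun ξ
  map_zero' := by simp [charFun]
  map_one' := by
    have : Units.mk0 (1 : K) one_ne_zero = 1 := by ext; rfl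
    simp [charFun, this]
  map_mul' x y := by
    rcases eq_or_ne x 0 with rfl | hx
    · simp [charFun]
    rcases eq_or_ne y 0 with rfl | hy
    · simp [charFun]
    simp only [charFun, hx, hy, mul_eq_zero, or_self, dite_false]
    rw [← Units.val_mul, ← map_mul]
    congr 2
    ext; rfl

theorem charFun_units (ξ : Kˣ →* ℂˣ) (x : Kˣ) : charFun ξ (x : K) = ξ x := by
  simp [charFun]

variable [IsUltrametricDist K]

/-- The function `x ↦ ξ_s(x)` on `K`, with value `0` at `0`. -/
def quasiChar (ϖ : Uniformizer K) (ξ : UnitChar K) (s : ℂ) : K →*₀ ℂ := charHom (twist ϖ ξ s)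

theorem charFun_twist (ϖ : Uniformizer K) (ξ : UnitChar K) (s : ℂ) (x : K) :
    charFun (twist ϖ ξ s) x = quasiChar ϖ ξ s x := rfl

theorem quasiChar_units (ϖ : Uniformizer K) (ξ : UnitChar K) (s : ℂ) (x : Kˣ) :
    quasiChar ϖ ξ s (x : K) = (ξ (unitPart ϖ x) : ℂ) *
      Complex.exp (s * (-(ord ϖ x : ℂ) * Real.log (residueCard K))) := by
  rw [← charFun_twist, charFun_units]
  rfl

theorem unitPart_of_norm_eq_one (ϖ : Uniformizer K) {x : Kˣ} (hx : ‖(x : K)‖ = 1) :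
    unitPart ϖ x = ⟨x, hx⟩ := by
  ext1
  change ϖ.val ^ (-ord ϖ x) * x = x
  rw [ord_eq_zero ϖ hx]; simp

theorem unitPart_uniformizer (ϖ : Uniformizer K) : unitPart ϖ ϖ.val = 1 := by
  ext1
  change ϖ.val ^ (-ord ϖ ϖ.val) * ϖ.val = 1
  rw [ord_uniformizer]; simp

theorem quasiChar_of_norm_eq_one (ϖ : Uniformizer K) (ξ : UnitChar K) (s : ℂ) {x : Kˣ}
    (hx : ‖(x : K)‖ = 1) : quasiChar ϖ ξ s (x : K) = ξ ⟨x, hx⟩ := by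
  rw [quasiChar_units, unitPart_of_norm_eq_one ϖ hx, ord_eq_zero ϖ hx]; simp

theorem quasiChar_congr_of_norm_eq_one (ϖ : Uniformizer K) (ξ : UnitChar K) (s s' : ℂ) {x : K}
    (hx : ‖x‖ = 1) : quasiChar ϖ ξ s x = quasiChar ϖ ξ s' x := by
  have hx0 : x ≠ 0 := norm_ne_zero_iff.1 (by rw [hx]; exact one_ne_zero)
  have h : ‖((Units.mk0 x hx0 : Kˣ) : K)‖ = 1 := hx
  have h1 := quasiChar_of_norm_eq_one ϖ ξ s h
  rw [← quasiChar_of_norm_eq_one ϖ ξ s' h] at h1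
  exact h1

theorem quasiChar_uniformizer (ϖ : Uniformizer K) (ξ : UnitChar K) (s : ℂ) :
    quasiChar ϖ ξ s (ϖ.val : K) = Complex.exp (-s * Real.log (residueCard K)) := by
  rw [quasiChar_units, unitPart_uniformizer, ord_uniformizer]
  simp

theorem quasiChar_mul_quasiChar (ϖ : Uniformizer K) (ξ ξ' : UnitChar K) (s s' : ℂ) (x : K) :
    quasiChar ϖ ξ s x * quasiChar ϖ ξ' s' x = quasiChar ϖ (ξ * ξ') (s + s') x := by
  rcases eq_or_ne x 0 with rfl | hx
  · simp
  rw [← Units.val_mk0 hx, quasiChar_units, quasiChar_units, quasiChar_units, add_mul,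
    Complex.exp_add]
  have : ((ξ * ξ') (unitPart ϖ (Units.mk0 x hx)) : ℂ)
      = ξ (unitPart ϖ (Units.mk0 x hx)) * ξ' (unitPart ϖ (Units.mk0 x hx)) := rfl
  rw [this]; ring

theorem quasiChar_inv (ϖ : Uniformizer K) (ξ : UnitChar K) (s : ℂ) (x : K) :
    (quasiChar ϖ ξ s x)⁻¹ = quasiChar ϖ ξ⁻¹ (-s) x := by
  rcases eq_or_ne x 0 with rfl | hx
  · simp
  rw [inv_eq_iff_eq_inv, eq_comm]
  apply inv_eq_of_mul_eq_one_left
  rw [quasiChar_mul_quasiChar, mul_inv_cancel, add_neg_cancel, ← Units.val_mk0 hx, quasiChar_units]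
  simp

theorem norm_quasiChar_zero (ϖ : Uniformizer K) (ξ : UnitChar K) {x : K} (hx : x ≠ 0) :
    ‖quasiChar ϖ ξ 0 x‖ = 1 := by
  rw [← Units.val_mk0 hx, quasiChar_units, norm_mul, Circle.norm_coe]; simp

theorem quasiChar_sq (ϖ : Uniformizer K) (ξ : UnitChar K) (s : ℂ) (x : K) :
    quasiChar ϖ ξ s x ^ 2 = quasiChar ϖ (ξ ^ 2) (2 * s) x := by
  rw [sq, quasiChar_mul_quasiChar, ← sq, ← two_mul]

variable [ProperSpace K]

theorem quasiChar_eq_mul_exp (ϖ : Uniformizer K) (ξ : UnitChar K) (s : ℂ) {x : K} (hx : x ≠ 0) :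
    quasiChar ϖ ξ s x = quasiChar ϖ ξ 0 x * Complex.exp (s * Real.log (absVal ϖ x)) := by
  rw [← Units.val_mk0 hx, quasiChar_units, quasiChar_units, absVal_units, Real.log_zpow]
  simp

theorem norm_quasiChar (ϖ : Uniformizer K) (ξ : UnitChar K) (s : ℂ) {x : K} (hx : x ≠ 0) :
    ‖quasiChar ϖ ξ s x‖ = absVal ϖ x ^ s.re := by
  rw [quasiChar_eq_mul_exp ϖ ξ s hx, norm_mul, norm_quasiChar_zero ϖ ξ hx, one_mul,
    Complex.norm_exp, Real.rpow_def_of_pos (absVal_pos ϖ hx)]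
  congr 1
  simp [Complex.mul_re, mul_comm]

theorem quasiChar_one_one (ϖ : Uniformizer K) (x : K) :
    quasiChar ϖ 1 1 x = (absVal ϖ x : ℂ) := by
  rcases eq_or_ne x 0 with rfl | hx
  · simp [absVal_zero]
  have h0 : quasiChar ϖ 1 0 x = 1 := by rw [← Units.val_mk0 hx, quasiChar_units]; simp
  rw [quasiChar_eq_mul_exp ϖ 1 1 hx, h0, one_mul, one_mul, ← Complex.ofReal_exp,
    Real.exp_log (absVal_pos ϖ hx)]

theorem quasiChar_one_eq_cpow (ϖ : Uniformizer K) (s : ℂ) {x : K} (hx : x ≠ 0) :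
    quasiChar ϖ 1 s x = (absVal ϖ x : ℂ) ^ s := by
  have h0 : quasiChar ϖ 1 0 x = 1 := by rw [← Units.val_mk0 hx, quasiChar_units]; simp
  have hp := absVal_pos ϖ hx
  rw [quasiChar_eq_mul_exp ϖ 1 s hx, h0, one_mul, Complex.cpow_def_of_ne_zero
    (by exact_mod_cast hp.ne'), ← Complex.ofReal_log hp.le, mul_comm]

theorem quasiChar_mul_absVal (ϖ : Uniformizer K) (ξ : UnitChar K) (s : ℂ) (x : K) :
    quasiChar ϖ ξ s x * (absVal ϖ x : ℂ) = quasiChar ϖ ξ (s + 1) x := by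
  rw [← quasiChar_one_one, quasiChar_mul_quasiChar, mul_one]

theorem quasiChar_mul_absVal_inv (ϖ : Uniformizer K) (ξ : UnitChar K) (s : ℂ) (x : K) :
    quasiChar ϖ ξ s x * (absVal ϖ x : ℂ)⁻¹ = quasiChar ϖ ξ (s - 1) x := by
  rw [← quasiChar_one_one, quasiChar_inv, inv_one, quasiChar_mul_quasiChar, mul_one,
    ← sub_eq_add_neg]

/-- Quasi-characters are locally constant, uniformly on a logarithmic scale: a character of the
unit group is trivial on some ball `1 + B(0, ε)`. -/
theorem exists_quasiChar_add_eq (ϖ : Uniformizer K) (ξ : UnitChar K) :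
    ∃ ε : ℝ, 0 < ε ∧ ε < 1 ∧ ∀ (s : ℂ) (x y : K), ‖y‖ ≤ ε * ‖x‖ →
      quasiChar ϖ ξ s (x + y) = quasiChar ϖ ξ s x := by
  have hopen : {u : unitGroup K | ‖(ξ u : ℂ) - 1‖ < 1 / 2} ∈ 𝓝 (1 : unitGroup K) := by
    refine IsOpen.mem_nhds ?_ (by simp)
    have hc : Continuous fun u : unitGroup K => (ξ u : ℂ) :=
      continuous_subtype_val.comp (map_continuous ξ)
    exact isOpen_lt (hc.sub continuous_const).norm continuous_const
  have hemb : IsInducing fun u : unitGroup K => ((u : Kˣ) : K) :=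
    Units.isEmbedding_val₀.isInducing.comp IsInducing.subtypeVal
  rw [hemb.nhds_eq_comap, mem_comap] at hopen
  obtain ⟨t, ht, hts⟩ := hopen
  obtain ⟨δ, hδ, hδt⟩ := Metric.mem_nhds_iff.1 ht
  have hone : ((((1 : unitGroup K) : unitGroup K) : Kˣ) : K) = 1 := rfl
  rw [hone] at hδt
  have hnorm : ∀ v : K, ‖v‖ < 1 → ‖1 + v‖ = 1 := by
    intro v hv
    rw [IsUltrametricDist.norm_add_eq_max_of_norm_ne_norm (by rw [norm_one]; exact hv.ne'),
      norm_one, max_eq_left hv.le]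
  have hsmall : ∀ v : K, ‖v‖ < min δ 1 → quasiChar ϖ ξ 0 (1 + v) = 1 := by
    intro v hv
    apply eq_one_of_norm_pow_sub_one_le
    intro n
    have hpow : ∃ w : K, ‖w‖ < min δ 1 ∧ (1 + v) ^ 2 ^ n = 1 + w := by
      induction n with
      | zero => exact ⟨v, hv, by simp⟩
      | succ n ih =>
        obtain ⟨w, hw, hw'⟩ := ih
        refine ⟨w * (1 + (1 + w)), ?_, by rw [pow_succ, pow_mul, hw']; ring⟩
        have h1 : ‖1 + (1 + w)‖ ≤ 1 := by
          refine (IsUltrametricDist.norm_add_le_max _ _).trans ?_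
          rw [hnorm w (hw.trans_le (min_le_right _ _)), norm_one, max_self]
        rw [norm_mul]
        exact (mul_le_of_le_one_right (norm_nonneg _) h1).trans_lt hw
    obtain ⟨w, hw, hw'⟩ := hpow
    have hw1 := hnorm w (hw.trans_le (min_le_right _ _))
    have hw0 : 1 + w ≠ 0 := norm_ne_zero_iff.1 (by rw [hw1]; exact one_ne_zero)
    rw [← map_pow, hw']
    have h2 := quasiChar_of_norm_eq_one ϖ ξ 0 (x := Units.mk0 (1 + w) hw0) hw1
    rw [Units.val_mk0] at h2
    rw [h2]
    refine le_of_lt (hts (a := ⟨Units.mk0 (1 + w) hw0, hw1⟩) (hδt ?_))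
    rw [mem_ball_iff_norm]
    simpa using hw.trans_le (min_le_left _ _)
  refine ⟨min δ 1 / 2, by positivity, ?_, ?_⟩
  · have := min_le_right δ 1; linarith
  intro s x y hxy
  rcases eq_or_ne x 0 with rfl | hx
  · rw [norm_zero, mul_zero] at hxy
    rw [norm_le_zero_iff.1 hxy, add_zero]
  have hv : ‖y / x‖ < min δ 1 := by
    rw [norm_div, div_lt_iff₀ (norm_pos_iff.2 hx)]
    have h0 : 0 < min δ 1 * ‖x‖ := mul_pos (lt_min hδ one_pos) (norm_pos_iff.2 hx)
    linarith
  have h1 : x + y = x * (1 + y / x) := by field_simp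
  rw [h1, map_mul, quasiChar_congr_of_norm_eq_one ϖ ξ s 0 (hnorm _
    (hv.trans_le (min_le_right _ _))), hsmall _ hv, mul_one]

theorem eventually_quasiChar_eq (ϖ : Uniformizer K) (ξ : UnitChar K) {x : K} (hx : x ≠ 0) :
    ∀ᶠ y in 𝓝 x, ∀ s, quasiChar ϖ ξ s y = quasiChar ϖ ξ s x := by
  obtain ⟨ε, hε, -, h⟩ := exists_quasiChar_add_eq ϖ ξ
  have : Metric.ball x (ε * ‖x‖) ∈ 𝓝 x :=
    Metric.ball_mem_nhds _ (mul_pos hε (norm_pos_iff.2 hx))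
  filter_upwards [this] with y hy s
  rw [mem_ball_iff_norm] at hy
  have := h s x (y - x) hy.le
  rwa [add_sub_cancel] at this

theorem measurable_quasiChar [MeasurableSpace K] [BorelSpace K] (ϖ : Uniformizer K)
    (ξ : UnitChar K) (s : ℂ) : Measurable (quasiChar ϖ ξ s) := by
  refine measurable_of_continuousOn_compl_singleton 0 fun x hx => ?_
  refine ContinuousAt.continuousWithinAt ?_
  refine continuousAt_const.congr (f := fun _ => quasiChar ϖ ξ s x) ?_
  filter_upwards [eventually_quasiChar_eq ϖ ξ hx] with y hy
  rw [hy s]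

end QuasiChar

/-! ### Local factors and the scaling elements attached to them -/

section EulerFactor

variable {K : Type*} [NontriviallyNormedField K] [IsUltrametricDist K]

/-- The inverse local factor: `1 - q ^ (-z)` if `ξ = 1`, and `1` otherwise. -/
def eulerFactor (ϖ : Uniformizer K) (ξ : UnitChar K) (z : ℂ) : ℂ :=
  open Classical in if ξ = 1 then 1 - quasiChar ϖ 1 z (ϖ.val : K) else 1

theorem twist_trivial_iff (ϖ : Uniformizer K) (ξ : UnitChar K) (s : ℂ) :
    (∀ u ∈ unitGroup K, twist ϖ ξ s u = 1) ↔ ξ = 1 := by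
  have key : ∀ u (hu : u ∈ unitGroup K), (twist ϖ ξ s u : ℂ) = ξ ⟨u, hu⟩ := fun u hu => by
    rw [← charFun_units, charFun_twist, quasiChar_of_norm_eq_one ϖ ξ s hu]
  constructor
  · intro h
    ext ⟨u, hu⟩
    rw [← key u hu, h u hu]; rfl
  · rintro rfl u hu
    ext
    rw [key u hu]; rfl

theorem inv_localL [ProperSpace K] (ϖ : Uniformizer K) (ξ : UnitChar K) (s z : ℂ) :
    (localL ϖ z (twist ϖ ξ s))⁻¹ = eulerFactor ϖ ξ (s + z) := by
  rw [localL, eulerFactor]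
  by_cases h : ξ = 1
  · rw [if_pos ((twist_trivial_iff ϖ ξ s).2 h), if_pos h]
    subst h
    rw [inv_inv, ← charFun_units, charFun_twist, quasiChar_uniformizer, quasiChar_uniformizer,
      Complex.cpow_def_of_ne_zero (by exact_mod_cast (residueCard_pos K).ne'),
      ← Complex.ofReal_natCast, ← Complex.ofReal_log (residueCard_pos K).le, ← Complex.exp_add]
    congr 3
    ring
  · rw [if_neg (mt (twist_trivial_iff ϖ ξ s).1 h), if_neg h, inv_one]

theorem exists_ne_one (ξ : UnitChar K) (h : ξ ≠ 1) : ∃ u : unitGroup K, ξ u ≠ 1 := by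
  by_contra! hc
  exact h (by ext u; rw [hc u]; rfl)

/-- An element `b` of `K^×` such that `1 - ξ_z(b)` is the inverse local factor of `ξ_z` up to a
non-zero constant: the uniformizer if `ξ = 1`, and a unit with `ξ(b) ≠ 1` otherwise. -/
def scaleUnit (ϖ : Uniformizer K) (ξ : UnitChar K) : Kˣ :=
  open Classical in if h : ξ = 1 then ϖ.val else ((exists_ne_one ξ h).choose : unitGroup K)

/-- The constant `c` for which `c (1 - ξ_z(b))` is the inverse local factor, `b` being the scaling
element of `ξ`. -/
def scaleConst (ϖ : Uniformizer K) (ξ : UnitChar K) : ℂ :=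
  open Classical in if ξ = 1 then 1 else (1 - quasiChar ϖ ξ 0 (scaleUnit ϖ ξ : K))⁻¹

theorem scaleConst_mul (ϖ : Uniformizer K) (ξ : UnitChar K) (z : ℂ) :
    scaleConst ϖ ξ * (1 - quasiChar ϖ ξ z (scaleUnit ϖ ξ : K)) = eulerFactor ϖ ξ z := by
  unfold scaleConst eulerFactor
  split_ifs with h
  · subst h
    simp [scaleUnit]
  · have hb : scaleUnit ϖ ξ = ((exists_ne_one ξ h).choose : unitGroup K) := by
      simp [scaleUnit, h]
    have hn : ‖(scaleUnit ϖ ξ : K)‖ = 1 := by rw [hb]; exact (exists_ne_one ξ h).choose.2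
    rw [quasiChar_congr_of_norm_eq_one ϖ ξ z 0 hn]
    apply inv_mul_cancel₀
    rw [sub_ne_zero, quasiChar_of_norm_eq_one ϖ ξ 0 hn]
    intro h1
    have hc := (exists_ne_one ξ h).choose_spec
    apply hc
    have h2 : (⟨scaleUnit ϖ ξ, hn⟩ : unitGroup K) = (exists_ne_one ξ h).choose := by
      ext1; exact hb
    rw [h2] at h1
    ext
    exact h1.symm

theorem scaleUnit_one (ϖ : Uniformizer K) : scaleUnit ϖ 1 = ϖ.val := by simp [scaleUnit]

theorem scaleConst_one (ϖ : Uniformizer K) : scaleConst ϖ (1 : UnitChar K) = 1 := by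
  simp [scaleConst]

theorem differentiable_quasiChar (ϖ : Uniformizer K) (ξ : UnitChar K) (x : K) :
    Differentiable ℂ fun s => quasiChar ϖ ξ s x := by
  rcases eq_or_ne x 0 with rfl | hx
  · simp
  rw [← Units.val_mk0 hx]
  simp only [quasiChar_units]
  fun_prop

theorem differentiable_eulerFactor (ϖ : Uniformizer K) (ξ : UnitChar K) :
    Differentiable ℂ (eulerFactor ϖ ξ) := by
  unfold eulerFactor
  split_ifs
  · exact (differentiable_const _).sub (differentiable_quasiChar ϖ 1 _)
  · exact differentiable_const _

theorem eulerFactor_ne_zero [ProperSpace K] (ϖ : Uniformizer K) (ξ : UnitChar K) {z : ℂ}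
    (hz : 0 < z.re) : eulerFactor ϖ ξ z ≠ 0 := by
  unfold eulerFactor
  split_ifs
  · rw [sub_ne_zero]
    intro h
    have h1 := congrArg norm h
    rw [norm_one, quasiChar_uniformizer, Complex.norm_exp] at h1
    have h2 := log_residueCard_pos K
    have h3 : (-z * (Real.log (residueCard K) : ℂ)).re = -(z.re * Real.log (residueCard K)) := by
      rw [Complex.re_mul_ofReal, Complex.neg_re, neg_mul]
    rw [h3, eq_comm, Real.exp_eq_one_iff] at h1
    have := mul_pos hz h2
    linarith
  · exact one_ne_zero

end EulerFactor

/-! ### Holomorphic families of test functions -/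

section TestFun

open scoped Pointwise

variable {X Y : Type*} [TopologicalSpace X] [TopologicalSpace Y]

theorem testFun_eventually_eq {f : X → ℂ} (hf : f ∈ testFun X) (x : X) :
    ∀ᶠ y in 𝓝 x, f y = f x := hf.1.eventually_eq x

theorem testFun_continuous {f : X → ℂ} (hf : f ∈ testFun X) : Continuous f := hf.1.continuous

theorem testFun_isCompact_support {f : X → ℂ} (hf : f ∈ testFun X) :
    IsCompact (Function.support f) := by
  have : IsClosed (f ⁻¹' {0}ᶜ) := ⟨by
    rw [← Set.preimage_compl]; exact hf.1 _⟩
  have h2 : closure (Function.support f) = Function.support f := this.closure_eq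
  rw [← h2]
  exact hf.2

theorem testFun_comp_homeomorph {f : Y → ℂ} (hf : f ∈ testFun Y) (h : X ≃ₜ Y) :
    (fun x => f (h x)) ∈ testFun X :=
  ⟨hf.1.comp_continuous h.continuous, hf.2.comp_homeomorph h⟩

/-- The product of a test function with a function that is locally constant on its support. -/
theorem mul_mem_testFun {f g : X → ℂ} (hf : f ∈ testFun X)
    (hg : ∀ x, f x ≠ 0 → ∀ᶠ y in 𝓝 x, g y = g x) : (fun x => g x * f x) ∈ testFun X := by
  refine ⟨?_, hf.2.mul_left⟩
  rw [IsLocallyConstant.iff_eventually_eq]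
  intro x
  by_cases hx : f x = 0
  · filter_upwards [testFun_eventually_eq hf x] with y hy
    rw [hy, hx, mul_zero, mul_zero]
  · filter_upwards [testFun_eventually_eq hf x, hg x hx] with y hy hy'
    rw [hy, hy']

theorem indicator_mem_testFun [R1Space X] {s : Set X} (ho : IsClopen s) (hc : IsCompact s)
    {g : X → ℂ}
    (hg : IsLocallyConstant g) : s.indicator g ∈ testFun X := by
  constructor
  · rw [IsLocallyConstant.iff_eventually_eq]
    intro x
    by_cases hx : x ∈ s
    · filter_upwards [ho.isOpen.mem_nhds hx, hg.eventually_eq x] with y hy hy'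
      rw [Set.indicator_of_mem hy, Set.indicator_of_mem hx, hy']
    · filter_upwards [ho.compl.isOpen.mem_nhds hx] with y hy
      rw [Set.indicator_of_notMem hy, Set.indicator_of_notMem hx]
  · refine HasCompactSupport.of_support_subset_isCompact hc ?_
    exact Set.support_indicator_subset

theorem testFun_integrable [MeasurableSpace X] [OpensMeasurableSpace X] {μ : Measure X}
    [IsFiniteMeasureOnCompacts μ] {f : X → ℂ} (hf : f ∈ testFun X) : Integrable f μ :=
  (testFun_continuous hf).integrable_of_hasCompactSupport hf.2

variable (X) (P : Type*) [NormedAddCommGroup P] [NormedSpace ℂ P]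

/-- Holomorphic families `p ↦ G p` of test functions on `X` vanishing on `Z`: the finite sums
`∑ aᵢ(p) fᵢ` with `aᵢ` entire and `fᵢ` a test function vanishing on `Z`. -/
def holFam (Z : Set X) : Submodule ℂ (P → X → ℂ) :=
  Submodule.span ℂ {G | ∃ a : P → ℂ, Differentiable ℂ a ∧
    ∃ f ∈ testFun X, (∀ x ∈ Z, f x = 0) ∧ G = fun p x => a p * f x}

variable {X P} {Z : Set X}

theorem const_mem_holFam {f : X → ℂ} (hf : f ∈ testFun X) (hZ : ∀ x ∈ Z, f x = 0) :
    (fun _ => f) ∈ holFam X P Z :=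
  Submodule.subset_span ⟨fun _ => 1, differentiable_const _, f, hf, hZ, by simp⟩

theorem apply_mem_of_mem_holFam {G : P → X → ℂ} (hG : G ∈ holFam X P Z) (p : P) :
    G p ∈ testFun X ∧ ∀ x ∈ Z, G p x = 0 := by
  induction hG using Submodule.span_induction with
  | mem G h =>
    obtain ⟨a, -, f, hf, hZ, rfl⟩ := h
    exact ⟨(testFun X).smul_mem (a p) hf, fun x hx => by simp [hZ x hx]⟩
  | zero => exact ⟨(testFun X).zero_mem, fun _ _ => rfl⟩
  | add G H _ _ hG hH =>
    exact ⟨(testFun X).add_mem hG.1 hH.1, fun x hx => by simp [hG.2 x hx, hH.2 x hx]⟩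
  | smul c G _ hG => exact ⟨(testFun X).smul_mem c hG.1, fun x hx => by simp [hG.2 x hx]⟩

theorem differentiable_integral_of_mem_holFam [MeasurableSpace X] [OpensMeasurableSpace X]
    (μ : Measure X) [IsFiniteMeasureOnCompacts μ] {G : P → X → ℂ} (hG : G ∈ holFam X P Z) :
    Differentiable ℂ fun p => ∫ x, G p x ∂μ := by
  induction hG using Submodule.span_induction with
  | mem G h =>
    obtain ⟨a, ha, f, -, -, rfl⟩ := h
    simp only [integral_const_mul]
    exact ha.mul_const _
  | zero => simp
  | add G H hG' hH' hG hH =>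
    have : (fun p => ∫ x, (G + H) p x ∂μ) = fun p => ∫ x, G p x ∂μ + ∫ x, H p x ∂μ := by
      ext p
      exact integral_add (testFun_integrable (apply_mem_of_mem_holFam hG' p).1)
        (testFun_integrable (apply_mem_of_mem_holFam hH' p).1)
    rw [this]
    exact hG.add hH
  | smul c G _ hG =>
    have : (fun p => ∫ x, (c • G) p x ∂μ) = fun p => c * ∫ x, G p x ∂μ := by
      ext p
      exact integral_const_mul c _
    rw [this]
    exact hG.const_mul c

theorem map_mem_holFam {Z' : Set Y} (L : (X → ℂ) →ₗ[ℂ] (Y → ℂ))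
    (hL : ∀ f ∈ testFun X, (∀ x ∈ Z, f x = 0) → L f ∈ testFun Y ∧ ∀ y ∈ Z', L f y = 0)
    {G : P → X → ℂ} (hG : G ∈ holFam X P Z) : (fun p => L (G p)) ∈ holFam Y P Z' := by
  induction hG using Submodule.span_induction with
  | mem G h =>
    obtain ⟨a, ha, f, hf, hZ, rfl⟩ := h
    refine Submodule.subset_span ⟨a, ha, L f, (hL f hf hZ).1, (hL f hf hZ).2, ?_⟩
    ext p y
    exact congrFun (L.map_smul (a p) f) y
  | zero =>
    have : (fun p => L ((0 : P → X → ℂ) p)) = 0 := by ext p y; simp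
    rw [this]; exact Submodule.zero_mem _
  | add G H _ _ hG hH =>
    have : (fun p => L ((G + H) p)) = (fun p => L (G p)) + fun p => L (H p) := by
      ext p y; simp
    rw [this]; exact Submodule.add_mem _ hG hH
  | smul c G _ hG =>
    have : (fun p => L ((c • G) p)) = c • fun p => L (G p) := by ext p y; simp
    rw [this]; exact Submodule.smul_mem _ c hG

variable {K : Type*} [NontriviallyNormedField K] [IsUltrametricDist K] [ProperSpace K]

theorem quasiChar_mul_mem_testFun (ϖ : Uniformizer K) (ξ : UnitChar K) (s : ℂ) {θ : X → K}
    (hθ : Continuous θ) {f : X → ℂ} (hf : f ∈ testFun X) (hfθ : ∀ x, θ x = 0 → f x = 0) :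
    (fun x => quasiChar ϖ ξ s (θ x) * f x) ∈ testFun X := by
  refine mul_mem_testFun hf fun x hx => ?_
  have h0 : θ x ≠ 0 := fun h => hx (hfθ x h)
  filter_upwards [hθ.continuousAt.eventually (eventually_quasiChar_eq ϖ ξ h0)] with y hy
  exact hy s

/-- Multiplication by `ξ_{A(p)}(θ(x))` preserves holomorphic families of test functions vanishing
on the zeros of `θ`: on a compact set avoiding these zeros, `|θ|` takes finitely many values. -/
theorem quasiChar_mul_mem_holFam (ϖ : Uniformizer K) (ξ : UnitChar K) {θ : X → K}
    (hθ : Continuous θ) (hθZ : ∀ x, θ x = 0 → x ∈ Z) {A : P → ℂ} (hA : Differentiable ℂ A)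
    {G : P → X → ℂ} (hG : G ∈ holFam X P Z) :
    (fun p x => quasiChar ϖ ξ (A p) (θ x) * G p x) ∈ holFam X P Z := by
  induction hG using Submodule.span_induction with
  | mem G h =>
    obtain ⟨a, ha, f, hf, hZ, rfl⟩ := h
    have h0 : ∀ x, f x ≠ 0 → θ x ≠ 0 := fun x hx h => hx (hZ x (hθZ x h))
    have hloc : ∀ x, f x ≠ 0 → ∀ᶠ y in 𝓝 x, absVal ϖ (θ y) = absVal ϖ (θ x) := by
      intro x hx
      filter_upwards [hθ.continuousAt.eventually (eventually_quasiChar_eq ϖ 1 (h0 x hx))] with y hy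
      have := hy 1
      rw [quasiChar_one_one, quasiChar_one_one] at this
      exact_mod_cast this
    obtain ⟨T, hT⟩ : ∃ T : Finset ℝ, ∀ x, f x ≠ 0 → absVal ϖ (θ x) ∈ T := by
      obtain ⟨t, -, ht⟩ := (testFun_isCompact_support hf).elim_nhds_subcover
        (fun x => {y | absVal ϖ (θ y) = absVal ϖ (θ x)}) hloc
      classical
      refine ⟨t.image fun x => absVal ϖ (θ x), fun x hx => ?_⟩
      obtain ⟨z, hz, hz'⟩ := Set.mem_iUnion₂.1 (ht hx)
      exact Finset.mem_image.2 ⟨z, hz, hz'.symm⟩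
    have hsum : (fun p x => quasiChar ϖ ξ (A p) (θ x) * (a p * f x)) =
        ∑ r ∈ T, fun p x => (Complex.exp (A p * Real.log r) * a p) *
          ((if absVal ϖ (θ x) = r then quasiChar ϖ ξ 0 (θ x) else 0) * f x) := by
      ext p x
      rw [Finset.sum_apply, Finset.sum_apply]
      by_cases hx : f x = 0
      · simp [hx]
      · rw [Finset.sum_eq_single (absVal ϖ (θ x))]
        · rw [if_pos rfl, quasiChar_eq_mul_exp ϖ ξ _ (h0 x hx)]; ring
        · intro r _ hr
          rw [if_neg hr.symm]; simp
        · intro h; exact absurd (hT x hx) h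
    rw [hsum]
    refine Submodule.sum_mem _ fun r _ => Submodule.subset_span
      ⟨_, ?_, _, mul_mem_testFun hf fun x hx => ?_, fun x hx => by simp [hZ x hx], rfl⟩
    · exact ((hA.mul_const _).cexp).mul ha
    · filter_upwards [hloc x hx,
        hθ.continuousAt.eventually (eventually_quasiChar_eq ϖ ξ (h0 x hx))] with y hy hy'
      rw [hy, hy' 0]
  | zero =>
    convert Submodule.zero_mem _ using 1
    ext p x; simp
  | add G H _ _ hG hH =>
    convert Submodule.add_mem _ hG hH using 1
    ext p x; simp [mul_add]
  | smul c G _ hG =>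
    convert Submodule.smul_mem _ c hG using 1
    ext p x; simp [mul_left_comm]

/-- The operator `f ↦ f - f ∘ h`. -/
def subComp (h : X ≃ₜ X) : (X → ℂ) →ₗ[ℂ] (X → ℂ) := LinearMap.id - LinearMap.funLeft ℂ ℂ h

theorem subComp_apply (h : X ≃ₜ X) (f : X → ℂ) (x : X) : subComp h f x = f x - f (h x) := rfl

theorem subComp_mem (h : X ≃ₜ X) {f : X → ℂ} (hf : f ∈ testFun X) : subComp h f ∈ testFun X :=
  (testFun X).sub_mem hf (testFun_comp_homeomorph hf h)

theorem subComp_eq_zero (h : X ≃ₜ X) (f : X → ℂ) {x : X} (hx : h x = x) : subComp h f x = 0 := by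
  rw [subComp_apply, hx, sub_self]

end TestFun

/-! ### Powers of the absolute value -/

section Powers

open scoped Pointwise

variable {K : Type*} [NontriviallyNormedField K] [IsUltrametricDist K] [ProperSpace K]
  [MeasurableSpace K] [BorelSpace K] (μ : Measure K) [μ.IsAddHaarMeasure]

theorem measurable_absVal (ϖ : Uniformizer K) : Measurable (absVal ϖ : K → ℝ) := by
  have : (absVal ϖ : K → ℝ) = fun x => ‖x‖ ^ normExponent ϖ := funext (absVal_eq_norm_rpow ϖ)
  rw [this]
  fun_prop

theorem measureReal_shell (ϖ : Uniformizer K) (k : ℤ) :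
    μ.real {x : K | ‖x‖ = ‖(ϖ.val : K)‖ ^ k} =
      (residueCard K : ℝ) ^ (-k) * μ.real {x : K | ‖x‖ = 1} := by
  have h := distribHaarChar_mul μ (ϖ.val ^ k) {x : K | ‖x‖ = 1}
  have h2 : (ϖ.val ^ k) • {x : K | ‖x‖ = 1} = {x : K | ‖x‖ = ‖(ϖ.val : K)‖ ^ k} := by
    ext x
    rw [Set.mem_smul_set_iff_inv_smul_mem]
    simp only [Units.smul_def, Set.mem_ofPred_eq, smul_eq_mul, norm_mul, Units.val_inv_eq_inv_val,
      Units.val_zpow_eq_zpow_val, norm_inv, norm_zpow]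
    rw [inv_mul_eq_one₀ (zpow_pos ϖ.norm_pos k).ne', eq_comm]
  rw [h2] at h
  rw [Measure.real, Measure.real, ← h, ENNReal.toReal_mul, ENNReal.coe_toReal,
    distribHaarChar_eq ϖ]
  congr 1
  rw [absVal_units]
  congr 2
  exact ord_eq_of_norm_eq ϖ (by rw [Units.val_zpow_eq_zpow_val, norm_zpow])

theorem absVal_of_norm_eq_zpow (ϖ : Uniformizer K) {x : K} {k : ℤ}
    (h : ‖x‖ = ‖(ϖ.val : K)‖ ^ k) : absVal ϖ x = (residueCard K : ℝ) ^ (-k) := by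
  have hx : x ≠ 0 := norm_pos_iff.1 (h ▸ zpow_pos ϖ.norm_pos k)
  rw [← Units.val_mk0 hx, absVal_units, ord_eq_of_norm_eq ϖ h]

/-- Integrability of `|x| ^ σ` over the shells `‖x‖ = ‖ϖ‖ ^ (m + ε k)`, `k ≥ 0`. -/
theorem integrableOn_absVal_rpow_shells (ϖ : Uniformizer K) (m ε : ℤ) {σ : ℝ}
    (hσ : 0 < ε * (σ + 1)) :
    IntegrableOn (fun x : K => absVal ϖ x ^ σ)
      (⋃ k : ℕ, {x : K | ‖x‖ = ‖(ϖ.val : K)‖ ^ (m + ε * k)}) μ := by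
  have hq := residueCard_pos K
  have hmeas : ∀ k : ℤ, MeasurableSet {x : K | ‖x‖ = ‖(ϖ.val : K)‖ ^ k} := fun k =>
    (isClosed_eq continuous_norm continuous_const).measurableSet
  have heq : ∀ k : ℤ, Set.EqOn (fun x : K => absVal ϖ x ^ σ)
      (fun _ => ((residueCard K : ℝ) ^ (-k)) ^ σ) {x : K | ‖x‖ = ‖(ϖ.val : K)‖ ^ k} :=
    fun k x hx => by simp only [absVal_of_norm_eq_zpow ϖ hx]
  have hfin : ∀ k : ℤ, μ {x : K | ‖x‖ = ‖(ϖ.val : K)‖ ^ k} ≠ ⊤ := fun k =>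
    (IsCompact.of_isClosed_subset (isCompact_closedBall 0 (‖(ϖ.val : K)‖ ^ k))
      (isClosed_eq continuous_norm continuous_const)
      (fun x hx => by rw [mem_closedBall_zero_iff]; exact le_of_eq hx)).measure_ne_top
  refine integrableOn_iUnion_of_summable_integral_norm (fun k => ?_) ?_
  · exact (integrableOn_const (hfin _)).congr_fun (heq _).symm (hmeas _)
  · have hval : ∀ k : ℕ, ∫ x in {x : K | ‖x‖ = ‖(ϖ.val : K)‖ ^ (m + ε * k)},
        ‖absVal ϖ x ^ σ‖ ∂μ = ((residueCard K : ℝ) ^ (-(ε * (σ + 1)))) ^ k *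
          ((residueCard K : ℝ) ^ (-(m * (σ + 1))) * μ.real {x : K | ‖x‖ = 1}) := by
      intro k
      rw [setIntegral_congr_fun (g := fun _ => ((residueCard K : ℝ) ^ (-(m + ε * k : ℤ))) ^ σ)
        (hmeas _)]
      · rw [setIntegral_const, smul_eq_mul, measureReal_shell, ← Real.rpow_intCast,
          ← Real.rpow_natCast, ← Real.rpow_mul hq.le, ← Real.rpow_mul hq.le, mul_right_comm,
          ← mul_assoc, ← Real.rpow_add hq, ← Real.rpow_add hq]
        congr 2
        push_cast; ring
      · intro x hx
        have := heq _ hx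
        simp only at this ⊢
        rw [this, Real.norm_of_nonneg]
        positivity
    simp only [hval]
    refine Summable.mul_right _ (summable_geometric_of_lt_one (by positivity) ?_)
    rw [Real.rpow_lt_one_iff_of_pos hq]
    left
    exact ⟨by exact_mod_cast one_lt_residueCard K, by linarith⟩

theorem ae_ne_zero : ∀ᵐ x : K ∂μ, x ≠ 0 := by
  rw [ae_iff]
  simp

theorem integrableOn_absVal_rpow_closedBall (ϖ : Uniformizer K) {σ : ℝ} (hσ : -1 < σ) (R : ℝ) :
    IntegrableOn (fun x : K => absVal ϖ x ^ σ) (Metric.closedBall 0 R) μ := by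
  obtain ⟨n, hn⟩ := pow_unbounded_of_one_lt R ((one_lt_inv₀ ϖ.norm_pos).2 ϖ.norm_lt_one)
  have h1 := integrableOn_absVal_rpow_shells μ ϖ (-n) 1 (σ := σ)
    (by push_cast; linarith)
  refine IntegrableOn.mono_set (t := (⋃ k : ℕ, {x : K | ‖x‖ = ‖(ϖ.val : K)‖ ^ (-(n : ℤ) + 1 * k)})
    ∪ {0}) ?_ ?_
  · rw [integrableOn_union]
    exact ⟨h1, integrableOn_singleton (by simp) isCompact_singleton.measure_lt_top⟩
  · intro x hx
    rcases eq_or_ne x 0 with rfl | hx0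
    · right; rfl
    left
    obtain ⟨k, hk⟩ := exists_norm_eq_zpow ϖ hx0
    rw [mem_closedBall_zero_iff, hk] at hx
    have h2 := hx.trans_lt hn
    rw [inv_pow, ← zpow_natCast, ← zpow_neg] at h2
    have h3 := (zpow_lt_zpow_iff_right_of_lt_one₀ ϖ.norm_pos ϖ.norm_lt_one).1 h2
    rw [Set.mem_iUnion]
    refine ⟨(k + n).toNat, ?_⟩
    rw [Set.mem_ofPred_eq, hk, Int.toNat_of_nonneg (by omega)]
    congr 1; ring

theorem integrableOn_absVal_rpow_compl_ball (ϖ : Uniformizer K) {σ : ℝ} (hσ : σ < -1) {R : ℝ}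
    (hR : 0 < R) :
    IntegrableOn (fun x : K => absVal ϖ x ^ σ) (Metric.ball 0 R)ᶜ μ := by
  obtain ⟨n, hn⟩ := exists_pow_lt_of_lt_one hR ϖ.norm_lt_one
  refine (integrableOn_absVal_rpow_shells μ ϖ n (-1) (σ := σ)
    (by push_cast; linarith)).mono_set ?_
  intro x hx
  rw [Set.mem_compl_iff, mem_ball_zero_iff, not_lt] at hx
  have hx0 : x ≠ 0 := norm_pos_iff.1 (hR.trans_le hx)
  obtain ⟨k, hk⟩ := exists_norm_eq_zpow ϖ hx0
  rw [hk] at hx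
  have h2 := hn.trans_le hx
  rw [← zpow_natCast] at h2
  have h3 := (zpow_lt_zpow_iff_right_of_lt_one₀ ϖ.norm_pos ϖ.norm_lt_one).1 h2
  rw [Set.mem_iUnion]
  refine ⟨(n - k).toNat, ?_⟩
  rw [Set.mem_ofPred_eq, hk, Int.toNat_of_nonneg (by omega)]
  congr 1; ring

end Powers

/-! ### Homogeneous distributions on a local field -/

section Homogeneous

variable {K : Type*} [NontriviallyNormedField K] [IsUltrametricDist K] [ProperSpace K]

/-- The homeomorphism `x ↦ b⁻¹ x`. -/
def invScale (b : Kˣ) : K ≃ₜ K := Homeomorph.mulLeft₀ (b : K)⁻¹ (inv_ne_zero b.ne_zero)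

theorem invScale_apply (b : Kˣ) (x : K) : invScale b x = (b : K)⁻¹ * x := rfl

theorem quasiChar_mul_subComp_mem (ϖ : Uniformizer K) (ξ : UnitChar K) (s : ℂ) (b : Kˣ)
    {φ : K → ℂ} (hφ : φ ∈ testFun K) :
    (fun x => quasiChar ϖ ξ s x * subComp (invScale b) φ x) ∈ testFun K := by
  refine quasiChar_mul_mem_testFun ϖ ξ s continuous_id (subComp_mem _ hφ) ?_
  rintro x rfl
  exact subComp_eq_zero _ _ (by simp [invScale_apply])

theorem testFun_bound {X : Type*} [TopologicalSpace X] {f : X → ℂ} (hf : f ∈ testFun X) :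
    ∃ C : ℝ, 0 ≤ C ∧ ∀ x, ‖f x‖ ≤ C := by
  obtain ⟨C, hC⟩ := (testFun_continuous hf).bounded_above_of_compact_support hf.2
  exact ⟨max C 0, le_max_right _ _, fun x => (hC x).trans (le_max_left _ _)⟩

theorem testFun_support_subset_closedBall {X : Type*} [NormedAddCommGroup X] {f : X → ℂ}
    (hf : f ∈ testFun X) : ∃ R : ℝ, 0 < R ∧ ∀ x, f x ≠ 0 → ‖x‖ ≤ R := by
  obtain ⟨R, hR⟩ := (testFun_isCompact_support hf).isBounded.subset_closedBall 0
  exact ⟨max R 1, by positivity, fun x hx =>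
    (mem_closedBall_zero_iff.1 (hR hx)).trans (le_max_left _ _)⟩

theorem isClopen_closedBall {r : ℝ} (hr : 0 < r) : IsClopen (Metric.closedBall (0 : K) r) :=
  IsUltrametricDist.isClopen_closedBall _ hr.ne'

theorem one_indicator_mem_testFun {r : ℝ} (hr : 0 < r) :
    (Metric.closedBall (0 : K) r).indicator (fun _ => (1 : ℂ)) ∈ testFun K :=
  indicator_mem_testFun (isClopen_closedBall hr) (isCompact_closedBall _ _)
    (IsLocallyConstant.const _)

variable [MeasurableSpace K] [BorelSpace K] (μ : Measure K) [μ.IsAddHaarMeasure]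

theorem integrable_quasiChar_mul (ϖ : Uniformizer K) (ξ : UnitChar K) {s : ℂ} (hs : -1 < s.re)
    {φ : K → ℂ} (hφ : φ ∈ testFun K) : Integrable (fun x => quasiChar ϖ ξ s x * φ x) μ := by
  obtain ⟨C, hC0, hC⟩ := testFun_bound hφ
  obtain ⟨R, -, hR⟩ := testFun_support_subset_closedBall hφ
  have h1 : Integrable ((Metric.closedBall (0 : K) R).indicator fun x => absVal ϖ x ^ s.re * C) μ :=
    IntegrableOn.integrable_indicator
      (Integrable.mul_const (integrableOn_absVal_rpow_closedBall μ ϖ hs R) C)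
      Metric.isClosed_closedBall.measurableSet
  refine h1.mono' ((measurable_quasiChar ϖ ξ s).mul
    (testFun_continuous hφ).measurable).aestronglyMeasurable ?_
  filter_upwards [ae_ne_zero μ] with x hx
  by_cases hx' : φ x = 0
  · rw [hx', mul_zero, norm_zero]
    exact Set.indicator_nonneg (fun x _ => mul_nonneg
      (Real.rpow_nonneg (absVal_nonneg ϖ x) _) hC0) _
  · rw [Set.indicator_of_mem (mem_closedBall_zero_iff.2 (hR x hx')), norm_mul,
      norm_quasiChar ϖ ξ s hx]
    exact mul_le_mul_of_nonneg_left (hC x) (Real.rpow_nonneg (absVal_nonneg ϖ x) _)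

theorem integral_quasiChar_mul_comp (ϖ : Uniformizer K) (ξ : UnitChar K) (s : ℂ) (b : Kˣ)
    (φ : K → ℂ) : ∫ x, quasiChar ϖ ξ s x * φ (invScale b x) ∂μ =
      quasiChar ϖ ξ (s + 1) b * ∫ x, quasiChar ϖ ξ s x * φ x ∂μ := by
  have h := integral_mul_left μ ϖ b.ne_zero fun x => quasiChar ϖ ξ s x * φ (invScale b x)
  have hb : ((absVal ϖ (b : K) : ℝ) : ℂ) ≠ 0 := by
    exact_mod_cast (absVal_pos ϖ b.ne_zero).ne'
  simp only [invScale_apply, map_mul, inv_mul_cancel_left₀ b.ne_zero, mul_assoc] at h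
  rw [integral_const_mul, eq_inv_mul_iff_mul_eq₀ hb] at h
  simp only [invScale_apply]
  rw [← h, ← mul_assoc, mul_comm ((absVal ϖ (b : K) : ℝ) : ℂ), quasiChar_mul_absVal]

/-- The distribution `φ ↦ c ∫ ξ_s(x) (φ(x) - φ(b⁻¹ x)) dx`, `(b, c)` being the scaling data
of `ξ`.  The integrand is a test function for every `s`, and for `Re s > -1` the value is
`L(1, ξ_s)⁻¹ ∫ ξ_s φ`. -/
def homDist (ϖ : Uniformizer K) (ξ : UnitChar K) (s : ℂ) : Distribution K where
  toFun φ := scaleConst ϖ ξ *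
    ∫ x, quasiChar ϖ ξ s x * subComp (invScale (scaleUnit ϖ ξ)) φ.1 x ∂μ
  map_add' φ φ' := by
    rw [← mul_add, ← integral_add
      (testFun_integrable (quasiChar_mul_subComp_mem ϖ ξ s _ φ.2))
      (testFun_integrable (quasiChar_mul_subComp_mem ϖ ξ s _ φ'.2))]
    congr 1
    refine integral_congr_ae (Eventually.of_forall fun x => ?_)
    simp only
    rw [← mul_add, Submodule.coe_add, map_add]; rfl
  map_smul' c φ := by
    rw [RingHom.id_apply, smul_eq_mul, mul_left_comm, ← integral_const_mul c]
    congr 1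
    refine integral_congr_ae (Eventually.of_forall fun x => ?_)
    simp only
    rw [mul_left_comm, Submodule.coe_smul, map_smul]; rfl

theorem homDist_apply (ϖ : Uniformizer K) (ξ : UnitChar K) (s : ℂ) (φ : testFun K) :
    homDist μ ϖ ξ s φ = scaleConst ϖ ξ *
      ∫ x, quasiChar ϖ ξ s x * subComp (invScale (scaleUnit ϖ ξ)) φ.1 x ∂μ := rfl

theorem homDist_eq_of_integrable (ϖ : Uniformizer K) (ξ : UnitChar K) (s : ℂ) (φ : testFun K)
    (h : Integrable (fun x => quasiChar ϖ ξ s x * φ.1 x) μ) :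
    homDist μ ϖ ξ s φ = eulerFactor ϖ ξ (s + 1) * ∫ x, quasiChar ϖ ξ s x * φ.1 x ∂μ := by
  have h2 : Integrable (fun x => quasiChar ϖ ξ s x * φ.1 (invScale (scaleUnit ϖ ξ) x)) μ := by
    have := h.sub (testFun_integrable (quasiChar_mul_subComp_mem ϖ ξ s (scaleUnit ϖ ξ) φ.2))
    refine this.congr (Eventually.of_forall fun x => ?_)
    simp only [Pi.sub_apply, subComp_apply]
    ring
  rw [homDist_apply, ← scaleConst_mul]
  simp only [subComp_apply, mul_sub]
  rw [integral_sub h h2, integral_quasiChar_mul_comp]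
  ring

/-- For `re s > -1` both terms of the scaling integrand are integrable, and rescaling
the second one turns the integral into an Euler factor times the integral of `|x| ^ s ξ(x) φ(x)`. -/
theorem isHomogeneousFamily_homDist (ϖ : Uniformizer K) (ξ : UnitChar K) :
    IsHomogeneousFamily μ ϖ ξ (homDist μ ϖ ξ) := by
  constructor
  · intro φ
    simp only [homDist_apply]
    refine Differentiable.const_mul ?_ _
    have h0 := const_mem_holFam (P := ℂ) (Z := {(0 : K)})
      (subComp_mem (invScale (scaleUnit ϖ ξ)) φ.2) (by
        rintro x rfl; exact subComp_eq_zero _ _ (by simp [invScale_apply]))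
    exact differentiable_integral_of_mem_holFam μ
      (quasiChar_mul_mem_holFam ϖ ξ continuous_id (fun x hx => hx) differentiable_id h0)
  · intro s hs φ
    rw [inv_localL, homDist_eq_of_integrable μ ϖ ξ s φ (integrable_quasiChar_mul μ ϖ ξ hs φ.2)]
    rfl

/-- Entire functions that agree on a half plane agree. -/
theorem eq_of_eqOn_halfPlane {f g : ℂ → ℂ} (hf : Differentiable ℂ f) (hg : Differentiable ℂ g)
    {a : ℝ} (h : ∀ s : ℂ, a < s.re → f s = g s) : f = g := by
  have hf' : AnalyticOnNhd ℂ f Set.univ := fun z _ => hf.analyticAt z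
  have hg' : AnalyticOnNhd ℂ g Set.univ := fun z _ => hg.analyticAt z
  refine hf'.eq_of_eventuallyEq hg' (z₀ := ((a + 1 : ℝ) : ℂ)) ?_
  have : {s : ℂ | a < s.re} ∈ 𝓝 ((a + 1 : ℝ) : ℂ) :=
    (isOpen_lt continuous_const Complex.continuous_re).mem_nhds (by simp)
  filter_upwards [this] with s hs using h s hs

theorem homogeneousFamily_eq (ϖ : Uniformizer K) (ξ : UnitChar K) :
    homogeneousFamily μ ϖ ξ = homDist μ ϖ ξ := by
  have h1 := isHomogeneousFamily_homDist μ ϖ ξ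
  have h2 : IsHomogeneousFamily μ ϖ ξ (homogeneousFamily μ ϖ ξ) :=
    Classical.epsilon_spec ⟨_, h1⟩
  ext s φ
  have := eq_of_eqOn_halfPlane (h2.1 φ) (h1.1 φ) (a := -1) fun s hs => by
    rw [h2.2 s hs φ, h1.2 s hs φ]
  exact congrFun this s

/-- The residue of `|x| ^ s` at `s = -1` is a multiple of the Dirac distribution. -/
theorem integral_absVal_inv_mul_subComp (ϖ : Uniformizer K) {g : K → ℂ} (hg : g ∈ testFun K) :
    ∫ x, quasiChar ϖ 1 (-1) x * subComp (invScale ϖ.val) g x ∂μ =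
      μ.real {x : K | ‖x‖ = 1} * g 0 := by
  classical
  have h1 := one_indicator_mem_testFun (K := K) one_pos
  set e : K → ℂ := (Metric.closedBall (0 : K) 1).indicator fun _ => (1 : ℂ) with he_def
  have he0 : e 0 = 1 := by simp [he_def]
  have key : ∀ φ : testFun K, homDist μ ϖ 1 (-1) φ =
      ∫ x, quasiChar ϖ 1 (-1) x * subComp (invScale ϖ.val) φ.1 x ∂μ := fun φ => by
    rw [homDist_apply, scaleConst_one, scaleUnit_one, one_mul]
  have he : homDist μ ϖ 1 (-1) ⟨e, h1⟩ = μ.real {x : K | ‖x‖ = 1} := by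
    have : (fun x => quasiChar ϖ 1 (-1) x * subComp (invScale ϖ.val) e x) =
        {x : K | ‖x‖ = 1}.indicator fun _ => (1 : ℂ) := by
      ext x
      have h2 : ‖x‖ ≤ ‖(ϖ.val : K)‖ ↔ ‖x‖ < 1 :=
        ⟨fun h => h.trans_lt ϖ.norm_lt_one, ϖ.le_norm x⟩
      simp only [subComp_apply, he_def, Set.indicator_apply, invScale_apply,
        mem_closedBall_zero_iff, norm_mul, norm_inv, inv_mul_le_one₀ ϖ.norm_pos, h2,
        Set.mem_ofPred_eq]
      rcases lt_trichotomy ‖x‖ 1 with h | h | h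
      · simp [h, h.le, h.ne]
      · have h3 : quasiChar ϖ (1 : UnitChar K) (-1) x = 1 := by
          rw [quasiChar_congr_of_norm_eq_one ϖ 1 (-1) 1 h, quasiChar_one_one,
            absVal_of_norm_eq_one ϖ h]; simp
        simp [h, h3]
      · simp [h.le.not_gt, h.not_ge, h.ne']
    rw [key, this, integral_indicator (isClosed_eq continuous_norm
      continuous_const).measurableSet, setIntegral_const]
    simp
  -- a test function that vanishes at `0` is annihilated: the Euler factor is zero at `s = -1`
  let φ₀ : testFun K := ⟨g, hg⟩ - g 0 • ⟨e, h1⟩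
  have hφ₀ : homDist μ ϖ 1 (-1) φ₀ = 0 := by
    have h0 : ∀ x : K, x = 0 → φ₀.1 x = 0 := by
      rintro x rfl
      change g 0 - g 0 * e 0 = 0
      rw [he0]; ring
    rw [homDist_eq_of_integrable μ ϖ 1 (-1) φ₀ (testFun_integrable
      (quasiChar_mul_mem_testFun ϖ 1 (-1) continuous_id φ₀.2 h0)), neg_add_cancel, eulerFactor,
      if_pos rfl, quasiChar_uniformizer]
    simp
  rw [← key ⟨g, hg⟩, ← he, mul_comm, ← smul_eq_mul, ← map_smul, ← sub_eq_zero, ← map_sub]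
  exact hφ₀

end Homogeneous

/-! ### Gamma factors -/

section Gamma

variable {K : Type*} [NontriviallyNormedField K] [IsUltrametricDist K]

theorem exists_addChar_eq_one {ψ : AddChar K Circle} (hψ : Continuous ψ) :
    ∃ δ : ℝ, 0 < δ ∧ ∀ x : K, ‖x‖ ≤ δ → ψ x = 1 := by
  have hopen : {x : K | ‖(ψ x : ℂ) - 1‖ < 1 / 2} ∈ 𝓝 (0 : K) := by
    refine IsOpen.mem_nhds ?_ (by simp)
    have hc : Continuous fun x : K => (ψ x : ℂ) := continuous_subtype_val.comp hψ
    exact isOpen_lt (hc.sub continuous_const).norm continuous_const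
  obtain ⟨δ, hδ, hball⟩ := Metric.nhds_basis_closedBall.mem_iff.1 hopen
  refine ⟨δ, hδ, fun x hx => ?_⟩
  ext
  rw [Circle.coe_one]
  refine eq_one_of_norm_pow_sub_one_le fun n => ?_
  rw [← Circle.coe_pow, ← AddChar.map_nsmul_eq_pow]
  refine le_of_lt (hball ?_)
  rw [mem_closedBall_zero_iff, nsmul_eq_mul, norm_mul]
  exact (mul_le_of_le_one_left (norm_nonneg _) (IsUltrametricDist.norm_natCast_le_one K _)).trans hx

theorem exists_addChar_ne_one {ψ : AddChar K Circle} (hψ : ψ ≠ 1) : ∃ x : K, ψ x ≠ 1 := by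
  by_contra! h
  exact hψ (by ext x; rw [h x]; rfl)

theorem isLocallyConstant_addChar {ψ : AddChar K Circle} (hψ : Continuous ψ) :
    IsLocallyConstant fun x : K => (ψ x : ℂ) := by
  obtain ⟨δ, hδ, h⟩ := exists_addChar_eq_one hψ
  rw [IsLocallyConstant.iff_eventually_eq]
  intro x
  filter_upwards [Metric.ball_mem_nhds x hδ] with y hy
  rw [mem_ball_iff_norm] at hy
  rw [← sub_add_cancel y x, AddChar.map_add_eq_mul, h _ hy.le, one_mul]

theorem norm_add_eq_of_norm_lt {x y : K} (h : ‖y‖ < ‖x‖) : ‖x + y‖ = ‖x‖ := by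
  rw [IsUltrametricDist.norm_add_eq_max_of_norm_ne_norm h.ne', max_eq_left h.le]

/-- The additive character `ψ`, cut off to the ball of radius `R`. -/
def truncChar (ψ : AddChar K Circle) (R : ℝ) : K → ℂ :=
  (Metric.closedBall (0 : K) R).indicator fun x => (ψ x : ℂ)

variable [ProperSpace K]

theorem truncChar_mem_testFun {ψ : AddChar K Circle} (hψ : Continuous ψ) {R : ℝ} (hR : 0 < R) :
    truncChar ψ R ∈ testFun K :=
  indicator_mem_testFun (isClopen_closedBall hR) (isCompact_closedBall _ _)
    (isLocallyConstant_addChar hψ)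

variable [MeasurableSpace K] [BorelSpace K] (μ : Measure K) [μ.IsAddHaarMeasure]

/-- Oscillation: `ψ ξ_s` has integral zero over all large annuli, because `ξ_s` is invariant under
a translation by which `ψ` is multiplied by a constant different from `1`. -/
theorem exists_integral_annulus_eq_zero (ϖ : Uniformizer K) {ψ : AddChar K Circle} (hψ : ψ ≠ 1)
    (ξ : UnitChar K) : ∃ R₀ : ℝ, 0 < R₀ ∧ ∀ (R : ℝ) (s : ℂ),
      ∫ x, {x : K | R₀ < ‖x‖ ∧ ‖x‖ ≤ R}.indicator (fun x => quasiChar ϖ ξ s x * (ψ x : ℂ)) x ∂μ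
        = 0 := by
  classical
  obtain ⟨y, hy⟩ := exists_addChar_ne_one hψ
  obtain ⟨ε, hε, hε1, h⟩ := exists_quasiChar_add_eq ϖ ξ
  have hy0 : y ≠ 0 := by rintro rfl; exact hy (AddChar.map_zero_eq_one ψ)
  have hyn : 0 < ‖y‖ := norm_pos_iff.2 hy0
  refine ⟨‖y‖ / ε, div_pos hyn hε, fun R s => ?_⟩
  have hyR : ‖y‖ < ‖y‖ / ε := by
    rw [lt_div_iff₀ hε]; exact mul_lt_of_lt_one_right hyn hε1
  set F : K → ℂ := {x : K | ‖y‖ / ε < ‖x‖ ∧ ‖x‖ ≤ R}.indicator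
    (fun x => quasiChar ϖ ξ s x * (ψ x : ℂ)) with hF
  have hFy : ∀ x, F (x + y) = (ψ y : ℂ) * F x := by
    intro x
    by_cases hx : ‖y‖ / ε < ‖x‖
    · have hn : ‖x + y‖ = ‖x‖ := norm_add_eq_of_norm_lt (hyR.trans hx)
      have hq := h s x y (by rw [div_lt_iff₀ hε] at hx; linarith)
      simp only [hF, Set.indicator_apply, Set.mem_ofPred_eq, hn, hq, AddChar.map_add_eq_mul,
        Circle.coe_mul]
      split_ifs
      · ring
      · simp
    · have hx' : ‖x + y‖ ≤ ‖y‖ / ε :=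
        (IsUltrametricDist.norm_add_le_max x y).trans (max_le (not_lt.1 hx) hyR.le)
      simp [hF, hx, hx'.not_gt]
  have h1 := integral_add_right_eq_self (μ := μ) F y
  simp only [hFy, integral_const_mul] at h1
  have h2 : ((ψ y : ℂ) - 1) * ∫ x, F x ∂μ = 0 := by rw [sub_mul, h1, one_mul, sub_self]
  refine (mul_eq_zero.1 h2).resolve_left ?_
  intro h3
  exact hy (by ext; exact sub_eq_zero.1 h3)

/-- The integral of `ψ ξ_s` over a ball does not depend on the ball, once it is large. -/
theorem exists_integral_truncChar_eq (ϖ : Uniformizer K) {ψ : AddChar K Circle}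
    (hψc : Continuous ψ) (hψ : ψ ≠ 1) (ξ : UnitChar K) : ∃ R₀ : ℝ, 0 < R₀ ∧
    (∀ (s : ℂ), -1 < s.re → ∀ R, R₀ ≤ R →
      ∫ x, quasiChar ϖ ξ s x * truncChar ψ R x ∂μ =
        ∫ x, quasiChar ϖ ξ s x * truncChar ψ R₀ x ∂μ) ∧
    ∀ s : ℂ, -1 < s.re → Tendsto (fun n : ℕ =>
      ∫ x in {x : K | (residueCard K : ℝ) ^ (-(n : ℤ)) ≤ absVal ϖ x ∧
          absVal ϖ x ≤ (residueCard K : ℝ) ^ (n : ℤ)}, quasiChar ϖ ξ s x * (ψ x : ℂ) ∂μ)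
      atTop (𝓝 (∫ x, quasiChar ϖ ξ s x * truncChar ψ R₀ x ∂μ)) := by
  classical
  obtain ⟨R₀, hR₀, h0⟩ := exists_integral_annulus_eq_zero μ ϖ hψ ξ
  have hint : ∀ s : ℂ, -1 < s.re → ∀ R, 0 < R →
      Integrable (fun x => quasiChar ϖ ξ s x * truncChar ψ R x) μ := fun s hs R hR =>
    integrable_quasiChar_mul μ ϖ ξ hs (truncChar_mem_testFun hψc hR)
  refine ⟨R₀, hR₀, fun s hs R hR => ?_, fun s hs => ?_⟩
  · rw [← sub_eq_zero, ← integral_sub (hint s hs R (hR₀.trans_le hR)) (hint s hs R₀ hR₀), ← h0 R s]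
    refine integral_congr_ae (Eventually.of_forall fun x => ?_)
    simp only [truncChar, Set.indicator_apply, mem_closedBall_zero_iff, Set.mem_ofPred_eq]
    by_cases h1 : ‖x‖ ≤ R₀
    · simp [h1, h1.trans hR, h1.not_gt]
    · simp [h1, not_le.1 h1]
  · have hq := residueCard_pos K
    have hlow : ∀ (n : ℕ) (x : K), (residueCard K : ℝ) ^ (-(n : ℤ)) ≤ absVal ϖ x ↔
        ‖(ϖ.val : K)‖ ^ n ≤ ‖x‖ := by
      intro n x
      have : absVal ϖ ((ϖ.val : K) ^ n) = (residueCard K : ℝ) ^ (-(n : ℤ)) :=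
        absVal_of_norm_eq_zpow ϖ (by rw [norm_pow, zpow_natCast])
      rw [← this, absVal_le_iff, norm_pow]
    have hup : ∀ (n : ℕ) (x : K), absVal ϖ x ≤ (residueCard K : ℝ) ^ (n : ℤ) ↔
        ‖x‖ ≤ (‖(ϖ.val : K)‖⁻¹) ^ n := by
      intro n x
      have : absVal ϖ (((ϖ.val : K)⁻¹) ^ n) = (residueCard K : ℝ) ^ (n : ℤ) := by
        rw [absVal_of_norm_eq_zpow (k := -(n : ℤ)) ϖ, neg_neg]
        rw [norm_pow, norm_inv, zpow_neg, zpow_natCast, inv_pow]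
      rw [← this, absVal_le_iff, norm_pow, norm_inv]
    simp only [hlow, hup]
    have hlim : Tendsto (fun n : ℕ => ∫ x, {x : K | ‖(ϖ.val : K)‖ ^ n ≤ ‖x‖}.indicator
        (fun x => quasiChar ϖ ξ s x * truncChar ψ R₀ x) x ∂μ) atTop
        (𝓝 (∫ x, quasiChar ϖ ξ s x * truncChar ψ R₀ x ∂μ)) := by
      refine tendsto_integral_of_dominated_convergence _ (fun n => ?_) (hint s hs R₀ hR₀).norm
        (fun n => Eventually.of_forall fun x => norm_indicator_le_norm_self _ _) ?_
      · exact (hint s hs R₀ hR₀).aestronglyMeasurable.indicator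
          (isClosed_le continuous_const continuous_norm).measurableSet
      · filter_upwards [ae_ne_zero μ] with x hx
        have := tendsto_pow_atTop_nhds_zero_of_lt_one (norm_nonneg _) ϖ.norm_lt_one
        refine tendsto_const_nhds.congr' ?_
        filter_upwards [this.eventually_le_const (norm_pos_iff.2 hx)] with n hn
        rw [Set.indicator_of_mem (by exact hn)]
    refine hlim.congr' ?_
    have hpow : ∀ᶠ n : ℕ in atTop, R₀ ≤ ‖(ϖ.val : K)‖⁻¹ ^ n :=
      (tendsto_pow_atTop_atTop_of_one_lt
        ((one_lt_inv₀ ϖ.norm_pos).2 ϖ.norm_lt_one)).eventually_ge_atTop R₀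
    have hpow2 := (tendsto_pow_atTop_nhds_zero_of_lt_one (norm_nonneg _)
      ϖ.norm_lt_one).eventually_le_const hR₀
    filter_upwards [hpow, hpow2] with n hn hn2
    have hms : MeasurableSet {x : K | ‖(ϖ.val : K)‖ ^ n ≤ ‖x‖ ∧ ‖x‖ ≤ ‖(ϖ.val : K)‖⁻¹ ^ n} :=
      ((isClosed_le continuous_const continuous_norm).inter
        (isClosed_le continuous_norm continuous_const)).measurableSet
    rw [← integral_indicator hms, ← sub_eq_zero, ← integral_sub]
    · rw [← neg_eq_zero, ← integral_neg, ← h0 (‖(ϖ.val : K)‖⁻¹ ^ n) s]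
      refine integral_congr_ae (Eventually.of_forall fun x => ?_)
      simp only [truncChar, Set.indicator_apply, mem_closedBall_zero_iff, Set.mem_ofPred_eq]
      generalize ‖(ϖ.val : K)‖⁻¹ ^ n = B at hn ⊢
      by_cases h1 : ‖x‖ ≤ R₀
      · simp [h1, h1.trans hn, h1.not_gt]
      · simp [h1, not_le.1 h1, hn2.trans (not_le.1 h1).le]
    · exact (hint s hs R₀ hR₀).indicator
        (isClosed_le continuous_const continuous_norm).measurableSet
    · have := (hint s hs _ (hR₀.trans_le hn)).indicator (s := {x : K | ‖(ϖ.val : K)‖ ^ n ≤ ‖x‖})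
        (isClosed_le continuous_const continuous_norm).measurableSet
      refine this.congr (Eventually.of_forall fun x => ?_)
      simp only [truncChar, Set.indicator_apply, mem_closedBall_zero_iff, Set.mem_ofPred_eq]
      generalize ‖(ϖ.val : K)‖⁻¹ ^ n = B
      by_cases h1 : ‖x‖ ≤ B <;> simp [h1]

theorem gammaIntegrand_eq (ϖ : Uniformizer K) (ψ : AddChar K Circle) (ξ : UnitChar K) (s : ℂ)
    (x : K) : (ψ x : ℂ) * charFun (twist ϖ ξ s) x * ((absVal ϖ x)⁻¹ : ℝ) =
      quasiChar ϖ ξ (s - 1) x * (ψ x : ℂ) := by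
  rw [← quasiChar_mul_absVal_inv, charFun_twist]
  push_cast
  ring

/-- Gamma factors exist: up to the local factor, `Γ(ξ_s)` is the value of the holomorphic
homogeneous family at a cut-off of `ψ`. -/
theorem exists_isGammaFactor (ϖ : Uniformizer K) {ψ : AddChar K Circle}
    (hψc : Continuous ψ) (hψ : ψ ≠ 1) (ξ : UnitChar K) : ∃ G, IsGammaFactor μ ϖ ψ ξ G := by
  obtain ⟨R₀, hR₀, -, hlim⟩ := exists_integral_truncChar_eq μ ϖ hψc hψ ξ
  let Φ : testFun K := ⟨truncChar ψ R₀, truncChar_mem_testFun hψc hR₀⟩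
  have hD : Differentiable ℂ fun s => homDist μ ϖ ξ (s - 1) Φ :=
    ((isHomogeneousFamily_homDist μ ϖ ξ).1 Φ).comp (differentiable_id.sub_const 1)
  let G₀ : ℂ → ℂ := fun s => homDist μ ϖ ξ (s - 1) Φ / eulerFactor ϖ ξ s
  have hmer : MeromorphicOn G₀ Set.univ := fun z _ =>
    (hD.analyticAt z).meromorphicAt.div
      ((differentiable_eulerFactor ϖ ξ).analyticAt z).meromorphicAt
  refine ⟨toMeromorphicNFOn G₀ Set.univ, meromorphicNFOn_toMeromorphicNFOn _ _, fun s hs => ?_⟩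
  have hana : AnalyticAt ℂ G₀ s := (hD.analyticAt s).div
    ((differentiable_eulerFactor ϖ ξ).analyticAt s) (eulerFactor_ne_zero ϖ ξ hs)
  have hs1 : -1 < (s - 1).re := by rw [Complex.sub_re, Complex.one_re]; linarith
  have hval : toMeromorphicNFOn G₀ Set.univ s =
      ∫ x, quasiChar ϖ ξ (s - 1) x * truncChar ψ R₀ x ∂μ := by
    rw [toMeromorphicNFOn_eq_toMeromorphicNFAt hmer (Set.mem_univ s),
      toMeromorphicNFAt_eq_self.2 hana.meromorphicNFAt]
    simp only [G₀]
    rw [homDist_eq_of_integrable μ ϖ ξ (s - 1) Φ (integrable_quasiChar_mul μ ϖ ξ hs1 Φ.2),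
      sub_add_cancel, mul_div_cancel_left₀ _ (eulerFactor_ne_zero ϖ ξ hs)]
  rw [hval]
  simp only [gammaIntegrand_eq]
  exact hlim (s - 1) hs1

theorem isGammaFactor_gammaFactor (ϖ : Uniformizer K) {ψ : AddChar K Circle}
    (hψc : Continuous ψ) (hψ : ψ ≠ 1) (ξ : UnitChar K) :
    IsGammaFactor μ ϖ ψ ξ (gammaFactor μ ϖ ψ ξ) :=
  Classical.epsilon_spec (exists_isGammaFactor μ ϖ hψc hψ ξ)

/-- For `Re s > 0` the gamma factor is the integral of `ψ ξ_{s-1}` over any large ball. -/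
theorem exists_gammaFactor_eq (ϖ : Uniformizer K) {ψ : AddChar K Circle}
    (hψc : Continuous ψ) (hψ : ψ ≠ 1) (ξ : UnitChar K) : ∃ R₀ : ℝ, 0 < R₀ ∧
    ∀ s : ℂ, 0 < s.re → ∀ R, R₀ ≤ R →
      ∫ x, quasiChar ϖ ξ (s - 1) x * truncChar ψ R x ∂μ = gammaFactor μ ϖ ψ ξ s := by
  obtain ⟨R₀, hR₀, hstab, hlim⟩ := exists_integral_truncChar_eq μ ϖ hψc hψ ξ
  refine ⟨R₀, hR₀, fun s hs R hR => ?_⟩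
  have hs1 : -1 < (s - 1).re := by rw [Complex.sub_re, Complex.one_re]; linarith
  have h1 := (isGammaFactor_gammaFactor μ ϖ hψc hψ ξ).2 s hs
  simp only [gammaIntegrand_eq] at h1
  rw [hstab (s - 1) hs1 R hR]
  exact tendsto_nhds_unique (hlim (s - 1) hs1) h1

end Gamma

/-! ### Fourier inversion on a local field -/

section Fourier

open scoped Pointwise

/-- A test function is invariant under all sufficiently small translations. -/
theorem exists_testFun_add_eq {X : Type*} [NormedAddCommGroup X] {f : X → ℂ}
    (hf : f ∈ testFun X) : ∃ δ : ℝ, 0 < δ ∧ ∀ x v : X, ‖v‖ ≤ δ → f (x + v) = f x := by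
  obtain ⟨δ, hδ, h⟩ := lebesgue_number_lemma_of_metric (testFun_isCompact_support hf)
    (c := fun z : ℂ => f ⁻¹' {z}) (fun z => hf.1 _) (fun x _ => Set.mem_iUnion.2 ⟨f x, rfl⟩)
  have key : ∀ x v : X, ‖v‖ < δ → f x ≠ 0 → f (x + v) = f x := by
    intro x v hv hx
    obtain ⟨z, hz⟩ := h x hx
    have h1 : f x = z := hz (Metric.mem_ball_self hδ)
    have h2 : f (x + v) = z := hz (by rw [mem_ball_iff_norm]; simpa using hv)
    rw [h1, h2]
  refine ⟨δ / 2, half_pos hδ, fun x v hv => ?_⟩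
  have hv' : ‖v‖ < δ := by linarith
  by_cases hx : f x = 0
  · by_contra hne
    have h1 : f (x + v) ≠ 0 := fun h => hne (by rw [h, hx])
    have h2 := key (x + v) (-v) (by rwa [norm_neg]) h1
    rw [add_neg_cancel_right] at h2
    exact hne h2.symm
  · exact key x v hv' hx

variable {K : Type*} [NontriviallyNormedField K] [IsUltrametricDist K] [ProperSpace K]

/-- A nontrivial additive character has a conductor: a largest ball on which it is trivial. -/
theorem exists_conductor (ϖ : Uniformizer K) {ψ : AddChar K Circle} (hψc : Continuous ψ)
    (hψ : ψ ≠ 1) : ∃ d : ℤ, (∀ x : K, ‖x‖ ≤ ‖(ϖ.val : K)‖ ^ d → ψ x = 1) ∧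
      ∃ y : K, ‖y‖ ≤ ‖(ϖ.val : K)‖ ^ (d - 1) ∧ ψ y ≠ 1 := by
  obtain ⟨y₀, hy₀⟩ := exists_addChar_ne_one hψ
  obtain ⟨δ, hδ, hψδ⟩ := exists_addChar_eq_one hψc
  have hy0 : y₀ ≠ 0 := by rintro rfl; exact hy₀ (AddChar.map_zero_eq_one ψ)
  obtain ⟨k, hk⟩ := exists_norm_eq_zpow ϖ hy0
  obtain ⟨n, hn⟩ := exists_pow_lt_of_lt_one hδ ϖ.norm_lt_one
  obtain ⟨d, hd, hmin⟩ := Int.exists_least_of_bdd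
    (P := fun d : ℤ => ∀ x : K, ‖x‖ ≤ ‖(ϖ.val : K)‖ ^ d → ψ x = 1)
    ⟨k, fun m hm => by
      by_contra hlt
      exact hy₀ (hm y₀ (hk.le.trans
        (zpow_le_zpow_right_of_le_one₀ ϖ.norm_pos ϖ.norm_lt_one.le (not_le.1 hlt).le)))⟩
    ⟨n, fun x hx => hψδ x (hx.trans (by rw [zpow_natCast]; exact hn.le))⟩
  refine ⟨d, hd, ?_⟩
  by_contra! hc
  have := hmin (d - 1) hc
  omega

variable [MeasurableSpace K] [BorelSpace K] (μ : Measure K) [μ.IsAddHaarMeasure]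

theorem measureReal_closedBall (ϖ : Uniformizer K) (k : ℤ) :
    μ.real (Metric.closedBall (0 : K) (‖(ϖ.val : K)‖ ^ k)) =
      (residueCard K : ℝ) ^ (-k) * μ.real (Metric.closedBall (0 : K) 1) := by
  have h := distribHaarChar_mul μ (ϖ.val ^ k) (Metric.closedBall (0 : K) 1)
  have h2 : (ϖ.val ^ k) • Metric.closedBall (0 : K) 1 =
      Metric.closedBall (0 : K) (‖(ϖ.val : K)‖ ^ k) := by
    ext x
    rw [Set.mem_smul_set_iff_inv_smul_mem]
    simp only [Units.smul_def, mem_closedBall_zero_iff, smul_eq_mul, norm_mul,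
      Units.val_inv_eq_inv_val, Units.val_zpow_eq_zpow_val, norm_inv, norm_zpow]
    rw [inv_mul_le_one₀ (zpow_pos ϖ.norm_pos k)]
  rw [h2] at h
  rw [Measure.real, Measure.real, ← h, ENNReal.toReal_mul, ENNReal.coe_toReal,
    distribHaarChar_eq ϖ]
  congr 1
  exact absVal_of_norm_eq_zpow ϖ (by rw [Units.val_zpow_eq_zpow_val, norm_zpow])

/-- The Fourier transform of a test function is a test function. -/
theorem fourier_mem_testFun {ψ : AddChar K Circle} (hψc : Continuous ψ) (hψ : ψ ≠ 1)
    {f : K → ℂ} (hf : f ∈ testFun K) : fourier μ ψ f ∈ testFun K := by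
  obtain ⟨y₀, hy₀⟩ := exists_addChar_ne_one hψ
  have hy0 : y₀ ≠ 0 := by rintro rfl; exact hy₀ (AddChar.map_zero_eq_one ψ)
  obtain ⟨ρ, hρ, hψρ⟩ := exists_addChar_eq_one hψc
  obtain ⟨δ, hδ, hfδ⟩ := exists_testFun_add_eq hf
  obtain ⟨R, hR, hfR⟩ := testFun_support_subset_closedBall hf
  constructor
  · rw [IsLocallyConstant.iff_eventually_eq]
    intro x
    filter_upwards [Metric.ball_mem_nhds x (div_pos hρ hR)] with y hy
    rw [mem_ball_iff_norm, lt_div_iff₀ hR] at hy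
    refine integral_congr_ae (Eventually.of_forall fun z => ?_)
    simp only
    by_cases hz : f z = 0
    · simp [hz]
    · have : y * z = (y - x) * z + x * z := by ring
      rw [this, AddChar.map_add_eq_mul, hψρ, one_mul]
      rw [norm_mul]
      exact (mul_le_mul_of_nonneg_left (hfR z hz) (norm_nonneg _)).trans hy.le
  · refine HasCompactSupport.of_support_subset_isCompact
      (isCompact_closedBall (0 : K) (‖y₀‖ / δ)) fun x hx => ?_
    rw [mem_closedBall_zero_iff]
    by_contra hlt
    rw [not_le] at hlt
    have hx0 : x ≠ 0 := norm_pos_iff.1 ((div_nonneg (norm_nonneg _) hδ.le).trans_lt hlt)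
    have hv : ‖y₀ / x‖ ≤ δ := by
      rw [norm_div, div_le_iff₀ (norm_pos_iff.2 hx0)]
      rw [div_lt_iff₀ hδ] at hlt
      linarith
    -- translation by `y₀ / x` does not change `f` but multiplies the integral by `ψ y₀ ≠ 1`
    have h1 := integral_add_right_eq_self (μ := μ) (fun z => (ψ (x * z) : ℂ) * f z) (y₀ / x)
    have h2 : ∀ z, (ψ (x * (z + y₀ / x)) : ℂ) * f (z + y₀ / x) =
        (ψ y₀ : ℂ) * ((ψ (x * z) : ℂ) * f z) := by
      intro z
      rw [hfδ z _ hv, mul_add, mul_div_cancel₀ _ hx0, AddChar.map_add_eq_mul, Circle.coe_mul]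
      ring
    simp only [h2, integral_const_mul] at h1
    have h3 : ((ψ y₀ : ℂ) - 1) * fourier μ ψ f x = 0 := by
      rw [sub_mul, one_mul, sub_eq_zero]; exact h1
    rcases mul_eq_zero.1 h3 with h4 | h4
    · exact hy₀ (by ext; exact sub_eq_zero.1 h4)
    · exact hx h4

/-- The integral of `y ↦ ψ(y z)` over a ball is the volume of the ball if the character is trivial
there, and `0` otherwise. -/
theorem integral_closedBall_addChar (ϖ : Uniformizer K) {ψ : AddChar K Circle} {d : ℤ}
    (hd : ∀ x : K, ‖x‖ ≤ ‖(ϖ.val : K)‖ ^ d → ψ x = 1)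
    (hd' : ∃ y : K, ‖y‖ ≤ ‖(ϖ.val : K)‖ ^ (d - 1) ∧ ψ y ≠ 1) (m : ℤ) (z : K) :
    ∫ y, (Metric.closedBall (0 : K) (‖(ϖ.val : K)‖ ^ m)).indicator
        (fun y => (ψ (y * z) : ℂ)) y ∂μ =
      (Metric.closedBall (0 : K) (‖(ϖ.val : K)‖ ^ (d - m))).indicator
        (fun _ => (μ.real (Metric.closedBall (0 : K) (‖(ϖ.val : K)‖ ^ m)) : ℂ)) z := by
  classical
  have hpos := ϖ.norm_pos
  by_cases hz : ‖z‖ ≤ ‖(ϖ.val : K)‖ ^ (d - m)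
  · rw [Set.indicator_of_mem (mem_closedBall_zero_iff.2 hz),
      integral_indicator Metric.isClosed_closedBall.measurableSet,
      setIntegral_congr_fun (g := fun _ => (1 : ℂ)) Metric.isClosed_closedBall.measurableSet]
    · rw [setIntegral_const]; simp
    · intro y hy
      rw [mem_closedBall_zero_iff] at hy
      simp only
      rw [hd, Circle.coe_one]
      rw [norm_mul]
      calc ‖y‖ * ‖z‖ ≤ ‖(ϖ.val : K)‖ ^ m * ‖(ϖ.val : K)‖ ^ (d - m) :=
            mul_le_mul hy hz (norm_nonneg _) (zpow_nonneg hpos.le _)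
        _ = ‖(ϖ.val : K)‖ ^ d := by rw [← zpow_add₀ hpos.ne']; congr 1; ring
  · rw [Set.indicator_of_notMem (by rwa [mem_closedBall_zero_iff])]
    obtain ⟨y, hy, hψy⟩ := hd'
    have hz0 : z ≠ 0 := norm_pos_iff.1 ((zpow_nonneg hpos.le _).trans_lt (not_le.1 hz))
    obtain ⟨k, hk⟩ := exists_norm_eq_zpow ϖ hz0
    rw [hk, not_le] at hz
    have hkd := (zpow_lt_zpow_iff_right_of_lt_one₀ hpos ϖ.norm_lt_one).1 hz
    have hv : ‖y / z‖ ≤ ‖(ϖ.val : K)‖ ^ m := by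
      rw [norm_div, div_le_iff₀ (norm_pos_iff.2 hz0), hk, ← zpow_add₀ hpos.ne']
      exact hy.trans (zpow_le_zpow_right_of_le_one₀ hpos ϖ.norm_lt_one.le (by omega))
    set F := (Metric.closedBall (0 : K) (‖(ϖ.val : K)‖ ^ m)).indicator
        (fun y => (ψ (y * z) : ℂ)) with hF
    have hFv : ∀ x, F (x + y / z) = (ψ y : ℂ) * F x := by
      intro x
      have hiff : ‖x + y / z‖ ≤ ‖(ϖ.val : K)‖ ^ m ↔ ‖x‖ ≤ ‖(ϖ.val : K)‖ ^ m := by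
        constructor <;> intro h
        · have := IsUltrametricDist.norm_add_le_max (x + y / z) (-(y / z))
          rw [add_neg_cancel_right, norm_neg] at this
          exact this.trans (max_le h hv)
        · exact (IsUltrametricDist.norm_add_le_max _ _).trans (max_le h hv)
      have hxz : (x + y / z) * z = y + x * z := by field_simp; ring
      simp only [hF, Set.indicator_apply, mem_closedBall_zero_iff, hiff, hxz,
        AddChar.map_add_eq_mul, Circle.coe_mul]
      split_ifs <;> simp
    have h1 := integral_add_right_eq_self (μ := μ) F (y / z)
    simp only [hFv, integral_const_mul] at h1
    have h2 : ((ψ y : ℂ) - 1) * ∫ x, F x ∂μ = 0 := by rw [sub_mul, h1, one_mul, sub_self]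
    refine (mul_eq_zero.1 h2).resolve_left fun h3 => ?_
    exact hψy (by ext; exact sub_eq_zero.1 h3)

theorem continuous_coe_addChar {ψ : AddChar K Circle} (hψc : Continuous ψ) :
    Continuous fun x : K => (ψ x : ℂ) := continuous_subtype_val.comp hψc

/-- Fourier inversion. Pairing with `ψ (-x * y)` over a large ball and applying Fubini reproduces
`f x`, by orthogonality on balls, up to a constant that depends only on `μ` and the
conductor of `ψ`. -/
theorem exists_isFourierConst {ψ : AddChar K Circle} (ϖ : Uniformizer K) (hψc : Continuous ψ)
    (hψ : ψ ≠ 1) : ∃ c, IsFourierConst μ ψ c := by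
  classical
  obtain ⟨d, hd, hd'⟩ := exists_conductor ϖ hψc hψ
  have hq := residueCard_pos K
  have hvol : 0 < μ.real (Metric.closedBall (0 : K) 1) :=
    ENNReal.toReal_pos (Metric.measure_closedBall_pos _ _ one_pos).ne'
      (isCompact_closedBall _ _).measure_ne_top
  set V := μ.real (Metric.closedBall (0 : K) 1) with hV
  refine ⟨(residueCard K : ℝ) ^ d / V ^ 2, by positivity, fun f hf x => ?_⟩
  obtain ⟨R, hR, hfR⟩ := testFun_support_subset_closedBall (fourier_mem_testFun μ hψc hψ hf)
  obtain ⟨δ, hδ, hfδ⟩ := exists_testFun_add_eq hf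
  have hpos := ϖ.norm_pos
  -- a ball that contains the support of the transform, and whose dual ball has radius at most `δ`
  obtain ⟨m, hmR, hmδ⟩ : ∃ m : ℤ, R ≤ ‖(ϖ.val : K)‖ ^ m ∧ ‖(ϖ.val : K)‖ ^ (d - m) ≤ δ := by
    obtain ⟨n₁, hn₁⟩ := pow_unbounded_of_one_lt R ((one_lt_inv₀ hpos).2 ϖ.norm_lt_one)
    obtain ⟨n₂, hn₂⟩ := exists_pow_lt_of_lt_one hδ ϖ.norm_lt_one
    refine ⟨min (-(n₁ : ℤ)) (d - n₂), ?_, ?_⟩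
    · rw [inv_pow, ← zpow_natCast, ← zpow_neg] at hn₁
      exact hn₁.le.trans
        (zpow_le_zpow_right_of_le_one₀ hpos ϖ.norm_lt_one.le (min_le_left _ _))
    · rw [← zpow_natCast] at hn₂
      refine (zpow_le_zpow_right_of_le_one₀ hpos ϖ.norm_lt_one.le ?_).trans hn₂.le
      have := min_le_right (-(n₁ : ℤ)) (d - n₂)
      omega
  set B := Metric.closedBall (0 : K) (‖(ϖ.val : K)‖ ^ m) with hB
  have hBm : MeasurableSet B := Metric.isClosed_closedBall.measurableSet
  have h1 : ∀ y, (ψ (-(x * y)) : ℂ) * fourier μ ψ f y =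
      ∫ z, B.indicator (fun y => (ψ (y * (z - x)) : ℂ)) y * f z ∂μ := by
    intro y
    by_cases hy : y ∈ B
    · rw [fourier, ← integral_const_mul]
      refine integral_congr_ae (Eventually.of_forall fun z => ?_)
      simp only [Set.indicator_of_mem hy]
      rw [← mul_assoc, ← Circle.coe_mul, ← AddChar.map_add_eq_mul]
      congr 3
      ring
    · have : fourier μ ψ f y = 0 := by
        by_contra h
        exact hy (mem_closedBall_zero_iff.2 ((hfR y h).trans hmR))
      simp [this, hy]
  have hint : Integrable (Function.uncurry fun y z =>
      B.indicator (fun y => (ψ (y * (z - x)) : ℂ)) y * f z) (μ.prod μ) := by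
    have h2 : Integrable (fun p : K × K => B.indicator (fun _ => (1 : ℂ)) p.1 * f p.2)
        (μ.prod μ) :=
      Integrable.mul_prod ((integrable_indicator_iff hBm).2
        (integrableOn_const (isCompact_closedBall _ _).measure_ne_top)) (testFun_integrable hf)
    have hc : Continuous fun p : K × K => (ψ (p.1 * (p.2 - x)) : ℂ) :=
      (continuous_coe_addChar hψc).comp (by fun_prop)
    refine (h2.bdd_mul (c := 1) hc.aestronglyMeasurable
      (Eventually.of_forall fun p => (Circle.norm_coe _).le)).congr
      (Eventually.of_forall fun p => ?_)
    simp only [Function.uncurry, Set.indicator_apply]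
    split_ifs <;> simp
  have h3 : ∀ z, ∫ y, B.indicator (fun y => (ψ (y * (z - x)) : ℂ)) y * f z ∂μ =
      (Metric.closedBall (0 : K) (‖(ϖ.val : K)‖ ^ (d - m))).indicator
        (fun _ => (μ.real B : ℂ)) (z - x) * f z := by
    intro z
    rw [integral_mul_const, integral_closedBall_addChar μ ϖ hd hd' m (z - x)]
  simp only [h1]
  rw [integral_integral_swap hint]
  simp only [h3]
  rw [← integral_add_right_eq_self _ x]
  have h4 : ∀ z, (Metric.closedBall (0 : K) (‖(ϖ.val : K)‖ ^ (d - m))).indicator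
        (fun _ => (μ.real B : ℂ)) (z + x - x) * f (z + x) =
      (Metric.closedBall (0 : K) (‖(ϖ.val : K)‖ ^ (d - m))).indicator
        (fun _ => (μ.real B : ℂ) * f x) z := by
    intro z
    rw [add_sub_cancel_right]
    by_cases hz : z ∈ Metric.closedBall (0 : K) (‖(ϖ.val : K)‖ ^ (d - m))
    · rw [Set.indicator_of_mem hz, Set.indicator_of_mem hz, add_comm z x, hfδ x z]
      exact (mem_closedBall_zero_iff.1 hz).trans hmδ
    · rw [Set.indicator_of_notMem hz, Set.indicator_of_notMem hz, zero_mul]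
  simp only [h4]
  rw [integral_indicator Metric.isClosed_closedBall.measurableSet, setIntegral_const, hB,
    measureReal_closedBall, measureReal_closedBall, ← hV]
  have h5 : (residueCard K : ℂ) ^ d * ((residueCard K : ℂ) ^ (-(d - m)) *
      (residueCard K : ℂ) ^ (-m)) = 1 := by
    have hq' : (residueCard K : ℂ) ≠ 0 := by exact_mod_cast hq.ne'
    rw [← zpow_add₀ hq', ← zpow_add₀ hq', show d + (-(d - m) + -m) = 0 by ring, zpow_zero]
  have hV' : (V : ℂ) ≠ 0 := by exact_mod_cast hvol.ne'
  rw [Complex.real_smul]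
  push_cast
  field_simp
  linear_combination (-f x) * h5

theorem isFourierConst_fourierConst {ψ : AddChar K Circle} (ϖ : Uniformizer K)
    (hψc : Continuous ψ) (hψ : ψ ≠ 1) : IsFourierConst μ ψ (fourierConst μ ψ) :=
  Classical.epsilon_spec (exists_isFourierConst μ ϖ hψc hψ)

end Fourier

/-! ### The arithmetic of the quadratic extension -/

section QuadraticExtension

open scoped Pointwise

variable {F E : Type*} [NontriviallyNormedField F] [NontriviallyNormedField E] [NormedAlgebra F E]
  (Q : QuadraticGenerator F E)

theorem coord_symm_coord (p : F × F) : Q.coord.symm (Q.coord p) = p := Q.coord.symm_apply_apply p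

theorem coord_one : Q.coord (1, 0) = 1 := by rw [Q.coord_apply]; simp

theorem coord_algebraMap (x : F) : Q.coord (x, 0) = algebraMap F E x := by
  rw [Q.coord_apply]; simp

theorem coord_mul (p r : F × F) : Q.coord p * Q.coord r =
    Q.coord (p.1 * r.1 + p.2 * r.2 * Q.a, p.1 * r.2 + p.2 * r.1) := by
  simp only [Q.coord_apply, map_add, map_mul, ← Q.sq]
  ring

theorem algebraMap_mul_coord (c : F) (p : F × F) :
    algebraMap F E c * Q.coord p = Q.coord (c * p.1, c * p.2) := by
  rw [← coord_algebraMap Q, coord_mul]; simp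

theorem coord_eq_zero_iff (p : F × F) : Q.coord p = 0 ↔ p = 0 := by
  exact LinearEquiv.map_eq_zero_iff _

/-- The conjugation `x₁ + x₂ α ↦ x₁ - x₂ α`. -/
def QuadraticGenerator.conj (x : E) : E := Q.coord ((Q.coord.symm x).1, -(Q.coord.symm x).2)

theorem conj_coord (p : F × F) : Q.conj (Q.coord p) = Q.coord (p.1, -p.2) := by
  rw [QuadraticGenerator.conj, coord_symm_coord]

theorem conj_conj (x : E) : Q.conj (Q.conj x) = x := by
  obtain ⟨p, rfl⟩ := Q.coord.surjective x
  rw [conj_coord, conj_coord]; simp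

theorem conj_mul (x y : E) : Q.conj (x * y) = Q.conj x * Q.conj y := by
  obtain ⟨p, rfl⟩ := Q.coord.surjective x
  obtain ⟨r, rfl⟩ := Q.coord.surjective y
  rw [coord_mul, conj_coord, conj_coord, conj_coord, coord_mul]
  congr 2 <;> ring

theorem conj_one : Q.conj 1 = 1 := by
  rw [← coord_one Q, conj_coord]; simp

theorem conj_pow (x : E) (n : ℕ) : Q.conj (x ^ n) = Q.conj x ^ n := by
  induction n with
  | zero => rw [pow_zero, pow_zero, conj_one]
  | succ n ih => rw [pow_succ, conj_mul, ih, pow_succ]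

/-- The norm form `x₁² - x₂² α²`. -/
def QuadraticGenerator.normForm (x : E) : F :=
  (Q.coord.symm x).1 ^ 2 - (Q.coord.symm x).2 ^ 2 * Q.a

theorem normForm_coord (p : F × F) : Q.normForm (Q.coord p) = p.1 ^ 2 - p.2 ^ 2 * Q.a := by
  rw [QuadraticGenerator.normForm, coord_symm_coord]

theorem algebraMap_normForm (x : E) : algebraMap F E (Q.normForm x) = x * Q.conj x := by
  obtain ⟨p, rfl⟩ := Q.coord.surjective x
  rw [normForm_coord, conj_coord, coord_mul, ← coord_algebraMap Q]
  congr 2 <;> ring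

theorem normForm_algebraMap (x : F) : Q.normForm (algebraMap F E x) = x ^ 2 := by
  rw [← coord_algebraMap Q, normForm_coord]; simp

theorem normForm_algebraMap_mul (c : F) (x : E) :
    Q.normForm (algebraMap F E c * x) = c ^ 2 * Q.normForm x := by
  obtain ⟨p, rfl⟩ := Q.coord.surjective x
  rw [algebraMap_mul_coord, normForm_coord, normForm_coord]; ring

theorem generator_eq_coord : Q.α = Q.coord (0, 1) := by rw [Q.coord_apply]; simp

theorem generator_ne_zero : Q.α ≠ 0 := by
  rw [generator_eq_coord Q, Ne, coord_eq_zero_iff]; simp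

variable [ProperSpace F] [ProperSpace E]

/-- The coordinates on `E` as a linear homeomorphism. -/
def QuadraticGenerator.coordL : (F × F) ≃L[F] E :=
  Q.coord.toContinuousLinearEquiv

theorem continuous_coord : Continuous Q.coord := Q.coordL.continuous

theorem continuous_coord_symm : Continuous Q.coord.symm := Q.coordL.symm.continuous

theorem continuous_normForm : Continuous Q.normForm := by
  have h := continuous_coord_symm Q
  exact (h.fst.pow 2).sub ((h.snd.pow 2).mul_const _)

theorem exists_norm_coord_le : ∃ C : ℝ, 0 < C ∧ (∀ p, ‖Q.coord p‖ ≤ C * ‖p‖) ∧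
    ∀ p, ‖p‖ ≤ C * ‖Q.coord p‖ := by
  obtain ⟨C, hC, h⟩ := Q.coordL.toContinuousLinearMap.isBoundedLinearMap.bound
  obtain ⟨C', hC', h'⟩ := Q.coordL.symm.toContinuousLinearMap.isBoundedLinearMap.bound
  refine ⟨max C C', lt_max_of_lt_left hC, fun p => (h p).trans ?_, fun p => ?_⟩
  · exact mul_le_mul_of_nonneg_right (le_max_left _ _) (norm_nonneg _)
  · have := h' (Q.coord p)
    have h2 : ‖p‖ ≤ C' * ‖Q.coord p‖ := by
      refine le_trans (le_of_eq ?_) this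
      exact congrArg norm (coord_symm_coord Q p).symm
    exact h2.trans (mul_le_mul_of_nonneg_right (le_max_right _ _) (norm_nonneg _))

/-- Conjugation is a continuous automorphism, hence isometric. -/
theorem norm_conj (x : E) : ‖Q.conj x‖ = ‖x‖ := by
  obtain ⟨C, hC, h1, h2⟩ := exists_norm_coord_le Q
  have hbound : ∀ x, ‖Q.conj x‖ ≤ C * C * ‖x‖ := by
    intro x
    obtain ⟨p, rfl⟩ := Q.coord.surjective x
    rw [conj_coord]
    refine (h1 _).trans ?_
    rw [mul_assoc]
    refine mul_le_mul_of_nonneg_left ((le_of_eq ?_).trans (h2 p)) hC.le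
    simp [Prod.norm_def]
  have key : ∀ x, ‖Q.conj x‖ ≤ ‖x‖ := by
    intro x
    rcases eq_or_ne x 0 with rfl | hx
    · simpa using hbound 0
    by_contra hlt
    rw [not_le] at hlt
    have hx0 := norm_pos_iff.2 hx
    -- both norms are multiplicative, so a bounded distortion of all powers is trivial
    obtain ⟨n, hn⟩ := pow_unbounded_of_one_lt (C * C) ((one_lt_div hx0).2 hlt)
    have h3 := hbound (x ^ n)
    rw [conj_pow, norm_pow, norm_pow] at h3
    rw [div_pow, lt_div_iff₀ (pow_pos hx0 n)] at hn
    linarith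
  refine le_antisymm (key x) ?_
  conv_lhs => rw [← conj_conj Q x]
  exact key _

theorem conj_ne_zero {x : E} (hx : x ≠ 0) : Q.conj x ≠ 0 := by
  rw [← norm_ne_zero_iff, norm_conj]; exact norm_ne_zero_iff.2 hx

theorem normForm_ne_zero {x : E} (hx : x ≠ 0) : Q.normForm x ≠ 0 := by
  have h : algebraMap F E (Q.normForm x) ≠ 0 := by
    rw [algebraMap_normForm]; exact mul_ne_zero hx (conj_ne_zero Q hx)
  exact fun h0 => h (by rw [h0, map_zero])

theorem norm_normForm (x : E) : ‖Q.normForm x‖ = ‖x‖ ^ 2 := by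
  rw [← norm_algebraMap' E (Q.normForm x), algebraMap_normForm, norm_mul, norm_conj, sq]

variable [MeasurableSpace F] [BorelSpace F] [MeasurableSpace E] [BorelSpace E]

instance : (haarO F).IsAddHaarMeasure := by unfold haarO; infer_instance

instance : Q.haarE.IsAddHaarMeasure :=
  Q.coordL.isAddHaarMeasure_map ((haarO F).prod (haarO F))

/-- Integration over `E` in coordinates. -/
theorem integral_haarE (f : E → ℂ) :
    ∫ x, f x ∂Q.haarE = ∫ p, f (Q.coord p) ∂(haarO F).prod (haarO F) :=
  integral_map_equiv Q.coordL.toHomeomorph.toMeasurableEquiv f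

theorem integrable_haarE_iff (f : E → ℂ) :
    Integrable f Q.haarE ↔ Integrable (fun p => f (Q.coord p)) ((haarO F).prod (haarO F)) :=
  integrable_map_equiv Q.coordL.toHomeomorph.toMeasurableEquiv f

variable [IsUltrametricDist F] [IsUltrametricDist E]

theorem measureReal_unitSphere_haarO (ϖF : Uniformizer F) :
    (haarO F).real {x : F | ‖x‖ = 1} = 1 - (residueCard F : ℝ)⁻¹ := by
  have hO : (haarO F).real (Metric.closedBall 0 1) = 1 := by
    have : haarO F (Metric.closedBall 0 1) = 1 := Measure.addHaarMeasure_self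
    rw [Measure.real, this, ENNReal.toReal_one]
  have h1 := measureReal_closedBall (haarO F) ϖF 1
  have hset : {x : F | ‖x‖ = 1} =
      Metric.closedBall 0 1 \ Metric.closedBall 0 (‖(ϖF.val : F)‖ ^ (1 : ℤ)) := by
    ext x
    simp only [Set.mem_ofPred_eq, Set.mem_sdiff, mem_closedBall_zero_iff, zpow_one, not_le]
    constructor
    · intro h; exact ⟨h.le, h ▸ ϖF.norm_lt_one⟩
    · rintro ⟨h, h'⟩
      refine le_antisymm h (not_lt.1 fun hlt => ?_)
      exact absurd (ϖF.le_norm x hlt) (not_le.2 h')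
  rw [hset, measureReal_sdiff (Metric.closedBall_subset_closedBall (by
    rw [zpow_one]; exact ϖF.norm_lt_one.le)) Metric.isClosed_closedBall.measurableSet
    (isCompact_closedBall _ _).measure_ne_top, h1, hO, zpow_neg_one, mul_one]

/-- The normalized absolute value of `E` restricts to the square of that of `F`: both describe how
multiplication by `x` scales the Haar measure of `E = F × F`. -/
theorem absVal_algebraMap (Q : QuadraticGenerator F E) (ϖF : Uniformizer F) (ϖE : Uniformizer E)
    (x : F) :
    absVal ϖE (algebraMap F E x) = absVal ϖF x ^ 2 := by
  rcases eq_or_ne x 0 with rfl | hx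
  · simp [absVal_zero]
  obtain ⟨x, rfl⟩ : ∃ u : Fˣ, (u : F) = x := ⟨Units.mk0 x hx, rfl⟩
  let y : Eˣ := Units.map (algebraMap F E : F →* E) x
  let O : Set F := Metric.closedBall 0 1
  have himg : ∀ S : Set F, Q.haarE (Q.coordL '' S ×ˢ S) = haarO F S * haarO F S := by
    intro S
    have h := (Q.coordL.toHomeomorph.toMeasurableEquiv).map_apply
      (μ := (haarO F).prod (haarO F)) (Q.coordL '' S ×ˢ S)
    change Q.haarE _ = _ at h
    rw [h, ← Measure.prod_prod]
    congr 1
    exact Set.preimage_image_eq _ Q.coordL.injective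
  have h0 : haarO F O ≠ 0 := (Metric.measure_closedBall_pos _ _ one_pos).ne'
  have h1 : haarO F O ≠ ⊤ := (isCompact_closedBall _ _).measure_ne_top
  have hsmul : y • (Q.coordL '' O ×ˢ O) = Q.coordL '' (x • O) ×ˢ (x • O) := by
    have hmul : ∀ p : F × F, y • Q.coordL p = Q.coordL (x • p.1, x • p.2) := fun p =>
      algebraMap_mul_coord Q (x : F) p
    ext z
    constructor
    · rintro ⟨_, ⟨p, hp, rfl⟩, rfl⟩
      exact ⟨_, ⟨Set.smul_mem_smul_set hp.1, Set.smul_mem_smul_set hp.2⟩, (hmul p).symm⟩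
    · rintro ⟨⟨_, _⟩, ⟨⟨p, hp, rfl⟩, ⟨r, hr, rfl⟩⟩, rfl⟩
      exact ⟨_, ⟨(p, r), ⟨hp, hr⟩, rfl⟩, hmul (p, r)⟩
  have key := distribHaarChar_eq_of_measure_smul_eq_mul (g := y) (μ := Q.haarE)
    (s := Q.coordL '' O ×ˢ O) (r := distribHaarChar F x ^ 2)
    (by rw [himg]; exact mul_ne_zero h0 h0) (by rw [himg]; exact ENNReal.mul_ne_top h1 h1) (by
      rw [hsmul, himg, himg, ← distribHaarChar_mul (haarO F) x O]
      push_cast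
      ring)
  have h2 := distribHaarChar_eq ϖE y
  rw [key, NNReal.coe_pow, distribHaarChar_eq ϖF] at h2
  exact h2.symm

theorem normExponent_eq (Q : QuadraticGenerator F E) (ϖF : Uniformizer F) (ϖE : Uniformizer E) :
    normExponent ϖE = 2 * normExponent ϖF := by
  have h := absVal_algebraMap Q ϖF ϖE (ϖF.val : F)
  rw [absVal_eq_norm_rpow, absVal_eq_norm_rpow, norm_algebraMap', ← Real.rpow_natCast,
    ← Real.rpow_mul (norm_nonneg _)] at h
  have := (Real.rpow_right_inj ϖF.norm_pos ϖF.norm_lt_one.ne).1 h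
  rw [this]; push_cast; ring

theorem absVal_normForm (ϖF : Uniformizer F) (ϖE : Uniformizer E) (x : E) :
    absVal ϖF (Q.normForm x) = absVal ϖE x := by
  rw [absVal_eq_norm_rpow, absVal_eq_norm_rpow, normExponent_eq Q ϖF ϖE, norm_normForm,
    ← Real.rpow_natCast, ← Real.rpow_mul (norm_nonneg _)]
  norm_num

theorem absVal_conj (ϖE : Uniformizer E) (x : E) : absVal ϖE (Q.conj x) = absVal ϖE x := by
  rw [absVal_eq_norm_rpow, absVal_eq_norm_rpow, norm_conj]

theorem absVal_a (ϖF : Uniformizer F) (ϖE : Uniformizer E) :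
    absVal ϖF Q.a = absVal ϖE Q.α := by
  rw [← absVal_normForm Q ϖF ϖE, generator_eq_coord Q, normForm_coord, absVal_eq_norm_rpow,
    absVal_eq_norm_rpow]
  simp

/-! ### Restriction of characters -/

theorem quasiChar_algebraMap (Q : QuadraticGenerator F E) (ϖF : Uniformizer F) (ϖE : Uniformizer E)
    (χ : UnitChar E)
    (hχ : resChar (twist ϖE χ 0) ϖF.val = 1) (s : ℂ) (x : F) :
    quasiChar ϖE χ s (algebraMap F E x) = quasiChar ϖF (resUnitChar χ) (2 * s) x := by
  rcases eq_or_ne x 0 with rfl | hx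
  · simp
  have hx' : algebraMap F E x ≠ 0 := by simpa using hx
  have habs := absVal_algebraMap Q ϖF ϖE x
  -- it suffices to treat `s = 0`
  suffices h0 : quasiChar ϖE χ 0 (algebraMap F E x) = quasiChar ϖF (resUnitChar χ) 0 x by
    rw [quasiChar_eq_mul_exp ϖE χ s hx', quasiChar_eq_mul_exp ϖF _ (2 * s) hx, h0, habs,
      Real.log_pow]
    congr 2
    push_cast; ring
  obtain ⟨x, rfl⟩ : ∃ u : Fˣ, (u : F) = x := ⟨Units.mk0 x hx, rfl⟩
  have hdec : x = ϖF.val ^ ord ϖF x * (unitPart ϖF x : Fˣ) := by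
    change x = ϖF.val ^ ord ϖF x * (ϖF.val ^ (-ord ϖF x) * x)
    rw [← mul_assoc, ← zpow_add]; simp
  have hunit : ∀ u : unitGroup F, quasiChar ϖE χ 0 (algebraMap F E ((u : Fˣ) : F)) =
      quasiChar ϖF (resUnitChar χ) 0 ((u : Fˣ) : F) := by
    intro u
    have hu : ‖((Units.map (algebraMap F E : F →* E) u : Eˣ) : E)‖ = 1 := by
      change ‖algebraMap F E ((u : Fˣ) : F)‖ = 1
      rw [norm_algebraMap']; exact u.2
    have h1 := quasiChar_of_norm_eq_one ϖE χ 0 hu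
    rw [quasiChar_of_norm_eq_one ϖF _ 0 u.2]
    exact h1
  have hϖ : quasiChar ϖE χ 0 (algebraMap F E (ϖF.val : F)) = 1 := by
    have h1 := congrArg (Units.val) hχ
    rw [Units.val_one] at h1
    rw [← h1, ← charFun_twist]
    exact charFun_units _ (Units.map (algebraMap F E : F →* E) ϖF.val)
  have hϖ' : quasiChar ϖF (resUnitChar χ) 0 (ϖF.val : F) = 1 := by
    rw [quasiChar_uniformizer]; simp
  rw [hdec]
  simp only [Units.val_mul, Units.val_zpow_eq_zpow_val, map_mul, map_zpow₀, hϖ, hϖ', one_zpow,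
    hunit]

theorem twist_mul (ϖF : Uniformizer F) (ξ ξ' : UnitChar F) (s s' : ℂ) :
    twist ϖF ξ s * twist ϖF ξ' s' = twist ϖF (ξ * ξ') (s + s') := by
  ext x
  rw [MonoidHom.mul_apply, Units.val_mul, ← charFun_units, ← charFun_units, ← charFun_units]
  exact quasiChar_mul_quasiChar ϖF ξ ξ' s s' _

theorem twist_inv (ϖF : Uniformizer F) (ξ : UnitChar F) (s : ℂ) :
    (twist ϖF ξ s)⁻¹ = twist ϖF ξ⁻¹ (-s) := by
  ext x
  rw [MonoidHom.inv_apply, Units.val_inv_eq_inv_val, ← charFun_units, ← charFun_units]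
  exact quasiChar_inv ϖF ξ s _

theorem resChar_twist (Q : QuadraticGenerator F E) (ϖF : Uniformizer F) (ϖE : Uniformizer E)
    (χ : UnitChar E)
    (hχ : resChar (twist ϖE χ 0) ϖF.val = 1) (s : ℂ) :
    resChar (twist ϖE χ s) = twist ϖF (resUnitChar χ) (2 * s) := by
  ext x
  rw [← charFun_units (twist ϖF (resUnitChar χ) (2 * s)) x, charFun_twist,
    ← quasiChar_algebraMap Q ϖF ϖE χ hχ s, ← charFun_twist]
  exact (charFun_units (twist ϖE χ s) (Units.map (algebraMap F E : F →* E) x)).symm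

theorem resUnitChar_sq (χ : UnitChar E) :
    resUnitChar (F := F) (χ ^ 2) = resUnitChar χ ^ 2 := by
  rw [sq, sq]; rfl

theorem resUnitChar_inv (χ : UnitChar E) :
    resUnitChar (F := F) χ⁻¹ = (resUnitChar χ)⁻¹ := rfl

/-- `ξ_s` is periodic in `s`. -/
theorem quasiChar_add_period (ϖF : Uniformizer F) (ξ : UnitChar F) (s : ℂ) (k : ℤ) (x : F) :
    quasiChar ϖF ξ (s + 2 * Real.pi * Complex.I / Real.log (residueCard F) * k) x =
      quasiChar ϖF ξ s x := by
  rcases eq_or_ne x 0 with rfl | hx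
  · simp
  rw [← Units.val_mk0 hx, quasiChar_units, quasiChar_units]
  congr 1
  have hl : (Real.log (residueCard F) : ℂ) ≠ 0 := by exact_mod_cast (log_residueCard_pos F).ne'
  rw [Complex.exp_eq_exp_iff_exists_int]
  refine ⟨-(k * ord ϖF (Units.mk0 x hx)), ?_⟩
  field_simp
  push_cast
  ring

end QuadraticExtension

/-! ### The renormalized kernel -/

section Kernel

variable {F E : Type*} [NontriviallyNormedField F] [NontriviallyNormedField E] [NormedAlgebra F E]
  [IsUltrametricDist F] [IsUltrametricDist E]
  (Q : QuadraticGenerator F E) (ϖF : Uniformizer F) (ϖE : Uniformizer E)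
  (χ : UnitChar E) (η : UnitChar F)

/-- The factor `χ_{s-1/2}(x²) (χ|η)_{2s+t-1/2}(x₁² - x₂² α²)⁻¹` of the kernel, which is locally
constant away from the origin. -/
def smoothPart (s t : ℂ) (x : E) : ℂ :=
  quasiChar ϖE (χ ^ 2) (2 * s - 1) x *
    quasiChar ϖF (resUnitChar χ * η)⁻¹ (-(2 * s + t - 1 / 2)) (Q.normForm x)

variable [ProperSpace F] [ProperSpace E]

/-- The image in `E^×` of an element of `F^×`. -/
def unitMap (E : Type*) [NontriviallyNormedField E] [NormedAlgebra F E] (b : Fˣ) : Eˣ :=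
  Units.map (algebraMap F E : F →* E) b

theorem invScale_unitMap (b : Fˣ) (x : E) :
    invScale (unitMap E b) x = algebraMap F E (b : F)⁻¹ * x := by
  rw [invScale_apply, map_inv₀]; rfl

/-- The homeomorphism `(x₁, x₂) ↦ (x₁, b⁻¹ x₂)`. -/
def scaleSnd (b : Fˣ) : F × F ≃ₜ F × F := (Homeomorph.refl F).prodCongr (invScale b)

theorem scaleSnd_apply (b : Fˣ) (p : F × F) : scaleSnd b p = (p.1, invScale b p.2) := rfl

variable [MeasurableSpace F] [BorelSpace F] [MeasurableSpace E] [BorelSpace E]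

theorem smoothPart_algebraMap_mul (hχ : resChar (twist ϖE χ 0) ϖF.val = 1) (s t : ℂ) (c : F)
    (x : E) : smoothPart Q ϖF ϖE χ η s t (algebraMap F E c * x) =
      quasiChar ϖF (η ^ 2)⁻¹ (-2 * t - 1) c * smoothPart Q ϖF ϖE χ η s t x := by
  have hχ2 : quasiChar ϖE (χ ^ 2) (2 * s - 1) (algebraMap F E c) =
      quasiChar ϖF (resUnitChar χ ^ 2) (2 * (2 * s - 1)) c := by
    have h := quasiChar_sq ϖE χ (s - 1 / 2) (algebraMap F E c)
    rw [quasiChar_algebraMap Q ϖF ϖE χ hχ, quasiChar_sq] at h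
    rw [show 2 * s - 1 = 2 * (s - 1 / 2) by ring, ← h]
  have hc : (resUnitChar χ ^ 2 * (resUnitChar χ * η)⁻¹ ^ 2 : UnitChar F) = (η ^ 2)⁻¹ := by
    rw [inv_pow, mul_pow, mul_inv, mul_inv_cancel_left]
  have h : quasiChar ϖF (resUnitChar χ ^ 2) (2 * (2 * s - 1)) c *
      quasiChar ϖF (resUnitChar χ * η)⁻¹ (-(2 * s + t - 1 / 2)) (c ^ 2) =
      quasiChar ϖF (η ^ 2)⁻¹ (-2 * t - 1) c := by
    rw [map_pow, quasiChar_sq, quasiChar_mul_quasiChar, hc]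
    congr 2
    ring
  rw [smoothPart, smoothPart, normForm_algebraMap_mul, map_mul, map_mul, hχ2, ← h]
  ring

theorem smoothPart_algebraMap (hχ : resChar (twist ϖE χ 0) ϖF.val = 1) (s t : ℂ) (c : F) :
    smoothPart Q ϖF ϖE χ η s t (algebraMap F E c) = quasiChar ϖF (η ^ 2)⁻¹ (-2 * t - 1) c := by
  have h := smoothPart_algebraMap_mul Q ϖF ϖE χ η hχ s t c 1
  have h1 : Q.normForm (1 : E) = 1 := by rw [← map_one (algebraMap F E), normForm_algebraMap]; simp
  rw [mul_one] at h
  rw [h, smoothPart, h1, map_one, map_one, mul_one, mul_one]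

/-- Splits the kernel into the factor that is singular along `x₂ = 0` and the rest. -/
theorem kernelFun_eq (hχ : resChar (twist ϖE χ 0) ϖF.val = 1) (s t : ℂ) (p : F × F) :
    kernelFun Q ϖF ϖE χ η s t (Q.coord p) =
      quasiChar ϖF (resUnitChar χ * η) (2 * s + t - 1 / 2) p.2 *
        smoothPart Q ϖF ϖE χ η s t (Q.coord p) := by
  have h1 : resChar (twist ϖE χ (s - 1 / 2)) * twist ϖF η (t + 1 / 2) =
      twist ϖF (resUnitChar χ * η) (2 * s + t - 1 / 2) := by
    rw [resChar_twist Q ϖF ϖE χ hχ, twist_mul]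
    congr 1
    ring
  have h2 : quasiChar ϖE χ (s - 1 / 2) (Q.coord p ^ 2) =
      quasiChar ϖE (χ ^ 2) (2 * s - 1) (Q.coord p) := by
    rw [map_pow, quasiChar_sq]
    congr 2
    ring
  simp only [kernelFun, h1, charFun_twist, h2, coord_symm_coord]
  rw [map_div₀, smoothPart, normForm_coord, ← quasiChar_inv]
  ring

theorem kernelFun_algebraMap_mul (hχ : resChar (twist ϖE χ 0) ϖF.val = 1) (s t : ℂ) (c : F)
    (x : E) : kernelFun Q ϖF ϖE χ η s t (algebraMap F E c * x) =
      quasiChar ϖF (resUnitChar χ * η⁻¹) (2 * s - t - 3 / 2) c *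
        kernelFun Q ϖF ϖE χ η s t x := by
  obtain ⟨p, rfl⟩ := Q.coord.surjective x
  have hc : (resUnitChar χ * η * (η ^ 2)⁻¹ : UnitChar F) = resUnitChar χ * η⁻¹ := by
    rw [mul_assoc, sq, mul_inv, mul_inv_cancel_left]
  have h : quasiChar ϖF (resUnitChar χ * η) (2 * s + t - 1 / 2) c *
      quasiChar ϖF (η ^ 2)⁻¹ (-2 * t - 1) c =
      quasiChar ϖF (resUnitChar χ * η⁻¹) (2 * s - t - 3 / 2) c := by
    rw [quasiChar_mul_quasiChar, hc]
    congr 2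
    ring
  rw [algebraMap_mul_coord, kernelFun_eq Q ϖF ϖE χ η hχ, ← algebraMap_mul_coord,
    smoothPart_algebraMap_mul Q ϖF ϖE χ η hχ, kernelFun_eq Q ϖF ϖE χ η hχ, ← h, map_mul]
  ring

/-- The test function `M φ₁` on `F × F`, where `M` is the smooth part of the kernel and
`φ₁ = φ - φ(b⁻¹ ·)` vanishes at the origin, `b` being the scaling element of `χ|η⁻¹`. -/
def smoothTest (s t : ℂ) (φ : E → ℂ) (p : F × F) : ℂ :=
  smoothPart Q ϖF ϖE χ η s t (Q.coord p) *
    subComp (invScale (unitMap E (scaleUnit ϖF (resUnitChar χ * η⁻¹)))) φ (Q.coord p)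

theorem subComp_coord_mem {φ : E → ℂ} (hφ : φ ∈ testFun E) (b : Fˣ) :
    (fun p => subComp (invScale (unitMap E b)) φ (Q.coord p)) ∈ testFun (F × F) ∧
      ∀ p ∈ ({0} : Set (F × F)), subComp (invScale (unitMap E b)) φ (Q.coord p) = 0 := by
  refine ⟨testFun_comp_homeomorph (subComp_mem _ hφ) Q.coordL.toHomeomorph, ?_⟩
  rintro p rfl
  exact subComp_eq_zero _ _ (by simp [invScale_apply])

theorem smoothTest_mem_holFam {φ : E → ℂ} (hφ : φ ∈ testFun E) :
    (fun (q : ℂ × ℂ) p => smoothTest Q ϖF ϖE χ η q.1 q.2 φ p) ∈ holFam (F × F) (ℂ × ℂ) {0} := by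
  obtain ⟨h0, h0'⟩ := subComp_coord_mem Q hφ (scaleUnit ϖF (resUnitChar χ * η⁻¹))
  have h1 := const_mem_holFam (P := ℂ × ℂ) h0 h0'
  have hcoord : ∀ p : F × F, Q.coord p = 0 → p ∈ ({0} : Set (F × F)) := fun p hp =>
    (coord_eq_zero_iff Q p).1 hp
  have h2 := quasiChar_mul_mem_holFam ϖF (resUnitChar χ * η)⁻¹
    (θ := fun p : F × F => Q.normForm (Q.coord p))
    ((continuous_normForm Q).comp (continuous_coord Q))
    (fun p hp => hcoord p (by by_contra h; exact normForm_ne_zero Q h hp))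
    (A := fun q : ℂ × ℂ => -(2 * q.1 + q.2 - 1 / 2)) (by fun_prop) h1
  have h3 := quasiChar_mul_mem_holFam ϖE (χ ^ 2) (continuous_coord Q) hcoord
    (A := fun q : ℂ × ℂ => 2 * q.1 - 1) (by fun_prop) h2
  convert h3 using 3
  rw [smoothTest, smoothPart, mul_assoc]

theorem smoothTest_mem (s t : ℂ) {φ : E → ℂ} (hφ : φ ∈ testFun E) :
    smoothTest Q ϖF ϖE χ η s t φ ∈ testFun (F × F) ∧ smoothTest Q ϖF ϖE χ η s t φ 0 = 0 := by
  have h := apply_mem_of_mem_holFam (smoothTest_mem_holFam Q ϖF ϖE χ η hφ) (s, t)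
  exact ⟨h.1, h.2 0 rfl⟩

/-- The regularized integrand of the renormalized kernel. -/
def regIntegrand (s t : ℂ) (φ : E → ℂ) (p : F × F) : ℂ :=
  quasiChar ϖF (resUnitChar χ * η) (2 * s + t - 1 / 2) p.2 *
    subComp (scaleSnd (scaleUnit ϖF (resUnitChar χ * η))) (smoothTest Q ϖF ϖE χ η s t φ) p

theorem regIntegrand_mem_holFam {φ : E → ℂ} (hφ : φ ∈ testFun E) :
    (fun (q : ℂ × ℂ) p => regIntegrand Q ϖF ϖE χ η q.1 q.2 φ p) ∈
      holFam (F × F) (ℂ × ℂ) {p | p.2 = 0} := by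
  have h1 := map_mem_holFam (Z' := {p : F × F | p.2 = 0})
    (subComp (scaleSnd (scaleUnit ϖF (resUnitChar χ * η)))) (fun f hf _ => ⟨subComp_mem _ hf, by
      rintro ⟨x, y⟩ (rfl : y = 0)
      exact subComp_eq_zero _ _ (by simp [scaleSnd_apply, invScale_apply])⟩)
    (smoothTest_mem_holFam Q ϖF ϖE χ η hφ)
  exact quasiChar_mul_mem_holFam ϖF (resUnitChar χ * η) (θ := fun p : F × F => p.2)
    continuous_snd (fun p hp => hp)
    (A := fun q : ℂ × ℂ => 2 * q.1 + q.2 - 1 / 2) (by fun_prop) h1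

theorem regIntegrand_mem (s t : ℂ) {φ : E → ℂ} (hφ : φ ∈ testFun E) :
    regIntegrand Q ϖF ϖE χ η s t φ ∈ testFun (F × F) :=
  (apply_mem_of_mem_holFam (regIntegrand_mem_holFam Q ϖF ϖE χ η hφ) (s, t)).1

/-- The renormalized kernel: the two scaling operators, one for the singularity at the origin and
one for the singularity along the line `x₂ = 0`, produce exactly the two local factors. -/
def kernelDist (s t : ℂ) : Distribution E where
  toFun φ := scaleConst ϖF (resUnitChar χ * η) * scaleConst ϖF (resUnitChar χ * η⁻¹) *
    ∫ p, regIntegrand Q ϖF ϖE χ η s t φ.1 p ∂(haarO F).prod (haarO F)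
  map_add' φ φ' := by
    rw [← mul_add, ← integral_add
      (testFun_integrable (regIntegrand_mem Q ϖF ϖE χ η s t φ.2))
      (testFun_integrable (regIntegrand_mem Q ϖF ϖE χ η s t φ'.2))]
    congr 1
    refine integral_congr_ae (Eventually.of_forall fun x => ?_)
    simp only [regIntegrand, subComp_apply, smoothTest, Submodule.coe_add, Pi.add_apply]
    ring
  map_smul' c φ := by
    rw [RingHom.id_apply, smul_eq_mul, mul_left_comm, ← integral_const_mul c]
    congr 1
    refine integral_congr_ae (Eventually.of_forall fun x => ?_)
    simp only [regIntegrand, subComp_apply, smoothTest, Submodule.coe_smul, Pi.smul_apply,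
      smul_eq_mul]
    ring

theorem kernelDist_apply (s t : ℂ) (φ : testFun E) : kernelDist Q ϖF ϖE χ η s t φ =
    scaleConst ϖF (resUnitChar χ * η) * scaleConst ϖF (resUnitChar χ * η⁻¹) *
      ∫ p, regIntegrand Q ϖF ϖE χ η s t φ.1 p ∂(haarO F).prod (haarO F) := rfl

theorem differentiable_kernelDist (φ : testFun E) :
    Differentiable ℂ fun q : ℂ × ℂ => kernelDist Q ϖF ϖE χ η q.1 q.2 φ :=
  (differentiable_integral_of_mem_holFam _
    (regIntegrand_mem_holFam Q ϖF ϖE χ η φ.2)).const_mul _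

end Kernel

/-! ### The domain of convergence -/

section Convergence

variable {F : Type*} [NontriviallyNormedField F] [IsUltrametricDist F] [ProperSpace F]
  [MeasurableSpace F] [BorelSpace F] (μ : Measure F) [μ.IsAddHaarMeasure]

theorem ae_prod_ne_zero : ∀ᵐ p : F × F ∂μ.prod μ, p.1 ≠ 0 ∧ p.2 ≠ 0 := by
  have h1 := (Measure.quasiMeasurePreserving_fst (μ := μ) (ν := μ)).ae (ae_ne_zero μ)
  have h2 := (Measure.quasiMeasurePreserving_snd (μ := μ) (ν := μ)).ae (ae_ne_zero μ)
  filter_upwards [h1, h2] with p hp1 hp2 using ⟨hp1, hp2⟩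

/-- A function on `F × F` with bounded support that is bounded by `C |x₁| ^ a |x₂| ^ b` with
`a, b > -1` is integrable. -/
theorem integrable_of_norm_le_rpow (ϖ : Uniformizer F) {f : F × F → ℂ}
    (hf : AEStronglyMeasurable f (μ.prod μ)) {R C a b : ℝ} (hC : 0 ≤ C) (ha : -1 < a) (hb : -1 < b)
    (hsupp : ∀ p, f p ≠ 0 → ‖p‖ ≤ R)
    (hbound : ∀ p : F × F, p.1 ≠ 0 → p.2 ≠ 0 → f p ≠ 0 →
      ‖f p‖ ≤ C * absVal ϖ p.1 ^ a * absVal ϖ p.2 ^ b) : Integrable f (μ.prod μ) := by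
  have hB : MeasurableSet (Metric.closedBall (0 : F) R) := Metric.isClosed_closedBall.measurableSet
  have h1 := ((integrable_indicator_iff hB).2
    (integrableOn_absVal_rpow_closedBall μ ϖ ha R)).mul_prod
    ((integrable_indicator_iff hB).2 (integrableOn_absVal_rpow_closedBall μ ϖ hb R))
  refine (h1.const_mul C).mono' hf ?_
  filter_upwards [ae_prod_ne_zero μ] with p hp
  by_cases h0 : f p = 0
  · rw [h0, norm_zero]
    refine mul_nonneg hC (mul_nonneg ?_ ?_) <;>
    exact Set.indicator_nonneg (fun x _ => Real.rpow_nonneg (absVal_nonneg ϖ x) _) _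
  · have hR := hsupp p h0
    have h2 := (norm_fst_le p).trans hR
    have h3 := (norm_snd_le p).trans hR
    rw [Set.indicator_of_mem (mem_closedBall_zero_iff.2 h2),
      Set.indicator_of_mem (mem_closedBall_zero_iff.2 h3), ← mul_assoc]
    exact hbound p hp.1 hp.2 h0

theorem integrable_quasiChar_snd_mul (ϖ : Uniformizer F) (ξ : UnitChar F) {s : ℂ}
    (hs : -1 < s.re) {g : F × F → ℂ} (hg : g ∈ testFun (F × F)) :
    Integrable (fun p => quasiChar ϖ ξ s p.2 * g p) (μ.prod μ) := by
  obtain ⟨C, hC0, hC⟩ := testFun_bound hg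
  obtain ⟨R, -, hR⟩ := testFun_support_subset_closedBall hg
  refine integrable_of_norm_le_rpow μ ϖ (R := R) (C := C) (a := 0) (b := s.re) ?_ hC0
    (by norm_num) hs (fun p hp => hR p (right_ne_zero_of_mul hp)) fun p _ hp2 _ => ?_
  · exact (((measurable_quasiChar ϖ ξ s).comp measurable_snd).mul
      (testFun_continuous hg).measurable).aestronglyMeasurable
  · rw [norm_mul, norm_quasiChar ϖ ξ s hp2, Real.rpow_zero, mul_one, mul_comm]
    exact mul_le_mul_of_nonneg_right (hC p) (Real.rpow_nonneg (absVal_nonneg ϖ _) _)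

theorem integral_quasiChar_snd_mul_subComp (ϖ : Uniformizer F) (ξ : UnitChar F) {s : ℂ}
    (hs : -1 < s.re) (b : Fˣ) {g : F × F → ℂ} (hg : g ∈ testFun (F × F)) :
    ∫ p, quasiChar ϖ ξ s p.2 * subComp (scaleSnd b) g p ∂μ.prod μ =
      (1 - quasiChar ϖ ξ (s + 1) b) * ∫ p, quasiChar ϖ ξ s p.2 * g p ∂μ.prod μ := by
  have h1 := integrable_quasiChar_snd_mul μ ϖ ξ hs hg
  have h2 := integrable_quasiChar_snd_mul μ ϖ ξ hs (testFun_comp_homeomorph hg (scaleSnd b))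
  simp only [subComp_apply, mul_sub]
  rw [integral_sub h1 h2, integral_prod _ h1, integral_prod _ h2, sub_mul, one_mul,
    ← integral_const_mul]
  congr 1
  refine integral_congr_ae (Eventually.of_forall fun x => ?_)
  exact integral_quasiChar_mul_comp μ ϖ ξ s b fun y => g (x, y)

variable {E : Type*} [NontriviallyNormedField E] [NormedAlgebra F E]
  [IsUltrametricDist E] [ProperSpace E] [MeasurableSpace E] [BorelSpace E]
  (Q : QuadraticGenerator F E) (ϖF : Uniformizer F) (ϖE : Uniformizer E)
  (χ : UnitChar E) (η : UnitChar F)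

theorem norm_smoothPart (s t : ℂ) {x : E} (hx : x ≠ 0) :
    ‖smoothPart Q ϖF ϖE χ η s t x‖ = absVal ϖE x ^ (-t.re - 1 / 2) := by
  rw [smoothPart, norm_mul, norm_quasiChar ϖE _ _ hx, norm_quasiChar ϖF _ _ (normForm_ne_zero Q hx),
    absVal_normForm Q ϖF ϖE, ← Real.rpow_add (absVal_pos ϖE hx)]
  congr 1
  simp
  ring

theorem measurable_smoothPart (s t : ℂ) : Measurable (smoothPart Q ϖF ϖE χ η s t) :=
  (measurable_quasiChar ϖE _ _).mul
    ((measurable_quasiChar ϖF _ _).comp (continuous_normForm Q).measurable)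

/-- The absolute value of `E` dominates the squares of the coordinates. -/
theorem exists_absVal_coord_ge : ∃ C : ℝ, 0 < C ∧ ∀ p : F × F,
    absVal ϖF p.1 ^ 2 ≤ C * absVal ϖE (Q.coord p) ∧
      absVal ϖF p.2 ^ 2 ≤ C * absVal ϖE (Q.coord p) := by
  obtain ⟨C, hC, -, h⟩ := exists_norm_coord_le Q
  have hκ := normExponent_pos ϖE
  have key : ∀ (x : F) (p : F × F), ‖x‖ ≤ ‖p‖ →
      absVal ϖF x ^ 2 ≤ C ^ normExponent ϖE * absVal ϖE (Q.coord p) := by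
    intro x p hx
    rw [← absVal_algebraMap Q ϖF ϖE, absVal_eq_norm_rpow, absVal_eq_norm_rpow, norm_algebraMap',
      ← Real.mul_rpow hC.le (norm_nonneg _)]
    exact Real.rpow_le_rpow (norm_nonneg _) (hx.trans (h p)) hκ.le
  exact ⟨C ^ normExponent ϖE, Real.rpow_pos_of_pos hC _, fun p =>
    ⟨key _ p (norm_fst_le p), key _ p (norm_snd_le p)⟩⟩

/-- If `a² ≤ C m` and `b² ≤ C m` then a negative power of `m` is bounded by a product of negative
powers of `a` and `b`. -/
theorem rpow_neg_le_of_sq_le {a b m C u v : ℝ} (ha : 0 < a) (hb : 0 < b) (hm : 0 < m) (hC : 0 < C)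
    (h1 : a ^ 2 ≤ C * m) (h2 : b ^ 2 ≤ C * m) (hu : 0 ≤ u) (hv : 0 ≤ v) :
    m ^ (-((u + v) / 2)) ≤ C ^ ((u + v) / 2) * a ^ (-u) * b ^ (-v) := by
  have key : ∀ {a u : ℝ}, 0 < a → a ^ 2 ≤ C * m → 0 ≤ u →
      m ^ (-(u / 2)) ≤ C ^ (u / 2) * a ^ (-u) := by
    intro a u ha h1 hu
    have h3 : a ^ u ≤ (C * m) ^ (u / 2) := by
      have := Real.rpow_le_rpow (sq_nonneg a) h1 (by positivity : 0 ≤ u / 2)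
      rwa [← Real.rpow_natCast, ← Real.rpow_mul ha.le,
        show ((2 : ℕ) : ℝ) * (u / 2) = u by push_cast; ring] at this
    rw [Real.mul_rpow hC.le hm.le] at h3
    rw [Real.rpow_neg hm.le, Real.rpow_neg ha.le, inv_le_iff_one_le_mul₀
      (Real.rpow_pos_of_pos hm _), ← div_eq_mul_inv, div_mul_eq_mul_div,
      one_le_div (Real.rpow_pos_of_pos ha _)]
    exact h3
  have h3 := mul_le_mul (key ha h1 hu) (key hb h2 hv) (Real.rpow_nonneg hm.le _)
    (mul_nonneg (Real.rpow_nonneg hC.le _) (Real.rpow_nonneg ha.le _))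
  rw [← Real.rpow_add hm] at h3
  calc m ^ (-((u + v) / 2)) = m ^ (-(u / 2) + -(v / 2)) := by congr 1; ring
    _ ≤ _ := h3
    _ = C ^ (u / 2) * C ^ (v / 2) * a ^ (-u) * b ^ (-v) := by ring
    _ = _ := by rw [← Real.rpow_add hC]; congr 3; ring

/-- Local integrability of the kernel in its domain of convergence. -/
theorem integrable_kernelFun_mul (hχ : resChar (twist ϖE χ 0) ϖF.val = 1) {s t : ℂ}
    (h1 : 0 < (2 * s + t + 1 / 2).re) (h2 : 0 < (2 * s - t + 1 / 2).re) {φ : E → ℂ}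
    (hφ : φ ∈ testFun E) : Integrable (fun x => kernelFun Q ϖF ϖE χ η s t x * φ x) Q.haarE := by
  rw [integrable_haarE_iff]
  simp only [kernelFun_eq Q ϖF ϖE χ η hχ]
  have hφ' : (fun p => φ (Q.coord p)) ∈ testFun (F × F) :=
    testFun_comp_homeomorph hφ Q.coordL.toHomeomorph
  obtain ⟨C, hC0, hC⟩ := testFun_bound hφ'
  obtain ⟨R, hR0, hR⟩ := testFun_support_subset_closedBall hφ'
  obtain ⟨C₁, hC₁, hcoord⟩ := exists_absVal_coord_ge Q ϖF ϖE
  obtain ⟨C₂, hC₂, hcoord₂, -⟩ := exists_norm_coord_le Q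
  have hmeas : AEStronglyMeasurable (fun p : F × F =>
      quasiChar ϖF (resUnitChar χ * η) (2 * s + t - 1 / 2) p.2 *
        smoothPart Q ϖF ϖE χ η s t (Q.coord p) * φ (Q.coord p)) ((haarO F).prod (haarO F)) :=
    ((((measurable_quasiChar ϖF _ _).comp measurable_snd).mul
      ((measurable_smoothPart Q ϖF ϖE χ η s t).comp (continuous_coord Q).measurable)).mul
      (testFun_continuous hφ').measurable).aestronglyMeasurable
  have hA : (2 * s + t - 1 / 2).re = 2 * s.re + t.re - 1 / 2 := by simp
  have h1' : 0 < 2 * s.re + t.re + 1 / 2 := by simpa using h1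
  have h2' : 0 < 2 * s.re - t.re + 1 / 2 := by simpa using h2
  -- the exponents `u`, `v` distribute the singularity at the origin over the two coordinates
  obtain ⟨u, v, C₃, hC₃, hu, hv, huv⟩ : ∃ u v C₃ : ℝ, 0 ≤ C₃ ∧ -1 < -u ∧
      -1 < 2 * s.re + t.re - 1 / 2 - v ∧ ∀ p : F × F, p.1 ≠ 0 → p.2 ≠ 0 → ‖p‖ ≤ R →
        absVal ϖE (Q.coord p) ^ (-t.re - 1 / 2) ≤
          C₃ * absVal ϖF p.1 ^ (-u) * absVal ϖF p.2 ^ (-v) := by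
    rcases le_or_gt (t.re + 1 / 2) 0 with ht | ht
    · refine ⟨0, 0, ((C₂ * R) ^ normExponent ϖE) ^ (-t.re - 1 / 2), by positivity, by norm_num,
        by linarith, fun p _ _ hp => ?_⟩
      rw [neg_zero, Real.rpow_zero, Real.rpow_zero, mul_one, mul_one]
      refine Real.rpow_le_rpow (absVal_nonneg _ _) ?_ (by linarith)
      rw [absVal_eq_norm_rpow]
      exact Real.rpow_le_rpow (norm_nonneg _) ((hcoord₂ p).trans
        (mul_le_mul_of_nonneg_left hp hC₂.le)) (normExponent_pos ϖE).le
    · set β := 2 * t.re + 1 with hβ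
      set A := 2 * s.re + t.re + 1 / 2 with hAdef
      have hA1 : 0 < A + 1 := by linarith
      have hsum : β / (A + 1) + β * A / (A + 1) = β := by field_simp; ring
      refine ⟨β / (A + 1), β * A / (A + 1), C₁ ^ (β / 2), by positivity, ?_, ?_,
        fun p hp1 hp2 _ => ?_⟩
      · rw [neg_lt_neg_iff, div_lt_one hA1]; linarith
      · have : β * A / (A + 1) < A := by
          rw [div_lt_iff₀ hA1]
          have : β < A + 1 := by linarith
          nlinarith
        linarith
      · have hx : Q.coord p ≠ 0 := by
          rw [Ne, coord_eq_zero_iff]; rintro rfl; exact hp1 rfl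
        have := rpow_neg_le_of_sq_le (absVal_pos ϖF hp1) (absVal_pos ϖF hp2) (absVal_pos ϖE hx)
          hC₁ (hcoord p).1 (hcoord p).2 (u := β / (A + 1)) (v := β * A / (A + 1))
          (div_nonneg (by linarith) hA1.le) (div_nonneg (mul_nonneg (by linarith) h1'.le) hA1.le)
        rw [hsum] at this
        rwa [show -t.re - 1 / 2 = -(β / 2) by rw [hβ]; ring]
  refine integrable_of_norm_le_rpow (haarO F) ϖF hmeas (R := R) (C := C₃ * C)
    (mul_nonneg hC₃ hC0) hu hv (fun p hp => hR p (right_ne_zero_of_mul hp)) fun p hp1 hp2 hp => ?_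
  have hx : Q.coord p ≠ 0 := by
    rw [Ne, coord_eq_zero_iff]; rintro rfl; exact hp1 rfl
  rw [norm_mul, norm_mul, norm_quasiChar ϖF _ _ hp2, norm_smoothPart Q ϖF ϖE χ η s t hx, hA]
  have h3 := huv p hp1 hp2 (hR p (right_ne_zero_of_mul hp))
  have h4 := absVal_pos ϖF hp2
  calc absVal ϖF p.2 ^ (2 * s.re + t.re - 1 / 2) * absVal ϖE (Q.coord p) ^ (-t.re - 1 / 2) *
        ‖φ (Q.coord p)‖
      ≤ absVal ϖF p.2 ^ (2 * s.re + t.re - 1 / 2) *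
        (C₃ * absVal ϖF p.1 ^ (-u) * absVal ϖF p.2 ^ (-v)) * C := by
        refine mul_le_mul (mul_le_mul_of_nonneg_left h3 (Real.rpow_nonneg h4.le _)) (hC p)
          (norm_nonneg _) ?_
        have := absVal_nonneg ϖF p.1
        positivity
    _ = C₃ * C * absVal ϖF p.1 ^ (-u) *
        (absVal ϖF p.2 ^ (2 * s.re + t.re - 1 / 2) * absVal ϖF p.2 ^ (-v)) := by ring
    _ = _ := by rw [← Real.rpow_add h4, ← sub_eq_add_neg]

/-- Scaling the argument of a test function by `b ∈ F^×` multiplies the value of the kernel by the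
degree of homogeneity of the kernel. -/
theorem integral_kernelFun_mul_comp (hχ : resChar (twist ϖE χ 0) ϖF.val = 1) (s t : ℂ) (b : Fˣ)
    (φ : E → ℂ) :
    ∫ x, kernelFun Q ϖF ϖE χ η s t x * φ (invScale (unitMap E b) x) ∂Q.haarE =
      quasiChar ϖF (resUnitChar χ * η⁻¹) (2 * s - t + 1 / 2) b *
        ∫ x, kernelFun Q ϖF ϖE χ η s t x * φ x ∂Q.haarE := by
  have hb : algebraMap F E b ≠ 0 := by simp
  have h := integral_mul_left Q.haarE ϖE hb fun x =>
    kernelFun Q ϖF ϖE χ η s t x * φ (invScale (unitMap E b) x)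
  have hb' : ((absVal ϖE (algebraMap F E b) : ℝ) : ℂ) ≠ 0 := by
    exact_mod_cast (absVal_pos ϖE hb).ne'
  have hinv : ∀ x : E, invScale (unitMap E b) (algebraMap F E b * x) = x := fun x => by
    rw [invScale_unitMap, ← mul_assoc, ← map_mul, inv_mul_cancel₀ b.ne_zero, map_one, one_mul]
  simp only [hinv, kernelFun_algebraMap_mul Q ϖF ϖE χ η hχ, mul_assoc] at h
  rw [integral_const_mul, eq_inv_mul_iff_mul_eq₀ hb'] at h
  rw [← h, ← mul_assoc, absVal_algebraMap Q ϖF ϖE]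
  congr 1
  push_cast
  rw [show 2 * s - t + 1 / 2 = (2 * s - t - 3 / 2) + 1 + 1 by ring, ← quasiChar_mul_absVal,
    ← quasiChar_mul_absVal]
  ring

/-- Away from the singularity at the origin the integral of the kernel is the integral of a
quasi-character of the second coordinate against a test function. -/
theorem integral_kernelFun_mul_subComp (hχ : resChar (twist ϖE χ 0) ϖF.val = 1) (s t : ℂ)
    (φ : E → ℂ) :
    ∫ x, kernelFun Q ϖF ϖE χ η s t x *
        subComp (invScale (unitMap E (scaleUnit ϖF (resUnitChar χ * η⁻¹)))) φ x ∂Q.haarE =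
      ∫ p, quasiChar ϖF (resUnitChar χ * η) (2 * s + t - 1 / 2) p.2 *
        smoothTest Q ϖF ϖE χ η s t φ p ∂(haarO F).prod (haarO F) := by
  rw [integral_haarE]
  refine integral_congr_ae (Eventually.of_forall fun p => ?_)
  simp only [kernelFun_eq Q ϖF ϖE χ η hχ, smoothTest]
  ring

/-- The value of the renormalized kernel when only the singularity along the line is integrable. -/
theorem kernelDist_eq_of_re_pos (hχ : resChar (twist ϖE χ 0) ϖF.val = 1) {s t : ℂ}
    (h1 : 0 < (2 * s + t + 1 / 2).re) (φ : testFun E) :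
    kernelDist Q ϖF ϖE χ η s t φ = eulerFactor ϖF (resUnitChar χ * η) (2 * s + t + 1 / 2) *
      (scaleConst ϖF (resUnitChar χ * η⁻¹) * ∫ x, kernelFun Q ϖF ϖE χ η s t x *
        subComp (invScale (unitMap E (scaleUnit ϖF (resUnitChar χ * η⁻¹)))) φ.1 x ∂Q.haarE) := by
  have hs : -1 < (2 * s + t - 1 / 2).re := by
    simp at h1 ⊢; linarith
  rw [kernelDist_apply, integral_kernelFun_mul_subComp Q ϖF ϖE χ η hχ]
  unfold regIntegrand
  rw [integral_quasiChar_snd_mul_subComp (haarO F) ϖF _ hs _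
    (smoothTest_mem Q ϖF ϖE χ η s t φ.2).1, ← scaleConst_mul,
    show 2 * s + t - 1 / 2 + 1 = 2 * s + t + 1 / 2 by ring]
  ring

theorem inv_localL_kernel (Q : QuadraticGenerator F E)
    (hχ : resChar (twist ϖE χ 0) ϖF.val = 1) (s t : ℂ) :
    (localL ϖF (1 / 2) (resChar (twist ϖE χ s) * twist ϖF η t))⁻¹ =
      eulerFactor ϖF (resUnitChar χ * η) (2 * s + t + 1 / 2) := by
  rw [resChar_twist Q ϖF ϖE χ hχ, twist_mul, inv_localL]

theorem inv_localL_kernel' (Q : QuadraticGenerator F E)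
    (hχ : resChar (twist ϖE χ 0) ϖF.val = 1) (s t : ℂ) :
    (localL ϖF (1 / 2) (resChar (twist ϖE χ s) * (twist ϖF η t)⁻¹))⁻¹ =
      eulerFactor ϖF (resUnitChar χ * η⁻¹) (2 * s - t + 1 / 2) := by
  rw [resChar_twist Q ϖF ϖE χ hχ, twist_inv, twist_mul, inv_localL, ← sub_eq_add_neg]

theorem isRenormalizedKernel_kernelDist (hχ : resChar (twist ϖE χ 0) ϖF.val = 1) :
    IsRenormalizedKernel Q ϖF ϖE χ η (kernelDist Q ϖF ϖE χ η) := by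
  refine ⟨differentiable_kernelDist Q ϖF ϖE χ η, fun s t h1 h2 φ => ?_⟩
  have hint := integrable_kernelFun_mul Q ϖF ϖE χ η hχ h1 h2 φ.2
  have hint' := integrable_kernelFun_mul Q ϖF ϖE χ η hχ h1 h2 (testFun_comp_homeomorph φ.2
    (invScale (unitMap E (scaleUnit ϖF (resUnitChar χ * η⁻¹)))))
  rw [kernelDist_eq_of_re_pos Q ϖF ϖE χ η hχ h1, inv_localL_kernel ϖF ϖE χ η Q hχ,
    inv_localL_kernel' ϖF ϖE χ η Q hχ]
  simp only [subComp_apply, mul_sub]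
  rw [integral_sub hint hint', integral_kernelFun_mul_comp Q ϖF ϖE χ η hχ, ← scaleConst_mul ϖF
    (resUnitChar χ * η⁻¹)]
  ring

/-- The holomorphic family of renormalized kernels is unique: restrict it to a complex line
through the given parameter along which it reaches the domain of convergence. -/
theorem IsRenormalizedKernel.unique {T T' : ℂ → ℂ → Distribution E}
    (h : IsRenormalizedKernel Q ϖF ϖE χ η T) (h' : IsRenormalizedKernel Q ϖF ϖE χ η T') :
    T = T' := by
  ext s t φ
  have hline : Differentiable ℂ fun z : ℂ => (z, t) := by fun_prop
  have hd : Differentiable ℂ fun z => T z t φ := (h.1 φ).comp hline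
  have hd' : Differentiable ℂ fun z => T' z t φ := (h'.1 φ).comp hline
  refine congrFun (eq_of_eqOn_halfPlane hd hd' (a := |t.re|) fun z hz => ?_) s
  have h1 := neg_abs_le t.re
  have h2 := le_abs_self t.re
  have h3 : 0 < (2 * z + t + 1 / 2).re := by simp; linarith [abs_nonneg t.re]
  have h4 : 0 < (2 * z - t + 1 / 2).re := by simp; linarith [abs_nonneg t.re]
  rw [h.2 z t h3 h4 φ, h'.2 z t h3 h4 φ]

theorem renormalizedKernel_eq (hχ : resChar (twist ϖE χ 0) ϖF.val = 1) :
    renormalizedKernel Q ϖF ϖE χ η = kernelDist Q ϖF ϖE χ η := by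
  have h := isRenormalizedKernel_kernelDist Q ϖF ϖE χ η hχ
  have h' : IsRenormalizedKernel Q ϖF ϖE χ η (renormalizedKernel Q ϖF ϖE χ η) :=
    Classical.epsilon_spec ⟨_, h⟩
  exact h'.unique Q ϖF ϖE χ η h

end Convergence

/-! ### The residue along the line -/

section Backslash

variable {F : Type*} [NontriviallyNormedField F] [IsUltrametricDist F] [ProperSpace F]
  [MeasurableSpace F] [BorelSpace F]
  {E : Type*} [NontriviallyNormedField E] [NormedAlgebra F E]
  [IsUltrametricDist E] [ProperSpace E] [MeasurableSpace E] [BorelSpace E]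
  (Q : QuadraticGenerator F E) (ϖF : Uniformizer F) (ϖE : Uniformizer E)
  (χ : UnitChar E) (η : UnitChar F)

theorem slice_mem_testFun {g : F × F → ℂ} (hg : g ∈ testFun (F × F)) (x : F) :
    (fun y => g (x, y)) ∈ testFun F := by
  obtain ⟨R, -, hR⟩ := testFun_support_subset_closedBall hg
  refine ⟨hg.1.comp_continuous (by fun_prop), HasCompactSupport.of_support_subset_isCompact
    (isCompact_closedBall 0 R) fun y hy => ?_⟩
  rw [mem_closedBall_zero_iff]
  exact (norm_snd_le (x, y)).trans (hR _ hy)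

theorem kernelDist_eq_lineDistribution (hχ : resChar (twist ϖE χ 0) ϖF.val = 1) {s t : ℂ}
    (h : InBackslash χ s η t) : kernelDist Q ϖF ϖE χ η s t =
      (1 - (residueCard F : ℂ)⁻¹) • lineDistribution (E := E) ϖF η t := by
  obtain ⟨hρ, k, hk⟩ := h
  have hχη : (resUnitChar χ * η⁻¹ : UnitChar F) = (η ^ 2)⁻¹ := by
    rw [eq_inv_of_mul_eq_one_left hρ, ← mul_inv, sq]
  ext φ
  have hg := (smoothTest_mem Q ϖF ϖE χ η s t φ.2).1
  have hA : ∀ y : F, quasiChar ϖF (1 : UnitChar F) (2 * s + t - 1 / 2) y =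
      quasiChar ϖF 1 (-1) y := by
    intro y
    rw [← quasiChar_add_period ϖF 1 (-1) k, ← hk]
    congr 2
    ring
  have hval : ∀ x : F, ∫ y, regIntegrand Q ϖF ϖE χ η s t φ.1 (x, y) ∂haarO F =
      (1 - (residueCard F : ℂ)⁻¹) * (quasiChar ϖF (η ^ 2)⁻¹ (-2 * t - 1) x *
        subComp (invScale (scaleUnit ϖF (η ^ 2)⁻¹)) (restrictTest (F := F) φ).1 x) := by
    intro x
    have h1 := integral_absVal_inv_mul_subComp (haarO F) ϖF (slice_mem_testFun hg x)
    rw [measureReal_unitSphere_haarO ϖF] at h1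
    simp only [regIntegrand, hρ, hA, scaleUnit_one]
    refine h1.trans ?_
    rw [smoothTest, coord_algebraMap, smoothPart_algebraMap Q ϖF ϖE χ η hχ, subComp_apply,
      invScale_unitMap, ← map_mul, hχη]
    rw [Complex.ofReal_sub, Complex.ofReal_one, Complex.ofReal_inv, Complex.ofReal_natCast]
    rfl
  rw [kernelDist_apply, integral_prod _ (testFun_integrable (regIntegrand_mem Q ϖF ϖE χ η s t φ.2)),
    hρ, scaleConst_one, one_mul, hχη]
  simp only [hval]
  rw [integral_const_mul, LinearMap.smul_apply, smul_eq_mul, lineDistribution,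
    LinearMap.comp_apply, homogeneousFamily_eq, homDist_apply]
  ring

end Backslash

/-! ### The residue at the origin -/

section Slash

variable {F : Type*} [NontriviallyNormedField F] [IsUltrametricDist F] [ProperSpace F]
  [MeasurableSpace F] [BorelSpace F]
  {E : Type*} [NontriviallyNormedField E] [NormedAlgebra F E]
  [IsUltrametricDist E] [ProperSpace E] [MeasurableSpace E] [BorelSpace E]
  (Q : QuadraticGenerator F E) (ϖF : Uniformizer F) (ϖE : Uniformizer E)
  (χ : UnitChar E) (η : UnitChar F)

/-- The integral of `(χ⁻²)_{-t-1/2}` over the affine line `F + α` in `E`. -/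
def lineIntegral (t : ℂ) : ℂ :=
  ∫ u, quasiChar ϖE (χ ^ 2)⁻¹ (-t - 1 / 2) (Q.coord (u, 1)) ∂haarO F

theorem resChar_twist_sq_inv (hχ : resChar (twist ϖE χ 0) ϖF.val = 1) :
    resChar (twist ϖE (χ ^ 2)⁻¹ 0) ϖF.val = 1 := by
  have key : ∀ ξ : UnitChar E, (resChar (twist ϖE ξ 0) ϖF.val : ℂ) =
      quasiChar ϖE ξ 0 (algebraMap F E (ϖF.val : F)) := fun ξ =>
    (charFun_units (twist ϖE ξ 0) (unitMap E ϖF.val)).symm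
  have h1 := key χ
  rw [hχ, Units.val_one] at h1
  ext
  rw [key, ← neg_zero, ← quasiChar_inv, ← mul_zero (2 : ℂ), ← quasiChar_sq, ← h1]
  simp

/-- On the hyperplane `//` the kernel factors through the character `(χ⁻²)_{-t-1/2}` of the
conjugate variable. -/
theorem kernelFun_eq_of_inSlash (hχ : resChar (twist ϖE χ 0) ϖF.val = 1) {s t : ℂ}
    (h : InSlash χ s η t) (p : F × F) : kernelFun Q ϖF ϖE χ η s t (Q.coord p) =
      quasiChar ϖF (resUnitChar χ ^ 2) (2 * t - 1) p.2 *
        quasiChar ϖE (χ ^ 2)⁻¹ (-t - 1 / 2) (Q.conj (Q.coord p)) := by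
  obtain ⟨hη, k, hk⟩ := h
  have hη' : η = resUnitChar χ := (eq_of_mul_inv_eq_one hη).symm
  rcases eq_or_ne p 0 with rfl | hp
  · rw [kernelFun_eq Q ϖF ϖE χ η hχ]; simp
  have hx0 : Q.coord p ≠ 0 := fun h => hp ((coord_eq_zero_iff Q p).1 h)
  rw [kernelFun_eq Q ϖF ϖE χ η hχ, smoothPart]
  set x := Q.coord p with hx
  have hρ : (resUnitChar χ * η : UnitChar F) = resUnitChar χ ^ 2 := by rw [hη', sq]
  have hρ' : (resUnitChar χ ^ 2 : UnitChar F)⁻¹ = resUnitChar (χ ^ 2)⁻¹ := by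
    rw [resUnitChar_inv, resUnitChar_sq]
  have hA : quasiChar ϖF (resUnitChar χ ^ 2) (2 * s + t - 1 / 2) p.2 =
      quasiChar ϖF (resUnitChar χ ^ 2) (2 * t - 1) p.2 := by
    rw [← quasiChar_add_period ϖF _ (2 * t - 1) k, ← hk]
    congr 2
    ring
  have hN : quasiChar ϖF (resUnitChar χ ^ 2)⁻¹ (-(2 * s + t - 1 / 2)) (Q.normForm x) =
      quasiChar ϖE (χ ^ 2)⁻¹ (-t + 1 / 2) x * quasiChar ϖE (χ ^ 2)⁻¹ (-t + 1 / 2) (Q.conj x) := by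
    rw [← map_mul, ← algebraMap_normForm,
      quasiChar_algebraMap Q ϖF ϖE _ (resChar_twist_sq_inv ϖF ϖE χ hχ), ← hρ',
      ← quasiChar_add_period ϖF _ (2 * (-t + 1 / 2)) (-k)]
    congr 2
    rw [Int.cast_neg]
    linear_combination -hk
  have hE : quasiChar ϖE (χ ^ 2) (2 * s - 1) x = quasiChar ϖE (χ ^ 2) (t - 3 / 2) x := by
    have h1 : Complex.exp ((2 * s - t + 1 / 2) * Real.log (absVal ϖE x)) = 1 := by
      have h2 := quasiChar_add_period ϖF 1 0 k (Q.normForm x)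
      rw [zero_add, ← hk, quasiChar_eq_mul_exp ϖF 1 _ (normForm_ne_zero Q hx0),
        absVal_normForm Q ϖF ϖE] at h2
      have h3 : quasiChar ϖF (1 : UnitChar F) 0 (Q.normForm x) ≠ 0 :=
        (map_ne_zero _).2 (normForm_ne_zero Q hx0)
      exact mul_left_cancel₀ h3 (by rw [h2, mul_one])
    rw [quasiChar_eq_mul_exp ϖE _ (2 * s - 1) hx0, quasiChar_eq_mul_exp ϖE _ (t - 3 / 2) hx0,
      show 2 * s - 1 = (2 * s - t + 1 / 2) + (t - 3 / 2) by ring, add_mul, Complex.exp_add, h1,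
      one_mul]
  have habs : quasiChar ϖE (1 : UnitChar E) (-1) x = quasiChar ϖE 1 (-1) (Q.conj x) := by
    have h1 := quasiChar_inv ϖE 1 1 x
    have h2 := quasiChar_inv ϖE 1 1 (Q.conj x)
    rw [quasiChar_one_one, inv_one] at h1 h2
    rw [← h1, ← h2, absVal_conj]
  have h1 : quasiChar ϖE (χ ^ 2) (t - 3 / 2) x * quasiChar ϖE (χ ^ 2)⁻¹ (-t + 1 / 2) x =
      quasiChar ϖE 1 (-1) x := by
    rw [quasiChar_mul_quasiChar, mul_inv_cancel]
    congr 2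
    ring
  have h2 : quasiChar ϖE 1 (-1) (Q.conj x) * quasiChar ϖE (χ ^ 2)⁻¹ (-t + 1 / 2) (Q.conj x) =
      quasiChar ϖE (χ ^ 2)⁻¹ (-t - 1 / 2) (Q.conj x) := by
    rw [quasiChar_mul_quasiChar, one_mul]
    congr 2
    ring
  rw [hρ, hA, hE, hN, ← mul_assoc (quasiChar ϖE (χ ^ 2) (t - 3 / 2) x), h1, habs, h2]

theorem absVal_mul_inv_cancel {y : F} (hy : y ≠ 0) : absVal ϖF y * (absVal ϖF y)⁻¹ = 1 :=
  mul_inv_cancel₀ (absVal_pos ϖF hy).ne'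

theorem integrable_shear {f : F × F → ℂ} (hm : Measurable f)
    (hf : Integrable f ((haarO F).prod (haarO F))) :
    Integrable (fun p : F × F => (absVal ϖF p.1 : ℂ) * f (p.1 * p.2, p.1))
      ((haarO F).prod (haarO F)) := by
  have hne := ae_ne_zero (haarO F)
  have hmeas : Measurable (fun p : F × F => (absVal ϖF p.1 : ℂ) * f (p.1 * p.2, p.1)) :=
    (Complex.measurable_ofReal.comp ((measurable_absVal ϖF).comp measurable_fst)).mul
      (hm.comp ((measurable_fst.mul measurable_snd).prodMk measurable_fst))
  rw [integrable_prod_iff hmeas.aestronglyMeasurable]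
  constructor
  · filter_upwards [hf.prod_left_ae, hne] with y hy hy0
    have h3 := integrable_mul_left (haarO F) ϖF hy0 (f := fun x => f (x, y)) hy
    exact h3.const_mul (absVal ϖF y : ℂ)
  · refine hf.integral_norm_prod_right.congr ?_
    filter_upwards [hne] with y hy0
    have h4 := integral_comp_mul_left (haarO F) ϖF hy0 fun x => ‖f (x, y)‖
    simp only [norm_mul, Complex.norm_real, Real.norm_of_nonneg (absVal_nonneg ϖF y)]
    rw [integral_const_mul, h4, smul_eq_mul, ← mul_assoc, absVal_mul_inv_cancel ϖF hy0, one_mul]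

/-- The substitution `(x₁, x₂) = (y u, y)`. -/
theorem integral_prod_eq_shear {f : F × F → ℂ} (hm : Measurable f)
    (hf : Integrable f ((haarO F).prod (haarO F))) :
    ∫ p, f p ∂(haarO F).prod (haarO F) =
      ∫ u, ∫ y, (absVal ϖF y : ℂ) * f (y * u, y) ∂haarO F ∂haarO F := by
  have h := integrable_shear ϖF hm hf
  rw [integral_prod_symm _ hf,
    ← integral_integral_swap (f := fun y u => (absVal ϖF y : ℂ) * f (y * u, y)) h]
  refine integral_congr_ae ?_
  filter_upwards [ae_ne_zero (haarO F)] with y hy0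
  have h4 := integral_comp_mul_left (haarO F) ϖF hy0 fun x => f (x, y)
  rw [integral_const_mul, h4, Complex.real_smul, ← mul_assoc, ← Complex.ofReal_mul,
    absVal_mul_inv_cancel ϖF hy0, Complex.ofReal_one, one_mul]

theorem quasiChar_sq_inv_neg_one (s : ℂ) : quasiChar ϖE (χ ^ 2)⁻¹ s (-1) = 1 := by
  have h := quasiChar_sq ϖE χ⁻¹ (s / 2) (-1)
  rw [← map_pow, neg_one_sq, map_one, inv_pow, mul_div_cancel₀ _ two_ne_zero] at h
  exact h.symm

theorem lineIntegral_eq_conj (t : ℂ) : ∫ u, quasiChar ϖE (χ ^ 2)⁻¹ (-t - 1 / 2)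
    (Q.conj (Q.coord (u, 1))) ∂haarO F = lineIntegral Q ϖE χ t := by
  rw [lineIntegral, ← integral_neg_eq_self]
  refine integral_congr_ae (Eventually.of_forall fun u => ?_)
  simp only
  have h : Q.conj (Q.coord (-u, 1)) = -1 * Q.coord (u, 1) := by
    rw [conj_coord, neg_one_mul, ← map_neg]
    rfl
  rw [h, map_mul, quasiChar_sq_inv_neg_one, one_mul]

/-- On `//` and for `Re t > 0` the renormalized kernel is a multiple of the Dirac distribution:
the integral of the kernel over each line through the origin is of the form `∫ |y|⁻¹ φ₁(y) dy`. -/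
theorem kernelDist_eq_of_inSlash_of_re_pos (hχ : resChar (twist ϖE χ 0) ϖF.val = 1) {s t : ℂ}
    (h : InSlash χ s η t) (ht : 0 < t.re) (φ : testFun E) : kernelDist Q ϖF ϖE χ η s t φ =
      eulerFactor ϖF (resUnitChar χ * η) (2 * s + t + 1 / 2) *
        ((1 - (residueCard F : ℂ)⁻¹) * lineIntegral Q ϖE χ t) * φ.1 0 := by
  obtain ⟨k, hk⟩ := h.2
  have hre : (2 * s - t + 1 / 2).re = 0 := by
    rw [hk]
    have : 2 * Real.pi * Complex.I / Real.log (residueCard F) * (k : ℂ) =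
        ((2 * Real.pi / Real.log (residueCard F) * k : ℝ) : ℂ) * Complex.I := by
      push_cast; ring
    rw [this, Complex.re_ofReal_mul, Complex.I_re, mul_zero]
  have h1 : 0 < (2 * s + t + 1 / 2).re := by
    simp at hre ⊢; linarith
  have hs : -1 < (2 * s + t - 1 / 2).re := by
    simp at h1 ⊢; linarith
  have hA : (resUnitChar χ * η⁻¹ : UnitChar F) = 1 := h.1
  have hg := (smoothTest_mem Q ϖF ϖE χ η s t φ.2).1
  rw [kernelDist_eq_of_re_pos Q ϖF ϖE χ η hχ h1, integral_kernelFun_mul_subComp Q ϖF ϖE χ η hχ,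
    integral_prod_eq_shear ϖF _ (integrable_quasiChar_snd_mul (haarO F) ϖF _ hs hg)]
  · have hval : ∀ u y : F, (absVal ϖF y : ℂ) *
        (quasiChar ϖF (resUnitChar χ * η) (2 * s + t - 1 / 2) (y * u, y).2 *
          smoothTest Q ϖF ϖE χ η s t φ.1 (y * u, y)) =
        quasiChar ϖE (χ ^ 2)⁻¹ (-t - 1 / 2) (Q.conj (Q.coord (u, 1))) *
          (quasiChar ϖF 1 (-1) y * subComp (invScale ϖF.val)
            (fun y => φ.1 (algebraMap F E y * Q.coord (u, 1))) y) := by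
      intro u y
      have hcoord : Q.coord (y * u, y) = algebraMap F E y * Q.coord (u, 1) := by
        rw [algebraMap_mul_coord, mul_one]
      have hconj : Q.conj (Q.coord (y * u, y)) = algebraMap F E y * Q.conj (Q.coord (u, 1)) := by
        rw [conj_coord, conj_coord, algebraMap_mul_coord, mul_neg, mul_one]
      have hk1 := kernelFun_eq_of_inSlash Q ϖF ϖE χ η hχ h (y * u, y)
      rw [kernelFun_eq Q ϖF ϖE χ η hχ, hconj, map_mul,
        quasiChar_algebraMap Q ϖF ϖE _ (resChar_twist_sq_inv ϖF ϖE χ hχ)] at hk1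
      have hy : (absVal ϖF y : ℂ) * (quasiChar ϖF (resUnitChar χ ^ 2) (2 * t - 1) y *
          quasiChar ϖF (resUnitChar (χ ^ 2)⁻¹) (2 * (-t - 1 / 2)) y) = quasiChar ϖF 1 (-1) y := by
        rw [resUnitChar_inv, resUnitChar_sq, quasiChar_mul_quasiChar, mul_inv_cancel, mul_comm,
          quasiChar_mul_absVal]
        congr 2
        ring
      have hsub : subComp (invScale (unitMap E (scaleUnit ϖF (resUnitChar χ * η⁻¹)))) φ.1
          (Q.coord (y * u, y)) = subComp (invScale ϖF.val)
            (fun y => φ.1 (algebraMap F E y * Q.coord (u, 1))) y := by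
        rw [hA, scaleUnit_one, subComp_apply, subComp_apply, invScale_unitMap, hcoord,
          invScale_apply, map_mul, mul_assoc]
      rw [smoothTest, ← mul_assoc (quasiChar ϖF (resUnitChar χ * η) _ _), hk1, hsub, ← hy]
      ring
    have hinner : ∀ u : F, ∫ y, quasiChar ϖF 1 (-1) y * subComp (invScale ϖF.val)
        (fun y => φ.1 (algebraMap F E y * Q.coord (u, 1))) y ∂haarO F =
        (1 - (residueCard F : ℂ)⁻¹) * φ.1 0 := by
      intro u
      have hu : Q.coord (u, 1) ≠ 0 := by
        rw [Ne, coord_eq_zero_iff]; intro h; exact one_ne_zero (congrArg Prod.snd h)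
      have htest : (fun y : F => φ.1 (algebraMap F E y * Q.coord (u, 1))) ∈ testFun F := by
        have h2 : (fun x : E => φ.1 (x * Q.coord (u, 1))) ∈ testFun E :=
          testFun_comp_homeomorph φ.2 (Homeomorph.mulRight₀ _ hu)
        exact (restrictTest (F := F) ⟨_, h2⟩).2
      have h2 := integral_absVal_inv_mul_subComp (haarO F) ϖF htest
      rw [measureReal_unitSphere_haarO ϖF, map_zero, zero_mul, Complex.ofReal_sub,
        Complex.ofReal_one, Complex.ofReal_inv, Complex.ofReal_natCast] at h2
      exact h2
    simp only [hval, integral_const_mul, hinner]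
    rw [integral_mul_const, lineIntegral_eq_conj, hA, scaleConst_one]
    ring
  · exact ((measurable_quasiChar ϖF _ _).comp measurable_snd).mul
      (testFun_continuous hg).measurable

theorem inSlash_shift {s t : ℂ} (h : InSlash χ s η t) (z : ℂ) :
    InSlash χ (s + (z - t) / 2) η z := by
  obtain ⟨hη, k, hk⟩ := h
  exact ⟨hη, k, by rw [← hk]; ring⟩

/-- A test function on `E` with value `1` at the origin. -/
def unitBump (E : Type*) [NontriviallyNormedField E] [IsUltrametricDist E] [ProperSpace E] :
    testFun E := ⟨_, one_indicator_mem_testFun (K := E) one_pos⟩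

theorem unitBump_zero (E : Type*) [NontriviallyNormedField E] [IsUltrametricDist E]
    [ProperSpace E] : (unitBump E).1 0 = 1 := by simp [unitBump]

theorem differentiable_comp_line {G : ℂ → ℂ → ℂ} (hG : Differentiable ℂ fun p : ℂ × ℂ => G p.1 p.2)
    (s t : ℂ) : Differentiable ℂ fun z => G (s + (z - t) / 2) z := by
  have hline : Differentiable ℂ fun z : ℂ => (s + (z - t) / 2, z) := by fun_prop
  exact hG.comp hline

theorem differentiable_kernelDist_line (s t : ℂ) (φ : testFun E) :
    Differentiable ℂ fun z => kernelDist Q ϖF ϖE χ η (s + (z - t) / 2) z φ :=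
  differentiable_comp_line (G := fun s t => kernelDist Q ϖF ϖE χ η s t φ)
    (differentiable_kernelDist Q ϖF ϖE χ η φ) s t

theorem kernelDist_eq_smul_dirac (hχ : resChar (twist ϖE χ 0) ϖF.val = 1) {s t : ℂ}
    (h : InSlash χ s η t) : kernelDist Q ϖF ϖE χ η s t =
      kernelDist Q ϖF ϖE χ η s t (unitBump E) • dirac (0 : E) := by
  ext φ
  have key := eq_of_eqOn_halfPlane (a := 0) (differentiable_kernelDist_line Q ϖF ϖE χ η s t φ)
    ((differentiable_kernelDist_line Q ϖF ϖE χ η s t (unitBump E)).mul_const (φ.1 0))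
    fun z hz => by
      rw [kernelDist_eq_of_inSlash_of_re_pos Q ϖF ϖE χ η hχ (inSlash_shift χ η h z) hz,
        kernelDist_eq_of_inSlash_of_re_pos Q ϖF ϖE χ η hχ (inSlash_shift χ η h z) hz,
        unitBump_zero, mul_one]
  have h1 := congrFun key t
  simp only [sub_self, zero_div, add_zero] at h1
  exact h1

end Slash

/-! ### A local functional equation -/

section Sphere

variable {K : Type*} [NontriviallyNormedField K] [IsUltrametricDist K] [ProperSpace K]

/-- The indicator function of the unit sphere. -/
def sphereInd (K : Type*) [NontriviallyNormedField K] : K → ℂ :=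
  (Metric.sphere (0 : K) 1).indicator fun _ => 1

theorem sphereInd_of_norm {x : K} (hx : ‖x‖ = 1) : sphereInd K x = 1 :=
  Set.indicator_of_mem (mem_sphere_zero_iff_norm.2 hx) _

theorem sphereInd_of_norm_ne {x : K} (hx : ‖x‖ ≠ 1) : sphereInd K x = 0 :=
  Set.indicator_of_notMem (fun h => hx (mem_sphere_zero_iff_norm.1 h)) _

theorem sphereInd_mem_testFun : sphereInd K ∈ testFun K :=
  indicator_mem_testFun (IsUltrametricDist.isClopen_sphere _ one_ne_zero) (isCompact_sphere _ _)
    (IsLocallyConstant.const _)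

/-- The character `ξ` of the unit sphere, extended by zero to a test function. -/
def sphereChar (ϖ : Uniformizer K) (ξ : UnitChar K) (x : K) : ℂ := quasiChar ϖ ξ 0 x * sphereInd K x

theorem sphereChar_mem_testFun (ϖ : Uniformizer K) (ξ : UnitChar K) :
    sphereChar ϖ ξ ∈ testFun K := by
  refine quasiChar_mul_mem_testFun ϖ ξ 0 continuous_id sphereInd_mem_testFun ?_
  rintro x rfl
  exact sphereInd_of_norm_ne (by simp)

variable [MeasurableSpace K] [BorelSpace K] (μ : Measure K) [μ.IsAddHaarMeasure]

theorem integral_sphereInd_mul (c : ℂ) :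
    ∫ x, sphereInd K x * c ∂μ = (μ.real {x : K | ‖x‖ = 1} : ℂ) * c := by
  rw [integral_mul_const, sphereInd, integral_indicator_const _
    Metric.isClosed_sphere.measurableSet]
  have : Metric.sphere (0 : K) 1 = {x : K | ‖x‖ = 1} := by ext; simp
  rw [this, Complex.real_smul, mul_one]

theorem norm_mul_le_iff_of_norm_eq_one {x y : K} {R : ℝ} (hx : ‖x‖ = 1) :
    ‖x * y‖ ≤ R ↔ ‖y‖ ≤ R := by rw [norm_mul, hx, one_mul]

/-- The pairing of `ξ_{s-1}` with the Fourier transform of the character `ξ` of the unit sphere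
is a gamma factor. -/
theorem integral_fourier_sphereChar_mul (ϖ : Uniformizer K) {ψ : AddChar K Circle}
    (hψc : Continuous ψ) (hψ : ψ ≠ 1) (ξ : UnitChar K) {s : ℂ} (hs : 0 < s.re) :
    ∫ y, fourier μ ψ (sphereChar ϖ ξ) y * quasiChar ϖ ξ (s - 1) y ∂μ =
      (μ.real {x : K | ‖x‖ = 1} : ℂ) * gammaFactor μ ϖ ψ ξ s := by
  classical
  obtain ⟨R₀, hR₀, hΓ⟩ := exists_gammaFactor_eq μ ϖ hψc hψ ξ
  have hf := sphereChar_mem_testFun ϖ ξ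
  obtain ⟨R₁, -, hR₁⟩ := testFun_support_subset_closedBall (fourier_mem_testFun μ hψc hψ hf)
  set R := max R₀ R₁
  have hR : 0 < R := hR₀.trans_le (le_max_left _ _)
  set b : K → ℂ := (Metric.closedBall (0 : K) R).indicator fun _ => (1 : ℂ) with hb
  have hs1 : -1 < (s - 1).re := by rw [Complex.sub_re, Complex.one_re]; linarith
  have hint1 := integrable_quasiChar_mul μ ϖ ξ hs1 (one_indicator_mem_testFun hR)
  have hint2 : Integrable (fun p : K × K => (ψ (p.1 * p.2) : ℂ) *
      ((quasiChar ϖ ξ (s - 1) p.1 * b p.1) * sphereChar ϖ ξ p.2)) (μ.prod μ) := by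
    refine (hint1.mul_prod (testFun_integrable hf)).bdd_mul (c := 1)
      ((continuous_coe_addChar hψc).comp (by fun_prop)).aestronglyMeasurable
      (Eventually.of_forall fun p => (Circle.norm_coe _).le)
  have h1 : ∀ y, fourier μ ψ (sphereChar ϖ ξ) y * quasiChar ϖ ξ (s - 1) y =
      ∫ x, (ψ (y * x) : ℂ) * ((quasiChar ϖ ξ (s - 1) y * b y) * sphereChar ϖ ξ x) ∂μ := by
    intro y
    have h2 : fourier μ ψ (sphereChar ϖ ξ) y * b y = fourier μ ψ (sphereChar ϖ ξ) y := by
      by_cases h : fourier μ ψ (sphereChar ϖ ξ) y = 0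
      · rw [h, zero_mul]
      · rw [hb, Set.indicator_of_mem
          (mem_closedBall_zero_iff.2 ((hR₁ y h).trans (le_max_right _ _))), mul_one]
    rw [← h2, fourier, mul_assoc, ← integral_mul_const]
    refine integral_congr_ae (Eventually.of_forall fun x => ?_)
    simp only
    ring
  have h2 : ∀ x, ∫ y, (ψ (y * x) : ℂ) *
      ((quasiChar ϖ ξ (s - 1) y * b y) * sphereChar ϖ ξ x) ∂μ =
      sphereInd K x * gammaFactor μ ϖ ψ ξ s := by
    intro x
    by_cases hx : ‖x‖ = 1
    · have hx0 : x ≠ 0 := norm_ne_zero_iff.1 (by rw [hx]; exact one_ne_zero)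
      have h3 := integral_mul_left μ ϖ hx0 fun v =>
        quasiChar ϖ ξ (s - 1) v * truncChar ψ R v
      rw [absVal_of_norm_eq_one ϖ hx, hΓ s hs R (le_max_left _ _), Complex.ofReal_one, inv_one,
        one_mul] at h3
      rw [sphereInd_of_norm hx, one_mul, ← h3]
      refine integral_congr_ae (Eventually.of_forall fun y => ?_)
      simp only [sphereChar, sphereInd_of_norm hx, hb, truncChar, Set.indicator_apply,
        mem_closedBall_zero_iff, norm_mul_le_iff_of_norm_eq_one hx, map_mul,
        quasiChar_congr_of_norm_eq_one ϖ ξ 0 (s - 1) hx, mul_comm y x]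
      split_ifs <;> ring
    · simp [sphereChar, sphereInd_of_norm_ne hx]
  simp only [h1]
  rw [integral_integral_swap (f := fun y x => (ψ (y * x) : ℂ) *
    ((quasiChar ϖ ξ (s - 1) y * b y) * sphereChar ϖ ξ x)) hint2]
  simp only [h2]
  exact integral_sphereInd_mul μ _

end Sphere

section Line

variable {F : Type*} [NontriviallyNormedField F] [IsUltrametricDist F] [ProperSpace F]
  [MeasurableSpace F] [BorelSpace F]
  {E : Type*} [NontriviallyNormedField E] [NormedAlgebra F E]
  [IsUltrametricDist E] [ProperSpace E] [MeasurableSpace E] [BorelSpace E]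
  (Q : QuadraticGenerator F E) (ϖF : Uniformizer F) (ϖE : Uniformizer E)
  (Ω : UnitChar E)

theorem coord_one_ne_zero (u : F) : Q.coord (u, 1) ≠ 0 := by
  rw [Ne, coord_eq_zero_iff]
  exact fun h => one_ne_zero (congrArg Prod.snd h)

theorem measurable_quasiChar_coord_one (s : ℂ) :
    Measurable fun u : F => quasiChar ϖE Ω s (Q.coord (u, 1)) :=
  (measurable_quasiChar ϖE Ω s).comp ((continuous_coord Q).measurable.comp
    (measurable_id.prodMk measurable_const))

/-- `Ω_{s}` is integrable over the line `F + α` for `Re s < -1/2`. -/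
theorem integrable_quasiChar_coord_one (ϖF : Uniformizer F) {s : ℂ} (hs : s.re < -1 / 2) :
    Integrable (fun u => quasiChar ϖE Ω s (Q.coord (u, 1))) (haarO F) := by
  obtain ⟨C, hC, h⟩ := exists_absVal_coord_ge Q ϖF ϖE
  set D := C ^ (-s.re)
  have hball : MeasurableSet (Metric.ball (0 : F) 1) := Metric.isOpen_ball.measurableSet
  have h1 : Integrable ((Metric.ball (0 : F) 1).indicator fun _ => D) (haarO F) :=
    (integrable_indicator_iff hball).2 (integrableOn_const measure_ball_lt_top.ne)
  have h2 : Integrable ((Metric.ball (0 : F) 1)ᶜ.indicator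
      fun u => D * absVal ϖF u ^ (2 * s.re)) (haarO F) :=
    (integrable_indicator_iff hball.compl).2 (Integrable.const_mul
      (integrableOn_absVal_rpow_compl_ball (haarO F) ϖF (by linarith) one_pos) D)
  refine (h1.add h2).mono' (measurable_quasiChar_coord_one Q ϖE Ω s).aestronglyMeasurable
    (Eventually.of_forall fun u => ?_)
  have hm := absVal_pos ϖE (coord_one_ne_zero Q u)
  have hb := (h (u, 1)).2
  rw [absVal_one] at hb
  rw [norm_quasiChar ϖE _ _ (coord_one_ne_zero Q u), Pi.add_apply]
  by_cases hu : u ∈ Metric.ball (0 : F) 1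
  · rw [Set.indicator_of_mem hu, Set.indicator_of_notMem (Set.notMem_compl_iff.2 hu), add_zero]
    have := rpow_neg_le_of_sq_le one_pos one_pos hm hC hb hb (u := -2 * s.re) (v := 0)
      (by linarith) le_rfl
    rw [show -((-2 * s.re + 0) / 2) = s.re by ring, Real.one_rpow, Real.one_rpow, mul_one,
      mul_one, show (-2 * s.re + 0) / 2 = -s.re by ring] at this
    exact this
  · rw [Set.indicator_of_notMem hu, Set.indicator_of_mem hu, zero_add]
    have hu0 : u ≠ 0 := by rintro rfl; exact hu (Metric.mem_ball_self one_pos)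
    have := rpow_neg_le_of_sq_le (absVal_pos ϖF hu0) one_pos hm hC (h (u, 1)).1 hb
      (u := -2 * s.re) (v := 0) (by linarith) le_rfl
    rw [show -((-2 * s.re + 0) / 2) = s.re by ring, Real.one_rpow, mul_one,
      show (-2 * s.re + 0) / 2 = -s.re by ring, show -(-2 * s.re) = 2 * s.re by ring] at this
    exact this

/-- On the unit sphere the factor `ξ = Ω⁻¹` cancels the homogeneity of `Ω_s`. -/
theorem sphereChar_mul_quasiChar_coord (hΩ : resChar (twist ϖE Ω 0) ϖF.val = 1) (s : ℂ) (x y : F) :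
    sphereChar ϖF (resUnitChar Ω)⁻¹ y * quasiChar ϖE Ω s (Q.coord (x, y)) =
      sphereInd F y * quasiChar ϖE Ω s (Q.coord (y⁻¹ * x, 1)) := by
  by_cases hy : ‖y‖ = 1
  · have hy0 : y ≠ 0 := norm_ne_zero_iff.1 (by rw [hy]; exact one_ne_zero)
    have hc : Q.coord (x, y) = algebraMap F E y * Q.coord (y⁻¹ * x, 1) := by
      rw [algebraMap_mul_coord, mul_inv_cancel_left₀ hy0, mul_one]
    have h1 : quasiChar ϖF (resUnitChar Ω)⁻¹ 0 y * quasiChar ϖF (resUnitChar Ω) (2 * s) y = 1 := by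
      rw [quasiChar_congr_of_norm_eq_one ϖF _ (2 * s) 0 hy, quasiChar_mul_quasiChar,
        inv_mul_cancel, add_zero, quasiChar_one_eq_cpow ϖF 0 hy0, Complex.cpow_zero]
    rw [sphereChar, hc, map_mul, quasiChar_algebraMap Q ϖF ϖE Ω hΩ]
    linear_combination (sphereInd F y * quasiChar ϖE Ω s (Q.coord (y⁻¹ * x, 1))) * h1
  · simp [sphereChar, sphereInd_of_norm_ne hy]

theorem integrable_sphereChar_mul_quasiChar (hΩ : resChar (twist ϖE Ω 0) ϖF.val = 1) {s : ℂ}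
    (hs : s.re < -1 / 2) :
    Integrable (fun p : F × F => sphereChar ϖF (resUnitChar Ω)⁻¹ p.2 *
      quasiChar ϖE Ω s (Q.coord p)) ((haarO F).prod (haarO F)) := by
  have hline := integrable_quasiChar_coord_one Q ϖE Ω ϖF hs
  have hmeas : Measurable (fun p : F × F => sphereChar ϖF (resUnitChar Ω)⁻¹ p.2 *
      quasiChar ϖE Ω s (Q.coord p)) :=
    ((testFun_continuous (sphereChar_mem_testFun ϖF _)).measurable.comp measurable_snd).mul
      ((measurable_quasiChar ϖE Ω s).comp (continuous_coord Q).measurable)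
  have hinv : ∀ y : F, ‖y‖ = 1 → y⁻¹ ≠ 0 ∧ absVal ϖF y⁻¹ = 1 := fun y hy =>
    ⟨inv_ne_zero (norm_ne_zero_iff.1 (by rw [hy]; exact one_ne_zero)),
      absVal_of_norm_eq_one ϖF (by rw [norm_inv, hy, inv_one])⟩
  rw [integrable_prod_iff' hmeas.aestronglyMeasurable]
  simp only [sphereChar_mul_quasiChar_coord Q ϖF ϖE Ω hΩ]
  constructor
  · refine Eventually.of_forall fun y => ?_
    by_cases hy : ‖y‖ = 1
    · exact (integrable_mul_left (haarO F) ϖF (hinv y hy).1 hline).const_mul _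
    · simp [sphereInd_of_norm_ne hy]
  · have h1 : Integrable (fun y => ‖sphereInd F y‖ *
        ∫ u, ‖quasiChar ϖE Ω s (Q.coord (u, 1))‖ ∂haarO F) (haarO F) :=
      (testFun_integrable sphereInd_mem_testFun).norm.mul_const _
    refine h1.congr (Eventually.of_forall fun y => ?_)
    simp only [norm_mul]
    rw [integral_const_mul]
    by_cases hy : ‖y‖ = 1
    · have h2 := integral_comp_mul_left (haarO F) ϖF (hinv y hy).1
        fun u => ‖quasiChar ϖE Ω s (Q.coord (u, 1))‖
      rw [h2, (hinv y hy).2, inv_one, one_smul]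
    · simp [sphereInd_of_norm_ne hy]

theorem integral_sphereChar_mul_quasiChar (hΩ : resChar (twist ϖE Ω 0) ϖF.val = 1) {s : ℂ}
    (hs : s.re < -1 / 2) :
    ∫ p : F × F, sphereChar ϖF (resUnitChar Ω)⁻¹ p.2 * quasiChar ϖE Ω s (Q.coord p)
        ∂(haarO F).prod (haarO F) =
      ((haarO F).real {x : F | ‖x‖ = 1} : ℂ) *
        ∫ u, quasiChar ϖE Ω s (Q.coord (u, 1)) ∂haarO F := by
  rw [integral_prod_symm _ (integrable_sphereChar_mul_quasiChar Q ϖF ϖE Ω hΩ hs)]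
  simp only [sphereChar_mul_quasiChar_coord Q ϖF ϖE Ω hΩ]
  rw [← integral_sphereInd_mul]
  refine integral_congr_ae (Eventually.of_forall fun y => ?_)
  simp only
  rw [integral_const_mul]
  by_cases hy : ‖y‖ = 1
  · have h2 := integral_comp_mul_left (haarO F) ϖF (c := y⁻¹)
      (inv_ne_zero (norm_ne_zero_iff.1 (by rw [hy]; exact one_ne_zero)))
      fun u => quasiChar ϖE Ω s (Q.coord (u, 1))
    rw [h2, absVal_of_norm_eq_one ϖF (by rw [norm_inv, hy, inv_one]), inv_one, one_smul]
  · simp [sphereInd_of_norm_ne hy]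

variable {ψ : AddChar F Circle}

theorem extendAddChar_coord (p : F × F) : Q.extendAddChar ψ (Q.coord p) = ψ p.1 := by
  change ψ (Q.coord.symm (Q.coord p)).1 = ψ p.1
  rw [coord_symm_coord]

theorem continuous_extendAddChar (hψc : Continuous ψ) : Continuous (Q.extendAddChar ψ) :=
  hψc.comp (continuous_fst.comp (continuous_coord_symm Q))

theorem extendAddChar_ne_one (hψ : ψ ≠ 1) : Q.extendAddChar ψ ≠ 1 := by
  obtain ⟨x, hx⟩ := exists_addChar_ne_one hψ
  intro h
  apply hx
  have := extendAddChar_coord Q (ψ := ψ) (x, 0)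
  rw [h] at this
  exact this.symm

/-- The partial Fourier transform of `Ω_{w-1}`, cut off to a ball, in the coordinate `u₂`. -/
theorem integral_addChar_snd_mul_quasiChar (hΩ : resChar (twist ϖE Ω 0) ϖF.val = 1) (w : ℂ)
    {y : F} (hy : y ≠ 0) (R : ℝ) :
    ∫ u, (ψ (-((Q.coord.symm u).2 * y)) : ℂ) * (quasiChar ϖE Ω (w - 1) u *
        (Metric.closedBall (0 : E) R).indicator (fun _ => (1 : ℂ)) u) ∂Q.haarE =
      quasiChar ϖE Ω w (-Q.α) * (quasiChar ϖF (resUnitChar Ω)⁻¹ (-(2 * w)) y *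
        ∫ v, quasiChar ϖE Ω (w - 1) v *
          truncChar (Q.extendAddChar ψ) (R / (‖Q.α‖ * ‖y‖⁻¹)) v ∂Q.haarE) := by
  classical
  have hα := generator_ne_zero Q
  set d : E := -Q.α * algebraMap F E y⁻¹ with hd
  have hd0 : d ≠ 0 := mul_ne_zero (neg_ne_zero.2 hα) (by simpa using hy)
  have hdn : ‖d‖ = ‖Q.α‖ * ‖y‖⁻¹ := by rw [hd, norm_mul, norm_neg, norm_algebraMap', norm_inv]
  have hdpos : 0 < ‖d‖ := norm_pos_iff.2 hd0
  have hqd : quasiChar ϖE Ω w d =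
      quasiChar ϖE Ω w (-Q.α) * quasiChar ϖF (resUnitChar Ω)⁻¹ (-(2 * w)) y := by
    rw [hd, map_mul, quasiChar_algebraMap Q ϖF ϖE Ω hΩ, map_inv₀, quasiChar_inv]
  have hsnd : ∀ v : E, ψ (-((Q.coord.symm (d * v)).2 * y)) = Q.extendAddChar ψ v := by
    intro v
    obtain ⟨p, rfl⟩ := Q.coord.surjective v
    have h1 : d = Q.coord (0, -y⁻¹) := by rw [hd, Q.coord_apply]; simp; ring
    rw [h1, coord_mul, coord_symm_coord, extendAddChar_coord]
    congr 1
    simp only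
    field_simp
    ring
  have hsub := integral_mul_left Q.haarE ϖE hd0 fun u =>
    (ψ (-((Q.coord.symm u).2 * y)) : ℂ) * (quasiChar ϖE Ω (w - 1) u *
        (Metric.closedBall (0 : E) R).indicator (fun _ => (1 : ℂ)) u)
  have habs : (absVal ϖE d : ℂ) ≠ 0 := by exact_mod_cast (absVal_pos ϖE hd0).ne'
  rw [eq_comm, inv_mul_eq_iff_eq_mul₀ habs] at hsub
  rw [hsub, ← mul_assoc, ← hqd, ← hdn, ← integral_const_mul, ← integral_const_mul]
  refine integral_congr_ae (Eventually.of_forall fun v => ?_)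
  have h1 : quasiChar ϖE Ω (w - 1) d * (absVal ϖE d : ℂ) = quasiChar ϖE Ω w d := by
    rw [quasiChar_mul_absVal, sub_add_cancel]
  simp only [hsnd, map_mul, truncChar, Set.indicator_apply, mem_closedBall_zero_iff, norm_mul,
    ← h1, le_div_iff₀ hdpos, mul_comm ‖v‖]
  split_ifs <;> ring

theorem exists_norm_integral_truncChar_le {K : Type*} [NontriviallyNormedField K]
    [IsUltrametricDist K] [ProperSpace K] [MeasurableSpace K] [BorelSpace K] (μ : Measure K)
    [μ.IsAddHaarMeasure] (ϖ : Uniformizer K) {ψ : AddChar K Circle}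
    (hψc : Continuous ψ) (hψ : ψ ≠ 1) (ξ : UnitChar K) {s : ℂ} (hs : 0 < s.re) :
    ∃ M : ℝ, ∀ R, ‖∫ x, quasiChar ϖ ξ (s - 1) x * truncChar ψ R x ∂μ‖ ≤ M := by
  obtain ⟨R₀, hR₀, hΓ⟩ := exists_gammaFactor_eq μ ϖ hψc hψ ξ
  have hs1 : -1 < (s - 1).re := by rw [Complex.sub_re, Complex.one_re]; linarith
  have hint := integrable_quasiChar_mul μ ϖ ξ hs1 (truncChar_mem_testFun hψc hR₀)
  refine ⟨max ‖gammaFactor μ ϖ ψ ξ s‖ (∫ x, ‖quasiChar ϖ ξ (s - 1) x * truncChar ψ R₀ x‖ ∂μ),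
    fun R => ?_⟩
  rcases le_total R₀ R with h | h
  · rw [hΓ s hs R h]
    exact le_max_left _ _
  · refine (norm_integral_le_of_norm_le hint.norm (Eventually.of_forall fun x => ?_)).trans
      (le_max_right _ _)
    rw [norm_mul, norm_mul]
    refine mul_le_mul_of_nonneg_left ?_ (norm_nonneg _)
    exact norm_indicator_le_of_subset (Metric.closedBall_subset_closedBall h) _ _

theorem tendsto_integral_closedBall {f : E → ℂ} {μ : Measure E} (hf : Integrable f μ) :
    Tendsto
      (fun n : ℕ => ∫ u, f u * (Metric.closedBall (0 : E) n).indicator (fun _ => (1 : ℂ)) u ∂μ)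
      atTop (𝓝 (∫ u, f u ∂μ)) := by
  refine tendsto_integral_of_dominated_convergence (fun u => ‖f u‖) (fun n => ?_) hf.norm
    (fun n => Eventually.of_forall fun u => ?_) (Eventually.of_forall fun u => ?_)
  · exact hf.aestronglyMeasurable.mul (aestronglyMeasurable_const.indicator
      Metric.isClosed_closedBall.measurableSet)
  · rw [norm_mul]
    refine mul_le_of_le_one_right (norm_nonneg _) ?_
    exact (norm_indicator_le_norm_self _ _).trans (by simp)
  · refine tendsto_const_nhds.congr' ?_
    filter_upwards [eventually_ge_atTop ⌈‖u‖⌉₊] with n hn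
    rw [Set.indicator_of_mem (mem_closedBall_zero_iff.2
      ((Nat.le_ceil _).trans (by exact_mod_cast hn))), mul_one]

/-- Fourier inversion turns the cut-off integral of `f(u₂) Ω_{w-1}(u)` into an integral over the
Fourier transform of `f`. -/
theorem integral_snd_mul_quasiChar_eq (ϖF : Uniformizer F) (hψc : Continuous ψ) (hψ : ψ ≠ 1)
    {w : ℂ} (hw : 0 < w.re) {f : F → ℂ}
    (hf : f ∈ testFun F) {R : ℝ} (hR : 0 < R) :
    Integrable (fun y => fourier (haarO F) ψ f y * ∫ u, (ψ (-((Q.coord.symm u).2 * y)) : ℂ) *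
        (quasiChar ϖE Ω (w - 1) u *
          (Metric.closedBall (0 : E) R).indicator (fun _ => (1 : ℂ)) u) ∂Q.haarE) (haarO F) ∧
    ∫ u, f (Q.coord.symm u).2 * quasiChar ϖE Ω (w - 1) u *
        (Metric.closedBall (0 : E) R).indicator (fun _ => (1 : ℂ)) u ∂Q.haarE =
      fourierConst (haarO F) ψ * ∫ y, fourier (haarO F) ψ f y *
        ∫ u, (ψ (-((Q.coord.symm u).2 * y)) : ℂ) * (quasiChar ϖE Ω (w - 1) u *
          (Metric.closedBall (0 : E) R).indicator (fun _ => (1 : ℂ)) u) ∂Q.haarE ∂haarO F := by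
  have hw1 : -1 < (w - 1).re := by rw [Complex.sub_re, Complex.one_re]; linarith
  have hfour := fourier_mem_testFun (haarO F) hψc hψ hf
  set b : E → ℂ := (Metric.closedBall (0 : E) R).indicator fun _ => (1 : ℂ)
  have hint1 := integrable_quasiChar_mul Q.haarE ϖE Ω hw1 (one_indicator_mem_testFun hR)
  have hsnd : Continuous fun u : E => (Q.coord.symm u).2 :=
    continuous_snd.comp (continuous_coord_symm Q)
  have hint : Integrable (fun p : F × E => (ψ (-((Q.coord.symm p.2).2 * p.1)) : ℂ) *
      (fourier (haarO F) ψ f p.1 * (quasiChar ϖE Ω (w - 1) p.2 * b p.2)))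
      ((haarO F).prod Q.haarE) := by
    refine ((testFun_integrable hfour).mul_prod hint1).bdd_mul (c := 1)
      ((continuous_coe_addChar hψc).comp
        (((hsnd.comp continuous_snd).mul continuous_fst).neg)).aestronglyMeasurable
      (Eventually.of_forall fun p => (Circle.norm_coe _).le)
  have hin : ∀ y, ∫ u, (ψ (-((Q.coord.symm u).2 * y)) : ℂ) *
      (fourier (haarO F) ψ f y * (quasiChar ϖE Ω (w - 1) u * b u)) ∂Q.haarE =
      fourier (haarO F) ψ f y * ∫ u, (ψ (-((Q.coord.symm u).2 * y)) : ℂ) *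
        (quasiChar ϖE Ω (w - 1) u * b u) ∂Q.haarE := by
    intro y
    rw [← integral_const_mul]
    refine integral_congr_ae (Eventually.of_forall fun u => ?_)
    simp only
    ring
  constructor
  · exact hint.integral_prod_left.congr (Eventually.of_forall hin)
  · simp only [← hin]
    rw [integral_integral_swap (f := fun y u => (ψ (-((Q.coord.symm u).2 * y)) : ℂ) *
      (fourier (haarO F) ψ f y * (quasiChar ϖE Ω (w - 1) u * b u))) hint, ← integral_const_mul]
    refine integral_congr_ae (Eventually.of_forall fun u => ?_)
    simp only
    rw [(isFourierConst_fourierConst (haarO F) ϖF hψc hψ).2 f hf (Q.coord.symm u).2, mul_assoc,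
      mul_assoc, ← integral_mul_const]
    congr 1
    refine integral_congr_ae (Eventually.of_forall fun y => ?_)
    simp only
    ring

/-- For `0 < Re w < 1/2` the integral of `Ω_{w-1}` over the line `F + α` is a product of two gamma
factors. -/
theorem integral_quasiChar_coord_one (hψc : Continuous ψ) (hψ : ψ ≠ 1)
    (hΩ : resChar (twist ϖE Ω 0) ϖF.val = 1) {w : ℂ} (hw : 0 < w.re) (hw' : w.re < 1 / 2) :
    ∫ u, quasiChar ϖE Ω (w - 1) (Q.coord (u, 1)) ∂haarO F =
      fourierConst (haarO F) ψ * quasiChar ϖE Ω w (-Q.α) *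
        gammaFactor (haarO F) ϖF ψ (resUnitChar Ω)⁻¹ (1 - 2 * w) *
        gammaFactor Q.haarE ϖE (Q.extendAddChar ψ) Ω w := by
  have hψEc := continuous_extendAddChar Q hψc
  have hψE := extendAddChar_ne_one Q hψ
  have hs : (w - 1).re < -1 / 2 := by rw [Complex.sub_re, Complex.one_re]; linarith
  have hz : 0 < (1 - 2 * w).re := by simp; linarith
  have hz1 : -1 < (-(2 * w)).re := by simp; linarith
  obtain ⟨R₀, hR₀, hΓ⟩ := exists_gammaFactor_eq Q.haarE ϖE hψEc hψE Ω
  obtain ⟨M, hM⟩ := exists_norm_integral_truncChar_le Q.haarE ϖE hψEc hψE Ω hw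
  set f := sphereChar ϖF (resUnitChar Ω)⁻¹ with hfdef
  have hf : f ∈ testFun F := sphereChar_mem_testFun _ _
  have hfour := fourier_mem_testFun (haarO F) hψc hψ hf
  set G : ℝ → F → ℂ := fun R y => fourier (haarO F) ψ f y *
    ∫ u, (ψ (-((Q.coord.symm u).2 * y)) : ℂ) * (quasiChar ϖE Ω (w - 1) u *
      (Metric.closedBall (0 : E) R).indicator (fun _ => (1 : ℂ)) u) ∂Q.haarE with hG
  have hGeq : ∀ R y, y ≠ 0 → G R y = quasiChar ϖE Ω w (-Q.α) *
      (quasiChar ϖF (resUnitChar Ω)⁻¹ (-(2 * w)) y * fourier (haarO F) ψ f y) *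
        ∫ v, quasiChar ϖE Ω (w - 1) v *
          truncChar (Q.extendAddChar ψ) (R / (‖Q.α‖ * ‖y‖⁻¹)) v ∂Q.haarE := by
    intro R y hy
    simp only [hG]
    rw [integral_addChar_snd_mul_quasiChar Q ϖF ϖE Ω hΩ w hy R]
    ring
  have hint := integrable_sphereChar_mul_quasiChar Q ϖF ϖE Ω hΩ hs
  have hintE : Integrable (fun u => f (Q.coord.symm u).2 * quasiChar ϖE Ω (w - 1) u) Q.haarE := by
    rw [integrable_haarE_iff]
    simp only [coord_symm_coord]
    exact hint
  have hJ : ∫ u, f (Q.coord.symm u).2 * quasiChar ϖE Ω (w - 1) u ∂Q.haarE =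
      ((haarO F).real {x : F | ‖x‖ = 1} : ℂ) *
        ∫ u, quasiChar ϖE Ω (w - 1) (Q.coord (u, 1)) ∂haarO F := by
    rw [integral_haarE]
    simp only [coord_symm_coord]
    exact integral_sphereChar_mul_quasiChar Q ϖF ϖE Ω hΩ hs
  have hlim1 := tendsto_integral_closedBall hintE
  have hdom := integrable_quasiChar_mul (haarO F) ϖF (resUnitChar Ω)⁻¹ hz1 hfour
  have hlim2 : Tendsto (fun n : ℕ => ∫ y, G n y ∂haarO F) atTop
      (𝓝 (∫ y, quasiChar ϖE Ω w (-Q.α) *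
        (quasiChar ϖF (resUnitChar Ω)⁻¹ (-(2 * w)) y * fourier (haarO F) ψ f y) *
          gammaFactor Q.haarE ϖE (Q.extendAddChar ψ) Ω w ∂haarO F)) := by
    refine tendsto_integral_filter_of_dominated_convergence
      (fun y => ‖quasiChar ϖE Ω w (-Q.α)‖ *
        ‖quasiChar ϖF (resUnitChar Ω)⁻¹ (-(2 * w)) y * fourier (haarO F) ψ f y‖ * M)
      ?_ (Eventually.of_forall fun n => ?_) ((hdom.norm.const_mul _).mul_const M) ?_
    · filter_upwards [eventually_gt_atTop 0] with n hn
      exact (integral_snd_mul_quasiChar_eq Q ϖE Ω ϖF hψc hψ hw hf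
        (by exact_mod_cast hn)).1.aestronglyMeasurable
    · filter_upwards [ae_ne_zero (haarO F)] with y hy
      rw [hGeq n y hy, norm_mul, norm_mul]
      exact mul_le_mul_of_nonneg_left (hM _) (by positivity)
    · filter_upwards [ae_ne_zero (haarO F)] with y hy
      refine tendsto_const_nhds.congr' ?_
      have hd : 0 < ‖Q.α‖ * ‖y‖⁻¹ :=
        mul_pos (norm_pos_iff.2 (generator_ne_zero Q)) (inv_pos.2 (norm_pos_iff.2 hy))
      filter_upwards [eventually_ge_atTop ⌈R₀ * (‖Q.α‖ * ‖y‖⁻¹)⌉₊] with n hn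
      rw [hGeq n y hy, hΓ w hw _ ((le_div_iff₀ hd).2
        ((Nat.le_ceil _).trans (by exact_mod_cast hn)))]
  have h1 : ∀ᶠ n : ℕ in atTop, ∫ u, f (Q.coord.symm u).2 * quasiChar ϖE Ω (w - 1) u *
        (Metric.closedBall (0 : E) n).indicator (fun _ => (1 : ℂ)) u ∂Q.haarE =
      fourierConst (haarO F) ψ * ∫ y, G n y ∂haarO F := by
    filter_upwards [eventually_gt_atTop 0] with n hn
    exact (integral_snd_mul_quasiChar_eq Q ϖE Ω ϖF hψc hψ hw hf (by exact_mod_cast hn)).2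
  have h2 := tendsto_nhds_unique (hlim1.congr' h1) (hlim2.const_mul _)
  have hA := integral_fourier_sphereChar_mul (haarO F) ϖF hψc hψ (resUnitChar Ω)⁻¹ hz
  rw [show 1 - 2 * w - 1 = -(2 * w) by ring] at hA
  rw [hJ, integral_mul_const, integral_const_mul] at h2
  simp only [mul_comm (quasiChar ϖF (resUnitChar Ω)⁻¹ (-(2 * w)) _)] at h2
  rw [hA, measureReal_unitSphere_haarO ϖF] at h2
  have hq : (1 - (residueCard F : ℝ)⁻¹ : ℝ) ≠ 0 :=
    (sub_pos.2 (inv_lt_one_of_one_lt₀ (by exact_mod_cast one_lt_residueCard F))).ne'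
  refine mul_left_cancel₀ (Complex.ofReal_ne_zero.2 hq) (h2.trans ?_)
  ring

end Line

/-! ### Identification of the constant -/

/-- The identity principle for meromorphic functions on `ℂ`. -/
theorem eventually_eq_zero_of_meromorphicOn {h : ℂ → ℂ} (hh : MeromorphicOn h Set.univ) {z₀ : ℂ}
    (h0 : ∀ᶠ z in 𝓝 z₀, h z = 0) (z : ℂ) : ∀ᶠ z' in 𝓝[≠] z, h z' = 0 := by
  have h1 : meromorphicOrderAt h z₀ = ⊤ :=
    meromorphicOrderAt_eq_top_iff.2 (h0.filter_mono nhdsWithin_le_nhds)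
  refine meromorphicOrderAt_eq_top_iff.1 ?_
  by_contra h2
  exact hh.meromorphicOrderAt_ne_top_of_isPreconnected isPreconnected_univ (Set.mem_univ z)
    (Set.mem_univ z₀) h2 h1

section Constant

variable {F : Type*} [NontriviallyNormedField F] [IsUltrametricDist F] [ProperSpace F]
  [MeasurableSpace F] [BorelSpace F]
  {E : Type*} [NontriviallyNormedField E] [NormedAlgebra F E]
  [IsUltrametricDist E] [ProperSpace E] [MeasurableSpace E] [BorelSpace E]
  (Q : QuadraticGenerator F E) (ϖF : Uniformizer F) (ϖE : Uniformizer E)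
  {ψ : AddChar F Circle} (χ : UnitChar E) (η : UnitChar F)

theorem quasiChar_neg_generator (t : ℂ) :
    quasiChar ϖE (χ ^ 2)⁻¹ (-t + 1 / 2) (-Q.α) =
      (charFun (twist ϖE χ 0) (-Q.α) ^ 2)⁻¹ * (absVal ϖF Q.a : ℂ) ^ (-t + 1 / 2) := by
  have hα : -Q.α ≠ 0 := neg_ne_zero.2 (generator_ne_zero Q)
  have habs : absVal ϖF Q.a = absVal ϖE (-Q.α) := by
    rw [absVal_a Q ϖF ϖE, absVal_eq_norm_rpow, absVal_eq_norm_rpow, norm_neg]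
  rw [charFun_twist, quasiChar_sq, mul_zero, quasiChar_inv, habs, ← quasiChar_one_eq_cpow ϖE _ hα,
    quasiChar_mul_quasiChar, mul_one, neg_zero, zero_add]

/-- The residue constant agrees with the regularized integral in the strip `0 < Re t < 1/2`. -/
theorem kernelDist_unitBump_eq_residueConst (hψc : Continuous ψ) (hψ : ψ ≠ 1)
    (hχ : resChar (twist ϖE χ 0) ϖF.val = 1) {s t : ℂ} (h : InSlash χ s η t)
    (ht : 0 < t.re) (ht' : t.re < 1 / 2) :
    kernelDist Q ϖF ϖE χ η s t (unitBump E) = residueConst Q ϖF ϖE ψ χ η s t := by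
  have hΩ := resChar_twist_sq_inv ϖF ϖE χ hχ
  have hw : 0 < (-t + 1 / 2).re := by simp; linarith
  have hw' : (-t + 1 / 2).re < 1 / 2 := by simp; linarith
  have hline := integral_quasiChar_coord_one Q ϖF ϖE (χ ^ 2)⁻¹ hψc hψ hΩ hw hw'
  rw [show -t + 1 / 2 - 1 = -t - 1 / 2 by ring, show 1 - 2 * (-t + 1 / 2) = 2 * t by ring,
    resUnitChar_inv, inv_inv, quasiChar_neg_generator Q ϖF] at hline
  rw [kernelDist_eq_of_inSlash_of_re_pos Q ϖF ϖE χ η hχ h ht, lineIntegral, hline, unitBump_zero,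
    residueConst, inv_localL_kernel ϖF ϖE χ η Q hχ]
  ring

theorem meromorphicAt_gammaFactor {K : Type*} [NontriviallyNormedField K] [IsUltrametricDist K]
    [ProperSpace K] [MeasurableSpace K] [BorelSpace K] (μ : Measure K) [μ.IsAddHaarMeasure]
    (ϖ : Uniformizer K) {ψ : AddChar K Circle} (hψc : Continuous ψ) (hψ : ψ ≠ 1) (ξ : UnitChar K)
    (s : ℂ) : MeromorphicAt (gammaFactor μ ϖ ψ ξ) s :=
  (isGammaFactor_gammaFactor μ ϖ hψc hψ ξ).1.meromorphicOn s (Set.mem_univ s)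

/-- The factors of the residue constant other than the gamma factors are entire along a
hyperplane `//`. -/
theorem exists_residueConst_eq (hχ : resChar (twist ϖE χ 0) ϖF.val = 1) (s t : ℂ) :
    ∃ A : ℂ → ℂ, Differentiable ℂ A ∧ ∀ z, residueConst Q ϖF ϖE ψ χ η (s + (z - t) / 2) z =
      A z * gammaFactor (haarO F) ϖF ψ (resUnitChar (χ ^ 2)) (2 * z) *
        gammaFactor Q.haarE ϖE (Q.extendAddChar ψ) (χ ^ 2)⁻¹ (-z + 1 / 2) := by
  refine ⟨fun z => fourierConst (haarO F) ψ * (1 - (residueCard F : ℂ)⁻¹) *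
    quasiChar ϖE (χ ^ 2)⁻¹ (-z + 1 / 2) (-Q.α) *
    eulerFactor ϖF (resUnitChar χ * η) (2 * (s + (z - t) / 2) + z + 1 / 2), ?_, fun z => ?_⟩
  · have h1 : Differentiable ℂ fun z : ℂ => -z + 1 / 2 := by fun_prop
    have h2 : Differentiable ℂ fun z : ℂ => 2 * (s + (z - t) / 2) + z + 1 / 2 := by fun_prop
    exact (((differentiable_quasiChar ϖE (χ ^ 2)⁻¹ (-Q.α)).comp h1).const_mul _).mul
      ((differentiable_eulerFactor ϖF (resUnitChar χ * η)).comp h2)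
  · simp only
    rw [residueConst, inv_localL_kernel ϖF ϖE χ η Q hχ, quasiChar_neg_generator Q ϖF]
    ring

/-- The identity for the constant continues along the hyperplane `//`. -/
theorem eventually_residueConst_eq (hψc : Continuous ψ) (hψ : ψ ≠ 1)
    (hχ : resChar (twist ϖE χ 0) ϖF.val = 1) {s t : ℂ} (h : InSlash χ s η t) :
    ∀ᶠ z in 𝓝[≠] t, residueConst Q ϖF ϖE ψ χ η (s + (z - t) / 2) z =
      kernelDist Q ϖF ϖE χ η (s + (z - t) / 2) z (unitBump E) := by
  obtain ⟨A, hA, hAeq⟩ := exists_residueConst_eq Q ϖF ϖE (ψ := ψ) χ η hχ s t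
  have hC := differentiable_kernelDist_line Q ϖF ϖE χ η s t (unitBump E)
  have hmer : MeromorphicOn (fun z => A z *
      gammaFactor (haarO F) ϖF ψ (resUnitChar (χ ^ 2)) (2 * z) *
        gammaFactor Q.haarE ϖE (Q.extendAddChar ψ) (χ ^ 2)⁻¹ (-z + 1 / 2) -
      kernelDist Q ϖF ϖE χ η (s + (z - t) / 2) z (unitBump E)) Set.univ := by
    intro z _
    have h1 : MeromorphicAt (fun z => gammaFactor (haarO F) ϖF ψ (resUnitChar (χ ^ 2)) (2 * z)) z :=
      (meromorphicAt_gammaFactor (haarO F) ϖF hψc hψ (resUnitChar (χ ^ 2))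
        (2 * z)).comp_analyticAt (g := fun z : ℂ => 2 * z) (by fun_prop)
    have h2 : MeromorphicAt (fun z => gammaFactor Q.haarE ϖE (Q.extendAddChar ψ) (χ ^ 2)⁻¹
        (-z + 1 / 2)) z :=
      (meromorphicAt_gammaFactor Q.haarE ϖE (continuous_extendAddChar Q hψc)
        (extendAddChar_ne_one Q hψ) (χ ^ 2)⁻¹
        (-z + 1 / 2)).comp_analyticAt (g := fun z : ℂ => -z + 1 / 2) (by fun_prop)
    exact (((hA.analyticAt z).meromorphicAt.mul h1).mul h2).sub (hC.analyticAt z).meromorphicAt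
  have hstrip : ∀ᶠ z in 𝓝 (1 / 4 : ℂ), A z *
      gammaFactor (haarO F) ϖF ψ (resUnitChar (χ ^ 2)) (2 * z) *
        gammaFactor Q.haarE ϖE (Q.extendAddChar ψ) (χ ^ 2)⁻¹ (-z + 1 / 2) -
      kernelDist Q ϖF ϖE χ η (s + (z - t) / 2) z (unitBump E) = 0 := by
    have hre : (1 / 4 : ℂ).re = 1 / 4 := by norm_num
    filter_upwards [Complex.continuous_re.continuousAt.eventually_const_lt
      (show (0 : ℝ) < (1 / 4 : ℂ).re by rw [hre]; norm_num),
      Complex.continuous_re.continuousAt.eventually_lt_const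
      (show (1 / 4 : ℂ).re < 1 / 2 by rw [hre]; norm_num)] with z hz hz'
    rw [← hAeq, kernelDist_unitBump_eq_residueConst Q ϖF ϖE χ η hψc hψ hχ
      (inSlash_shift χ η h z) hz hz', sub_self]
  filter_upwards [eventually_eq_zero_of_meromorphicOn hmer hstrip t] with z hz
  rw [hAeq]
  exact sub_eq_zero.1 hz

theorem tendsto_residueConst (hψc : Continuous ψ) (hψ : ψ ≠ 1)
    (hχ : resChar (twist ϖE χ 0) ϖF.val = 1) {s t : ℂ} (h : InSlash χ s η t) :
    Tendsto (fun z => residueConst Q ϖF ϖE ψ χ η (s + (z - t) / 2) z) (𝓝[≠] t)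
      (𝓝 (kernelDist Q ϖF ϖE χ η s t (unitBump E))) := by
  have hC := (differentiable_kernelDist_line Q ϖF ϖE χ η s t (unitBump E)).continuous.tendsto t
  simp only [sub_self, zero_div, add_zero] at hC
  refine (hC.mono_left nhdsWithin_le_nhds).congr' ?_
  filter_upwards [eventually_residueConst_eq Q ϖF ϖE χ η hψc hψ hχ h] with z hz using hz.symm

/-- Where neither gamma factor has a pole, the limit of the constant is its value. -/
theorem kernelDist_unitBump_eq_of_analyticAt (hψc : Continuous ψ) (hψ : ψ ≠ 1)
    (hχ : resChar (twist ϖE χ 0) ϖF.val = 1) {s t : ℂ} (h : InSlash χ s η t)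
    (h1 : AnalyticAt ℂ (gammaFactor (haarO F) ϖF ψ (resUnitChar (χ ^ 2))) (2 * t))
    (h2 : AnalyticAt ℂ (gammaFactor Q.haarE ϖE (Q.extendAddChar ψ) (χ ^ 2)⁻¹) (-t + 1 / 2)) :
    kernelDist Q ϖF ϖE χ η s t (unitBump E) = residueConst Q ϖF ϖE ψ χ η s t := by
  obtain ⟨A, hA, hAeq⟩ := exists_residueConst_eq Q ϖF ϖE (ψ := ψ) χ η hχ s t
  have hcont : ContinuousAt (fun z => residueConst Q ϖF ϖE ψ χ η (s + (z - t) / 2) z) t := by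
    simp only [hAeq]
    have h3 : ContinuousAt (fun z => gammaFactor (haarO F) ϖF ψ (resUnitChar (χ ^ 2)) (2 * z)) t :=
      ContinuousAt.comp (f := fun z : ℂ => 2 * z) h1.continuousAt (by fun_prop)
    have h4 : ContinuousAt (fun z => gammaFactor Q.haarE ϖE (Q.extendAddChar ψ) (χ ^ 2)⁻¹
        (-z + 1 / 2)) t :=
      ContinuousAt.comp (f := fun z : ℂ => -z + 1 / 2) h2.continuousAt (by fun_prop)
    exact (hA.continuous.continuousAt.mul h3).mul h4
  have h5 := hcont.tendsto.mono_left (nhdsWithin_le_nhds (s := {t}ᶜ))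
  simp only [sub_self, zero_div, add_zero] at h5
  exact tendsto_nhds_unique (tendsto_residueConst Q ϖF ϖE χ η hψc hψ hχ h) h5

end Constant

end ResidueIdentities

end

theorem mainTheorem2 {F E : Type*}
    [NontriviallyNormedField F] [IsUltrametricDist F] [ProperSpace F]
    [MeasurableSpace F] [BorelSpace F]
    [NontriviallyNormedField E] [IsUltrametricDist E] [ProperSpace E]
    [MeasurableSpace E] [BorelSpace E] [NormedAlgebra F E]
    (Q : ResidueIdentities.QuadraticGenerator F E)
    (ϖF : ResidueIdentities.Uniformizer F) (ϖE : ResidueIdentities.Uniformizer E)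
    (ψ : AddChar F Circle) (hψ_cont : Continuous ψ) (hψ : ψ ≠ 1)
    (χ : ResidueIdentities.UnitChar E) (η : ResidueIdentities.UnitChar F)
    (hχ : ResidueIdentities.resChar (ResidueIdentities.twist ϖE χ 0) ϖF.val = 1) :
    -- the objects in the identities exist
    (ResidueIdentities.IsRenormalizedKernel Q ϖF ϖE χ η
        (ResidueIdentities.renormalizedKernel Q ϖF ϖE χ η) ∧
      ResidueIdentities.IsHomogeneousFamily (ResidueIdentities.haarO F) ϖF (η ^ 2)⁻¹
        (ResidueIdentities.homogeneousFamily (ResidueIdentities.haarO F) ϖF (η ^ 2)⁻¹) ∧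
      ResidueIdentities.IsFourierConst (ResidueIdentities.haarO F) ψ
        (ResidueIdentities.fourierConst (ResidueIdentities.haarO F) ψ) ∧
      ResidueIdentities.IsGammaFactor (ResidueIdentities.haarO F) ϖF ψ
        (ResidueIdentities.resUnitChar (χ ^ 2))
        (ResidueIdentities.gammaFactor (ResidueIdentities.haarO F) ϖF ψ
          (ResidueIdentities.resUnitChar (χ ^ 2))) ∧
      ResidueIdentities.IsGammaFactor Q.haarE ϖE (Q.extendAddChar ψ) (χ ^ 2)⁻¹
        (ResidueIdentities.gammaFactor Q.haarE ϖE (Q.extendAddChar ψ) (χ ^ 2)⁻¹)) ∧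
    -- the identity on `\\`
    (∀ s t : ℂ, ResidueIdentities.InBackslash χ s η t →
      ResidueIdentities.renormalizedKernel Q ϖF ϖE χ η s t =
        (1 - (ResidueIdentities.residueCard F : ℂ)⁻¹) •
          ResidueIdentities.lineDistribution (E := E) ϖF η t) ∧
    -- the identity on `//`, at parameters where neither gamma factor has a pole
    (∀ s t : ℂ, ResidueIdentities.InSlash χ s η t →
      AnalyticAt ℂ (ResidueIdentities.gammaFactor (ResidueIdentities.haarO F) ϖF ψ
        (ResidueIdentities.resUnitChar (χ ^ 2))) (2 * t) →
      AnalyticAt ℂ (ResidueIdentities.gammaFactor Q.haarE ϖE (Q.extendAddChar ψ) (χ ^ 2)⁻¹)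
        (-t + 1 / 2) →
      ResidueIdentities.renormalizedKernel Q ϖF ϖE χ η s t =
        ResidueIdentities.residueConst Q ϖF ϖE ψ χ η s t • ResidueIdentities.dirac (0 : E)) ∧
    -- the identity on all of `//`: poles of the gamma factors are removable singularities of the
    -- constant along the hyperplane `2s' - t' = 2s - t`
    (∀ s t : ℂ, ResidueIdentities.InSlash χ s η t →
      ∃ κ : ℂ,
        Tendsto (fun t' : ℂ =>
            ResidueIdentities.residueConst Q ϖF ϖE ψ χ η (s + (t' - t) / 2) t')
          (𝓝[≠] t) (𝓝 κ) ∧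
        ResidueIdentities.renormalizedKernel Q ϖF ϖE χ η s t =
          κ • ResidueIdentities.dirac (0 : E)) := by
  have hT := ResidueIdentities.renormalizedKernel_eq Q ϖF ϖE χ η hχ
  refine ⟨⟨?_, ?_, ResidueIdentities.isFourierConst_fourierConst _ ϖF hψ_cont hψ,
    ResidueIdentities.isGammaFactor_gammaFactor _ ϖF hψ_cont hψ _,
    ResidueIdentities.isGammaFactor_gammaFactor _ ϖE
      (ResidueIdentities.continuous_extendAddChar Q hψ_cont)
      (ResidueIdentities.extendAddChar_ne_one Q hψ) _⟩,
    fun s t h => ?_, fun s t h h1 h2 => ?_, fun s t h => ⟨_,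
      ResidueIdentities.tendsto_residueConst Q ϖF ϖE χ η hψ_cont hψ hχ h, ?_⟩⟩
  · rw [hT]
    exact ResidueIdentities.isRenormalizedKernel_kernelDist Q ϖF ϖE χ η hχ
  · rw [ResidueIdentities.homogeneousFamily_eq]
    exact ResidueIdentities.isHomogeneousFamily_homDist _ ϖF _
  · rw [hT]
    exact ResidueIdentities.kernelDist_eq_lineDistribution Q ϖF ϖE χ η hχ h
  · rw [hT, ← ResidueIdentities.kernelDist_unitBump_eq_of_analyticAt Q ϖF ϖE χ η hψ_cont hψ hχ
      h h1 h2]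
    exact ResidueIdentities.kernelDist_eq_smul_dirac Q ϖF ϖE χ η hχ h
  · rw [hT]
    exact ResidueIdentities.kernelDist_eq_smul_dirac Q ϖF ϖE χ η hχ h
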